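/- Let $M$ be a smooth $d$-dimensional manifold (Hausdorff, second countable, without boundary), let $n\ge 1$, and let $\mathcal M=\{(x_1,\dots,x_n)\in M^n : x_i\ne x_j \text{ for } i\neq j\}$ be the landmark manifold. Let $T>0$, let $\sigma_1,\dots,\sigma_J$ be linearly independent vector fields of class $C^1$ on $M$ (for instance $H^s$ vector fields with $s>\frac d2+1$) such that every nonzero vector field in $\operatorname{span}\{\sigma_1,\dots,\sigma_J\}$ vanishes at no more than $n-1$ points of $M$, and let $a_t$, $t\in[0,T]$, be a time-dependent vector field on $M$ which, in charts, is jointly continuous in $(t,x)$ together with its first derivatives in $x$. Fix $\mathbf o=(o_1,\dots,o_n)\in\mathcal M$. For a control $u\in L^2([0,T];\mathbb R^J)$, the trajectory of $u$ is the absolutely continuous curve $\boldsymbol\gamma=(\gamma_1,\dots,\gamma_n)$ in $\mathcal M$, if it exists on $[0,T]$, with $$\dot\gamma_{r,t}=\sum_{j=1}^J u_{j,t}\,\sigma_j(\gamma_{r,t})+a_t(\gamma_{r,t})\ \text{ for a.e. } t,\qquad \gamma_{r,0}=o_r,\qquad r=1,\dots,n,$$ and $\Pi(u)=\boldsymbol\gamma_T\in\mathcal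 M$ is its endpoint ($\Pi$ is defined on an open set of controls). These are the trajectories of the stochastic equation $d\mathbf x_t=\sum_j\boldsymbol\sigma_j(\mathbf x_t)\circ dB^j_t+\mathbf a_t(\mathbf x_t)\,dt$, where $\boldsymbol\sigma_j(\mathbf x)=(\sigma_j(x_1),\dots,\sigma_j(x_n))$ and similarly for $\mathbf a_t$, with the standard Brownian motion $B$ in $\mathbb R^J$ replaced by $\omega=\int_0^{\cdot}u_t\,dt$. A curve $\boldsymbol\gamma$ is called *singular* if it is the trajectory of some $u\in L^2([0,T];\mathbb R^J)$ at which the differential of $\Pi$ is not surjective onto $T_{\Pi(u)}\mathcal M$. It is called a *most probable path* if it is the trajectory of some $u\in L^2([0,T];\mathbb R^J)$ that minimizes the Onsager–Machlup functional $\frac12\int_0^T|u_t|^2\,dt$ among all $v\in L^2([0,T];\mathbb R^J)$ with a trajectory on $[0,T]$ from $\mathbf o$ to the same endpoint $\boldsymbol\gamma_T$. Let $c\in L^2([0,T];\mathbb R^J)$, put $z_t=\sum_{j=1}^J c_{j,t}\sigma_j$, and let $\boldsymbol\gamma$ be the trajectory of $c$, so that $\dot\gamma_{r,t}=(z_t+a_t)(\gamma_{r,t})$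 and $\gamma_{r,0}=o_r$. Consider forms $\lambda_{r,t}\in T^*_{\gamma_{r,t}}M$ along $\gamma_r$, $r=1,\dots,n$, such that for every smooth vector field $W$ on $M$ the function $t\mapsto\lambda_{r,t}(W)=\lambda_{r,t}(W(\gamma_{r,t}))$ is absolutely continuous on $[0,T]$ with $$\frac{d}{dt}\lambda_{r,t}(W)=\lambda_{r,t}([z_t+a_t,W])\quad\text{for a.e. } t. \tag{1}$$ (a) The curve $\boldsymbol\gamma$ is singular if and only if there are solutions $\lambda_1,\dots,\lambda_n$ of (1) such that for no $t\in[0,T]$ all of $\lambda_{1,t},\dots,\lambda_{n,t}$ are zero, and $$\sum_{r=1}^n\lambda_{r,t}(\sigma_j(\gamma_{r,t}))=0,\qquad j=1,\dots,J,\quad t\in[0,T].$$ (b) If $\boldsymbol\gamma$ is a most probable path and not singular, then there are solutions $\lambda_1,\dots,\lambda_n$ of (1) such that $$\sum_{r=1}^n\lambda_{r,t}(\sigma_j(\gamma_{r,t}))=c_{j,t},\qquad j=1,\dots,J,\quad \text{for a.e. } t\in[0,T].$$ -/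

import Mathlib

open Set MeasureTheory
open scoped Manifold ContDiff ENNReal

noncomputable section

namespace Landmark

/-- `f` is absolutely continuous on `[0, T]`, with `f' = g` almost everywhere. -/
def HasACDeriv (T : ℝ) (f g : ℝ → ℝ) : Prop :=
  IntervalIntegrable g volume 0 T ∧ ∀ t ∈ Icc 0 T, f t = f 0 + ∫ s in (0 : ℝ)..t, g s

/-- The landmark manifold: configurations of `n` distinct points of `M`. It is an open subset of
`M ^ n`, so its tangent space at `x` is `∀ r, TangentSpace (x r)`. -/
abbrev Config (M : Type*) (n : ℕ) : Type _ := {x : Fin n → M // Function.Injective x}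

/-- The controls, i.e. the derivatives `ω'` of the elements `ω` of the Cameron-Martin space of
standard Brownian motion in `ℝ ^ J` on `[0, T]`; the map `ω ↦ ω'` is an isometry onto `L²`. -/
abbrev Control (J : ℕ) (T : ℝ) : Type :=
  Lp (EuclideanSpace ℝ (Fin J)) 2 (volume.restrict (Icc (0 : ℝ) T))

/-- The Onsager-Machlup functional `1/2 ∫ |ω'|²` of standard Brownian motion in `ℝ ^ J`. -/
def onsagerMachlup {J : ℕ} {T : ℝ} (u : Control J T) : ℝ :=
  (1 / 2) * ∫ t in Icc (0 : ℝ) T, ‖u t‖ ^ 2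

variable {d : ℕ} {M : Type*} [TopologicalSpace M] [ChartedSpace (EuclideanSpace ℝ (Fin d)) M]
  [IsManifold (𝓡 d) ∞ M]

/-- A vector field of class `C¹`. -/
def IsC1Field (V : ∀ x : M, TangentSpace (𝓡 d) x) : Prop :=
  ContMDiff (𝓡 d) (𝓡 d).tangent 1 (fun x => (⟨x, V x⟩ : TangentBundle (𝓡 d) M))

/-- A smooth vector field, i.e. an element of `Γ(TM)`. -/
def IsSmoothField (W : ∀ x : M, TangentSpace (𝓡 d) x) : Prop :=
  ContMDiff (𝓡 d) (𝓡 d).tangent ∞ (fun x => (⟨x, W x⟩ : TangentBundle (𝓡 d) M))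

/-- The components of a vector field in the chart around `x₀`, as a function of the coordinates. -/
def localRep (x₀ : M) (V : ∀ x : M, TangentSpace (𝓡 d) x) (y : EuclideanSpace ℝ (Fin d)) :
    EuclideanSpace ℝ (Fin d) :=
  mfderiv (𝓡 d) 𝓘(ℝ, EuclideanSpace ℝ (Fin d)) (extChartAt (𝓡 d) x₀)
    ((extChartAt (𝓡 d) x₀).symm y) (V ((extChartAt (𝓡 d) x₀).symm y))

/-- A time-dependent vector field on `[0, T]` that is, in every chart, jointly continuous in time
and space together with its first derivatives in space. -/
def IsC1TimeField (T : ℝ) (a : ℝ → ∀ x : M, TangentSpace (𝓡 d) x) : Prop :=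
  ∀ x₀ : M,
    ContinuousOn (fun p : ℝ × EuclideanSpace ℝ (Fin d) => localRep x₀ (a p.1) p.2)
      (Icc 0 T ×ˢ (extChartAt (𝓡 d) x₀).target) ∧
    (∀ t ∈ Icc 0 T, DifferentiableOn ℝ (localRep x₀ (a t)) (extChartAt (𝓡 d) x₀).target) ∧
    ContinuousOn (fun p : ℝ × EuclideanSpace ℝ (Fin d) => fderiv ℝ (localRep x₀ (a p.1)) p.2)
      (Icc 0 T ×ˢ (extChartAt (𝓡 d) x₀).target)

/-- Every nonzero vector field in the span of the `σ j` vanishes at no more than `n - 1` points. -/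
def FewZeros {J : ℕ} (n : ℕ) (σ : Fin J → ∀ x : M, TangentSpace (𝓡 d) x) : Prop :=
  ∀ V ∈ Submodule.span ℝ (range σ), V ≠ 0 → {x : M | V x = 0}.encard < n

/-- The vector field `z_t + a_t`, where `z_t = ∑ j, c_{j,t} σ_j`. -/
def velocity {J : ℕ} (σ : Fin J → ∀ x : M, TangentSpace (𝓡 d) x)
    (a : ℝ → ∀ x : M, TangentSpace (𝓡 d) x) (c : ℝ → EuclideanSpace ℝ (Fin J)) (t : ℝ) :
    ∀ x : M, TangentSpace (𝓡 d) x :=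
  fun x => ∑ j, c t j • σ j x + a t x

/-- The curve `γ` in the landmark manifold is, on `[0, T]`, the absolutely continuous solution of
`γ' = (z_t + a_t)(γ)`, `γ 0 = o`. On a manifold this is tested on smooth functions: `f ∘ γ_r` is
absolutely continuous with derivative `df(z_t + a_t)(γ_r)` a.e., for each landmark `r`. -/
def IsTrajectory {n J : ℕ} (σ : Fin J → ∀ x : M, TangentSpace (𝓡 d) x)
    (a : ℝ → ∀ x : M, TangentSpace (𝓡 d) x) (T : ℝ) (o : Config M n)
    (c : ℝ → EuclideanSpace ℝ (Fin J)) (γ : ℝ → Config M n) : Prop :=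
  γ 0 = o ∧ ContinuousOn γ (Icc 0 T) ∧
    ∀ (r : Fin n) (f : M → ℝ), ContMDiff (𝓡 d) 𝓘(ℝ, ℝ) ∞ f →
      HasACDeriv T (fun t => f ((γ t).1 r))
        (fun t => mfderiv (𝓡 d) 𝓘(ℝ, ℝ) f ((γ t).1 r) (velocity σ a c t ((γ t).1 r)))

open Classical in
/-- The endpoint map `Π : ω ↦ γ_T`. It is a partial map with open domain, the controls for which the
solution exists up to time `T`; off the domain it has the irrelevant value `o`. -/
def endpoint {n J : ℕ} (σ : Fin J → ∀ x : M, TangentSpace (𝓡 d) x)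
    (a : ℝ → ∀ x : M, TangentSpace (𝓡 d) x) (T : ℝ) (o : Config M n) (u : Control J T) :
    Config M n :=
  if h : ∃ γ : ℝ → Config M n, IsTrajectory σ a T o u γ then h.choose T else o

/-- The differential of the endpoint map at `u`, with values in the tangent space of the landmark
manifold, is onto. -/
def IsRegularControl {n J : ℕ} (σ : Fin J → ∀ x : M, TangentSpace (𝓡 d) x)
    (a : ℝ → ∀ x : M, TangentSpace (𝓡 d) x) (T : ℝ) (o : Config M n) (u : Control J T) : Prop :=
  Function.Surjective
    (fun (k : Control J T) (r : Fin n) =>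
      (mfderiv 𝓘(ℝ, Control J T) (𝓡 d) (fun v => (endpoint σ a T o v).1 r) u k :
        TangentSpace (𝓡 d) ((endpoint σ a T o u).1 r)))

/-- `γ` is singular: it is the solution for a control that is not a regular point. -/
def IsSingularCurve {n J : ℕ} (σ : Fin J → ∀ x : M, TangentSpace (𝓡 d) x)
    (a : ℝ → ∀ x : M, TangentSpace (𝓡 d) x) (T : ℝ) (o : Config M n)
    (γ : ℝ → Config M n) : Prop :=
  ∃ u : Control J T, IsTrajectory σ a T o u γ ∧ ¬ IsRegularControl σ a T o u

/-- `γ` is a most probable path: it is the solution for a control that minimizes the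
Onsager-Machlup functional among all controls whose solution from `o` ends at the same point. -/
def IsMostProbablePath {n J : ℕ} (σ : Fin J → ∀ x : M, TangentSpace (𝓡 d) x)
    (a : ℝ → ∀ x : M, TangentSpace (𝓡 d) x) (T : ℝ) (o : Config M n)
    (γ : ℝ → Config M n) : Prop :=
  ∃ u : Control J T, IsTrajectory σ a T o u γ ∧
    ∀ (v : Control J T) (η : ℝ → Config M n), IsTrajectory σ a T o v η → η T = γ T →
      onsagerMachlup u ≤ onsagerMachlup v

/-- The forms `l r t` along `γ_r` solve `d/dt l_r(W) = l_r([z_t + a_t, W])` on `[0, T]` for all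
smooth vector fields `W`, in the absolutely continuous sense. -/
def IsCostate {n J : ℕ} (σ : Fin J → ∀ x : M, TangentSpace (𝓡 d) x)
    (a : ℝ → ∀ x : M, TangentSpace (𝓡 d) x) (T : ℝ) (c : ℝ → EuclideanSpace ℝ (Fin J))
    (γ : ℝ → Config M n) (l : ∀ (r : Fin n) (t : ℝ), TangentSpace (𝓡 d) ((γ t).1 r) →L[ℝ] ℝ) :
    Prop :=
  ∀ (r : Fin n) (W : ∀ x : M, TangentSpace (𝓡 d) x), IsSmoothField W →
    HasACDeriv T (fun t => l r t (W ((γ t).1 r)))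
      (fun t => l r t (VectorField.mlieBracket (𝓡 d) (velocity σ a c t) W ((γ t).1 r)))

end Landmark

end

/-! Everything is moved to a finite-dimensional vector space. The range of a trajectory is compact,
so finitely many cut-off charts together with a partition of unity map `M` into such a space, and
near the range this map (`Cover.emb`) is injective with injective differential. Vector fields extend
to an open set of the ambient space (`Cover.extField`), and solutions of the extended equation that
start on the image of `M` stay on it (`Cover.exists_emb_eq`, a Grönwall argument along the fibres of
a chart projection).

In the ambient space a trajectory solves y = y₀ + ∑ ∫ u_j σ_j(y) + ∫ a(y) in the space of continuous
paths. The partial differential in y is the identity minus a Volterra operator, which is invertible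
however large its integrable coefficient is, because its powers decay like 1/k!. The implicit
function theorem therefore makes y strictly differentiable in u (`exists_flow`), and the derivative
ξ in the direction k solves ξ' = A ξ + ∑ k_j σ_j, ξ_0 = 0, where A is the linearization along the
curve.

The costates are exactly the restrictions to the tangent spaces of solutions of the dual equation Λ'
= -Λ A. One direction is the product rule combined with the ambient formula for the Lie bracket
(`IsTrajectory.isCostate_pullback`); the other is uniqueness for (1) (`IsCostate.eq_zero`). In d/dt
Λ(ξ) the terms with A cancel. Hence the terminal costate, paired with the differential of Π in the
direction k, equals the L² inner product of k with the momentum p, where p_j = ∑_r λ_r(σ_j)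
(`Cover.IsDualSolution.sum_apply_endpoint`).

For (a): the differential of Π fails to be onto exactly when a nonzero covector at the endpoint
kills its image, that is, when p is orthogonal to all controls, so p = 0. Uniqueness makes the
costate nonzero at all times. For (b): at a regular minimizer the Lagrange multiplier rule gives a
terminal covector for which k has the same inner product with p and with u for every k, so p = u.
Both notions quantify over the controls that produce the curve; there is only one, since two
different ones would differ at some time by a nonzero field of the span with n distinct zeros
(`eq_of_velocity_eq`). -/

noncomputable section

open Set MeasureTheory Filter Topology
open scoped Manifold ContDiff ENNReal NNReal

namespace Landmark

/-! ### Absolutely continuous functions and Grönwall estimates with integrable weights -/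

section Primitive

variable {E F G : Type*} [NormedAddCommGroup E] [NormedSpace ℝ E] [NormedAddCommGroup F]
  [NormedSpace ℝ F] [NormedAddCommGroup G] [NormedSpace ℝ G]

/-- `f` is absolutely continuous on `[a, b]` with derivative `g` almost everywhere. -/
def IsPrimitiveOn (a b : ℝ) (f g : ℝ → F) : Prop :=
  IntervalIntegrable g volume a b ∧ ∀ t ∈ Icc a b, f t = f a + ∫ s in a..t, g s

lemma intervalIntegrable_mono_Icc {F : Type*} [NormedAddCommGroup F]
    {a b s t : ℝ} {g : ℝ → F} (hg : IntervalIntegrable g volume a b)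
    (hs : s ∈ Icc a b) (ht : t ∈ Icc a b) : IntervalIntegrable g volume s t :=
  hg.mono_set (by
    have hab : a ≤ b := hs.1.trans hs.2
    rw [uIcc_of_le hab]
    exact uIcc_subset_Icc hs ht)

/-- Absolute continuity passes to any function whose increments are dominated; here `m` will be an
indefinite integral. -/
lemma absolutelyContinuousOnInterval_of_dist_le {F : Type*} [NormedAddCommGroup F]
    {a b : ℝ} {f : ℝ → F} {m : ℝ → ℝ}
    (hm : AbsolutelyContinuousOnInterval m a b)
    (h : ∀ s ∈ uIcc a b, ∀ t ∈ uIcc a b, dist (f s) (f t) ≤ dist (m s) (m t)) :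
    AbsolutelyContinuousOnInterval f a b := by
  refine squeeze_zero' (Eventually.of_forall fun E => Finset.sum_nonneg fun _ _ => dist_nonneg)
    ?_ hm
  filter_upwards [mem_inf_of_right (mem_principal_self _)] with E hE
  exact Finset.sum_le_sum fun i hi => h _ (hE.1 i hi).1 _ (hE.1 i hi).2

namespace IsPrimitiveOn

variable {a b : ℝ} {f g : ℝ → F}

lemma integral_eq (h : IsPrimitiveOn a b f g) {s t : ℝ} (hs : s ∈ Icc a b) (ht : t ∈ Icc a b) :
    f t = f s + ∫ r in s..t, g r := by
  have hab : a ≤ b := hs.1.trans hs.2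
  rw [h.2 t ht, h.2 s hs, add_assoc, intervalIntegral.integral_add_adjacent_intervals]
  · exact intervalIntegrable_mono_Icc h.1 ⟨le_rfl, hab⟩ hs
  · exact intervalIntegrable_mono_Icc h.1 hs ht

lemma mono (h : IsPrimitiveOn a b f g) {c d : ℝ} (hc : c ∈ Icc a b) (hd : d ∈ Icc a b) :
    IsPrimitiveOn c d f g :=
  ⟨intervalIntegrable_mono_Icc h.1 hc hd, fun _ ht =>
    h.integral_eq hc ⟨hc.1.trans ht.1, ht.2.trans hd.2⟩⟩

lemma continuousOn (h : IsPrimitiveOn a b f g) : ContinuousOn f (Icc a b) := by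
  rcases le_or_gt a b with hab | hab
  · have := intervalIntegral.continuousOn_primitive_interval (μ := volume) (f := g) (a := a)
      (b := b) (by rw [uIcc_of_le hab]; exact (intervalIntegrable_iff_integrableOn_Icc_of_le hab).1 h.1)
    rw [uIcc_of_le hab] at this
    exact (continuousOn_const.add this).congr h.2
  · simp [Icc_eq_empty_of_lt hab]

lemma congr (h : IsPrimitiveOn a b f g) (hab : a ≤ b) {f₁ g₁ : ℝ → F}
    (hf : EqOn f₁ f (Icc a b)) (hg : ∀ᵐ t, t ∈ Icc a b → g₁ t = g t) :
    IsPrimitiveOn a b f₁ g₁ := by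
  constructor
  · refine h.1.congr_ae ?_
    rw [uIoc_of_le hab]
    refine (ae_restrict_iff' measurableSet_Ioc).2 (hg.mono fun t ht h't => ?_)
    exact (ht ⟨h't.1.le, h't.2⟩).symm
  · intro t ht
    rw [hf ht, hf ⟨le_rfl, hab⟩, h.2 t ht]
    congr 1
    refine intervalIntegral.integral_congr_ae (hg.mono fun s hs h's => ?_)
    rw [uIoc_of_le ht.1] at h's
    exact (hs ⟨h's.1.le, h's.2.trans ht.2⟩).symm

lemma of_eq {c : F} (hab : a ≤ b) (hg : IntervalIntegrable g volume a b)
    (h : ∀ t ∈ Icc a b, f t = c + ∫ s in a..t, g s) : IsPrimitiveOn a b f g := by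
  refine ⟨hg, fun t ht => ?_⟩
  rw [h t ht, h a ⟨le_rfl, hab⟩, intervalIntegral.integral_same, add_zero]

lemma add (h : IsPrimitiveOn a b f g) {f₁ g₁ : ℝ → F} (h₁ : IsPrimitiveOn a b f₁ g₁) :
    IsPrimitiveOn a b (fun t => f t + f₁ t) (fun t => g t + g₁ t) := by
  refine ⟨h.1.add h₁.1, fun t ht => ?_⟩
  have hab : a ≤ b := ht.1.trans ht.2
  have ha : a ∈ Icc a b := ⟨le_rfl, hab⟩
  beta_reduce
  rw [h.2 t ht, h₁.2 t ht, intervalIntegral.integral_add (intervalIntegrable_mono_Icc h.1 ha ht)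
    (intervalIntegrable_mono_Icc h₁.1 ha ht)]
  abel

lemma sub (h : IsPrimitiveOn a b f g) {f₁ g₁ : ℝ → F} (h₁ : IsPrimitiveOn a b f₁ g₁) :
    IsPrimitiveOn a b (fun t => f t - f₁ t) (fun t => g t - g₁ t) := by
  refine ⟨h.1.sub h₁.1, fun t ht => ?_⟩
  have hab : a ≤ b := ht.1.trans ht.2
  have ha : a ∈ Icc a b := ⟨le_rfl, hab⟩
  beta_reduce
  rw [h.2 t ht, h₁.2 t ht, intervalIntegral.integral_sub (intervalIntegrable_mono_Icc h.1 ha ht)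
    (intervalIntegrable_mono_Icc h₁.1 ha ht)]
  abel

lemma clm_apply [CompleteSpace F] [CompleteSpace E] (h : IsPrimitiveOn a b f g) (L : F →L[ℝ] E) :
    IsPrimitiveOn a b (fun t => L (f t)) (fun t => L (g t)) := by
  have hi : ∀ {s t : ℝ}, IntervalIntegrable g volume s t →
      IntervalIntegrable (fun t => L (g t)) volume s t := fun hg =>
    ⟨L.integrable_comp hg.1, L.integrable_comp hg.2⟩
  refine ⟨hi h.1, fun t ht => ?_⟩
  have hab : a ≤ b := ht.1.trans ht.2
  beta_reduce
  rw [h.2 t ht, map_add, L.intervalIntegral_comp_comm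
    (intervalIntegrable_mono_Icc h.1 ⟨le_rfl, hab⟩ ht)]

lemma prodMk [CompleteSpace F] [CompleteSpace E] (h : IsPrimitiveOn a b f g) {f₁ g₁ : ℝ → E}
    (h₁ : IsPrimitiveOn a b f₁ g₁) :
    IsPrimitiveOn a b (fun t => (f t, f₁ t)) (fun t => (g t, g₁ t)) := by
  simpa using (h.clm_apply (ContinuousLinearMap.inl ℝ F E)).add
    (h₁.clm_apply (ContinuousLinearMap.inr ℝ F E))

lemma ae_hasDerivAt [CompleteSpace F] (h : IsPrimitiveOn a b f g) :
    ∀ᵐ t, t ∈ Icc a b → HasDerivWithinAt f (g t) (Icc a b) t := by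
  filter_upwards [h.1.ae_hasDerivAt_integral] with t ht htab
  have hab : a ≤ b := htab.1.trans htab.2
  rw [uIcc_of_le hab] at ht
  have := ((ht htab a ⟨le_rfl, hab⟩).const_add (f a)).hasDerivWithinAt (s := Icc a b)
  exact this.congr h.2 (h.2 t htab)

/-- A derivative almost everywhere does not determine a function, as the Cantor function shows. The
increment bound by `∫ m` supplies the missing absolute continuity: the difference of `f` and the
integral of `g` is absolutely continuous with derivative zero almost everywhere, hence constant. -/
lemma of_ae_hasDerivAt [CompleteSpace F] (hab : a ≤ b) (hg : IntervalIntegrable g volume a b)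
    {m : ℝ → ℝ} (hm : IntervalIntegrable m volume a b)
    (hfm : ∀ s ∈ Icc a b, ∀ t ∈ Icc a b, s ≤ t → ‖f t - f s‖ ≤ ∫ r in s..t, m r)
    (hf : ∀ᵐ t, t ∈ Icc a b → HasDerivWithinAt f (g t) (Icc a b) t) : IsPrimitiveOn a b f g := by
  refine ⟨hg, ?_⟩
  have ha : a ∈ Icc a b := ⟨le_rfl, hab⟩
  have hP : IsPrimitiveOn a b (fun t => ∫ s in a..t, g s) g := ⟨hg, fun t _ => by simp⟩
  let N : ℝ → ℝ := fun t => ∫ s in a..t, (m s + ‖g s‖)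
  have hN : IntervalIntegrable (fun s => m s + ‖g s‖) volume a b := hm.add hg.norm
  have hac : AbsolutelyContinuousOnInterval (fun t => f t - ∫ s in a..t, g s) a b := by
    refine absolutelyContinuousOnInterval_of_dist_le
      (hN.absolutelyContinuousOnInterval_intervalIntegral (c := a) left_mem_uIcc) ?_
    rw [uIcc_of_le hab]
    have key : ∀ s ∈ Icc a b, ∀ t ∈ Icc a b, s ≤ t →
        dist (f s - ∫ r in a..s, g r) (f t - ∫ r in a..t, g r) ≤ dist (N s) (N t) := by
      intro s hs t ht hst
      have e1 : N t - N s = (∫ r in s..t, m r) + ∫ r in s..t, ‖g r‖ := by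
        rw [intervalIntegral.integral_interval_sub_left (intervalIntegrable_mono_Icc hN ha ht)
          (intervalIntegrable_mono_Icc hN ha hs), intervalIntegral.integral_add
          (intervalIntegrable_mono_Icc hm hs ht) (intervalIntegrable_mono_Icc hg hs ht).norm]
      have e2 : (∫ r in a..t, g r) - (∫ r in a..s, g r) = ∫ r in s..t, g r :=
        intervalIntegral.integral_interval_sub_left (intervalIntegrable_mono_Icc hg ha ht)
          (intervalIntegrable_mono_Icc hg ha hs)
      rw [dist_comm (N s), Real.dist_eq, e1, dist_comm, dist_eq_norm, sub_sub_sub_comm, e2]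
      refine le_trans ?_ (le_abs_self _)
      exact (norm_sub_le _ _).trans (add_le_add (hfm s hs t ht hst)
        (intervalIntegral.norm_integral_le_integral_norm hst))
    intro s hs t ht
    rcases le_total s t with hst | hst
    · exact key s hs t ht hst
    · rw [dist_comm, dist_comm (N s)]
      exact key t ht s hs hst
  obtain ⟨C, hC⟩ := hac.const_of_ae_hasDerivAt_zero (by
    -- Away from the two endpoints, a null set, derivatives within the interval are genuine
    -- derivatives.
    have h₁ : ∀ᵐ x : ℝ, x ≠ a := by simp [ae_iff, measure_singleton]
    have h₂ : ∀ᵐ x : ℝ, x ≠ b := by simp [ae_iff, measure_singleton]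
    filter_upwards [hf, hP.ae_hasDerivAt, h₁, h₂] with t h1 h2 h3 h4 ht
    rw [uIcc_of_le hab] at ht
    have hn : Icc a b ∈ 𝓝 t := Icc_mem_nhds (lt_of_le_of_ne ht.1 h3.symm) (lt_of_le_of_ne ht.2 h4)
    simpa using ((h1 ht).hasDerivAt hn).fun_sub ((h2 ht).hasDerivAt hn))
  rw [uIcc_of_le hab] at hC
  intro t ht
  have h1 := hC t ht
  have h2 := hC a ha
  simp only [intervalIntegral.integral_same, sub_zero] at h2
  rw [h2, ← h1]
  abel

lemma norm_sub_le (h : IsPrimitiveOn a b f g) {s t : ℝ} (hs : s ∈ Icc a b) (ht : t ∈ Icc a b)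
    (hst : s ≤ t) : ‖f t - f s‖ ≤ ∫ r in s..t, ‖g r‖ := by
  rw [h.integral_eq hs ht, add_sub_cancel_left]
  exact intervalIntegral.norm_integral_le_integral_norm hst

lemma _root_.Landmark.intervalIntegrable_clm_apply {a b : ℝ} (hab : a ≤ b) {L : ℝ → F →L[ℝ] E}
    {g : ℝ → F} (hL : ContinuousOn L (Icc a b)) (hg : IntervalIntegrable g volume a b) :
    IntervalIntegrable (fun t => L t (g t)) volume a b := by
  rw [intervalIntegrable_iff_integrableOn_Icc_of_le hab] at hg ⊢
  obtain ⟨C, hC⟩ := isCompact_Icc.exists_bound_of_continuousOn hL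
  refine Integrable.mono' (hg.norm.const_mul C) ?_ ?_
  · exact (ContinuousLinearMap.apply ℝ E (E := F)).flip.aestronglyMeasurable_comp₂
      (hL.aestronglyMeasurable measurableSet_Icc) hg.1
  · refine (ae_restrict_iff' measurableSet_Icc).2 (Eventually.of_forall fun t ht => ?_)
    exact ((L t).le_opNorm _).trans (mul_le_mul_of_nonneg_right (hC t ht) (norm_nonneg _))

/-- The chain rule for absolutely continuous functions. -/
lemma comp [CompleteSpace F] [CompleteSpace E] (h : IsPrimitiveOn a b f g) (hab : a ≤ b)
    {H : F → E} (hH : ∀ t ∈ Icc a b, ContDiffAt ℝ 1 H (f t)) :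
    IsPrimitiveOn a b (fun t => H (f t)) (fun t => fderiv ℝ H (f t) (g t)) := by
  have hfc := h.continuousOn
  have hc : ContinuousOn (fun t => fderiv ℝ H (f t)) (Icc a b) := fun t ht =>
    ((hH t ht).continuousAt_fderiv one_ne_zero).comp_continuousWithinAt (hfc t ht)
  -- On the compact image of `f` the map `H` is Lipschitz, so `C * ‖g‖` dominates the increments of
  -- `H ∘ f`.
  obtain ⟨C, hC⟩ := LocallyLipschitzOn.exists_lipschitzOnWith_of_compact (f := H)
    (isCompact_Icc.image_of_continuousOn hfc) (by
      rintro _ ⟨t, ht, rfl⟩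
      obtain ⟨K, s, hs, hK⟩ := (hH t ht).exists_lipschitzOnWith
      exact ⟨K, s, mem_nhdsWithin_of_mem_nhds hs, hK⟩)
  refine of_ae_hasDerivAt (m := fun t => C * ‖g t‖) hab (intervalIntegrable_clm_apply hab hc h.1)
    (h.1.norm.const_mul _) ?_ ?_
  · intro s hs t ht hst
    rw [intervalIntegral.integral_const_mul]
    refine (hC.norm_sub_le (mem_image_of_mem _ ht) (mem_image_of_mem _ hs)).trans ?_
    exact mul_le_mul_of_nonneg_left (h.norm_sub_le hs ht hst) C.2
  · filter_upwards [h.ae_hasDerivAt] with t ht htab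
    exact ((hH t htab).differentiableAt one_ne_zero).hasFDerivAt.comp_hasDerivWithinAt t (ht htab)

/-- The product rule for absolutely continuous functions. -/
lemma clm_apply_apply [CompleteSpace F] [CompleteSpace E] (hab : a ≤ b) {L L' : ℝ → F →L[ℝ] E}
    (hL : IsPrimitiveOn a b L L') (h : IsPrimitiveOn a b f g) :
    IsPrimitiveOn a b (fun t => L t (f t)) (fun t => L' t (f t) + L t (g t)) := by
  have hB : IsBoundedBilinearMap ℝ (fun p : (F →L[ℝ] E) × F => p.1 p.2) :=
    isBoundedBilinearMap_apply
  have := (hL.prodMk h).comp hab (H := fun p : (F →L[ℝ] E) × F => p.1 p.2)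
    fun t _ => hB.contDiff.contDiffAt
  refine this.congr hab (fun _ _ => rfl) (Eventually.of_forall fun t _ => ?_)
  rw [(hB.hasFDerivAt _).fderiv]
  simp [add_comm]

end IsPrimitiveOn

/-- The powers of a primitive of `m`. -/
lemma integral_pow_primitive_mul {a b : ℝ} {m : ℝ → ℝ} (hab : a ≤ b)
    (hm : IntervalIntegrable m volume a b) (k : ℕ) {t : ℝ} (ht : t ∈ Icc a b) :
    ∫ s in a..t, m s * (∫ r in a..s, m r) ^ k = (∫ r in a..t, m r) ^ (k + 1) / (k + 1) := by
  have hP : IsPrimitiveOn a b (fun t => ∫ s in a..t, m s) m := ⟨hm, fun t _ => by simp⟩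
  have h2 := hP.comp hab (H := fun x : ℝ => x ^ (k + 1) / (k + 1)) fun t _ => by fun_prop
  have h3 := h2.2 t ht
  simp only [intervalIntegral.integral_same, ne_eq, Nat.succ_ne_zero, not_false_eq_true, zero_pow,
    zero_div, zero_add] at h3
  rw [h3]
  congr 1
  ext s
  have : HasDerivAt (fun x : ℝ => x ^ (k + 1) / (k + 1)) ((∫ r in a..s, m r) ^ k)
      (∫ r in a..s, m r) := by
    have := (hasDerivAt_pow (k + 1) (∫ r in a..s, m r)).div_const ((k : ℝ) + 1)
    refine this.congr_deriv ?_
    have : (k : ℝ) + 1 ≠ 0 := by positivity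
    push_cast
    simp [mul_div_cancel_left₀ _ this]
  rw [this.hasFDerivAt.fderiv]
  simp

/-- Iterated Grönwall estimate. -/
lemma le_pow_of_le_integral {a b : ℝ} {m : ℝ → ℝ} (hab : a ≤ b)
    (hm : IntervalIntegrable m volume a b) (hm0 : ∀ t, 0 ≤ m t) {φ : ℕ → ℝ → ℝ} {C : ℝ}
    (hφ : ∀ k, ContinuousOn (φ k) (Icc a b)) (h0 : ∀ t ∈ Icc a b, φ 0 t ≤ C)
    (hle : ∀ k, ∀ t ∈ Icc a b, φ (k + 1) t ≤ ∫ s in a..t, m s * φ k s) (k : ℕ) :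
    ∀ t ∈ Icc a b, φ k t ≤ C * (∫ s in a..t, m s) ^ k / k.factorial := by
  have hP : IsPrimitiveOn a b (fun t => ∫ s in a..t, m s) m := ⟨hm, fun t _ => by simp⟩
  have ha : a ∈ Icc a b := ⟨le_rfl, hab⟩
  induction k with
  | zero => simpa using h0
  | succ k ih =>
    intro t ht
    have hsub : uIcc a t ⊆ Icc a b := uIcc_subset_Icc ha ht
    calc φ (k + 1) t ≤ ∫ s in a..t, m s * φ k s := hle k t ht
      _ ≤ ∫ s in a..t, (C / k.factorial) * (m s * (∫ r in a..s, m r) ^ k) := by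
        refine intervalIntegral.integral_mono_on ht.1 ?_ ?_ ?_
        · exact (intervalIntegrable_mono_Icc hm ha ht).mul_continuousOn ((hφ k).mono hsub)
        · exact ((intervalIntegrable_mono_Icc hm ha ht).mul_continuousOn
            ((hP.continuousOn.mono hsub).pow k)).const_mul _
        · intro s hs
          have := mul_le_mul_of_nonneg_left (ih s ⟨hs.1, hs.2.trans ht.2⟩) (hm0 s)
          exact this.trans_eq (by ring)
      _ = C * (∫ s in a..t, m s) ^ (k + 1) / (k + 1).factorial := by
        rw [intervalIntegral.integral_const_mul, integral_pow_primitive_mul hab hm k ht,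
          Nat.factorial_succ]
        push_cast
        field_simp

/-- The weight is only integrable, since it will contain the control. Iterating the inequality
bounds `φ t` by `C (∫ m)^k / k!` for every `k`, and this tends to zero. -/
lemma gronwall_eq_zero {a b : ℝ} {m φ : ℝ → ℝ} (hab : a ≤ b)
    (hm : IntervalIntegrable m volume a b) (hm0 : ∀ t, 0 ≤ m t)
    (hφ : ContinuousOn φ (Icc a b)) (hφ0 : ∀ t ∈ Icc a b, 0 ≤ φ t)
    (hle : ∀ t ∈ Icc a b, φ t ≤ ∫ s in a..t, m s * φ s) : ∀ t ∈ Icc a b, φ t = 0 := by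
  obtain ⟨C, hC⟩ := isCompact_Icc.exists_bound_of_continuousOn hφ
  intro t ht
  refine le_antisymm ?_ (hφ0 t ht)
  have key := fun k => le_pow_of_le_integral (φ := fun _ => φ) hab hm hm0 (fun _ => hφ)
    (fun t ht => (le_abs_self _).trans (hC t ht)) (fun _ => hle) k t ht
  have hlim := (FloorSemiring.tendsto_pow_div_factorial_atTop (∫ s in a..t, m s)).const_mul C
  rw [mul_zero] at hlim
  exact ge_of_tendsto' hlim fun k => (key k).trans_eq (mul_div_assoc _ _ _)

lemma gronwall_norm_eq_zero [CompleteSpace F] {a b : ℝ} {m : ℝ → ℝ} {f g : ℝ → F} (hab : a ≤ b)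
    (h : IsPrimitiveOn a b f g) (ha : f a = 0) (hm : IntervalIntegrable m volume a b)
    (hm0 : ∀ t, 0 ≤ m t) (hle : ∀ᵐ t, t ∈ Icc a b → ‖g t‖ ≤ m t * ‖f t‖) :
    ∀ t ∈ Icc a b, f t = 0 := by
  have hfc := h.continuousOn
  have := gronwall_eq_zero (φ := fun t => ‖f t‖) hab hm hm0 hfc.norm
    (fun t _ => norm_nonneg _) (fun t ht => by
      have hta := intervalIntegrable_mono_Icc (hm.mul_continuousOn (g := fun t => ‖f t‖)
        (by rw [uIcc_of_le hab]; exact hfc.norm)) ⟨le_rfl, hab⟩ ht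
      rw [h.2 t ht, ha, zero_add]
      refine intervalIntegral.norm_integral_le_of_norm_le ht.1 (hle.mono fun s hs h's => ?_) hta
      exact hs ⟨h's.1.le, h's.2.trans ht.2⟩)
  exact fun t ht => norm_eq_zero.1 (this t ht)

end Primitive

set_option linter.unusedSectionVars false

/-! ### Volterra operators and linear equations with integrable coefficients -/

section Volterra

variable {F G : Type*} [NormedAddCommGroup F] [NormedSpace ℝ F] [NormedAddCommGroup G]
  [NormedSpace ℝ G]

/-- Evaluation at `x t` is a continuous operator-valued path, so `intervalIntegrable_clm_apply`
applies with the operator and the argument exchanged. -/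
lemma IntervalIntegrable.clm_apply_continuousOn {a b : ℝ} (hab : a ≤ b) {A : ℝ → F →L[ℝ] G}
    {x : ℝ → F} (hA : IntervalIntegrable A volume a b) (hx : ContinuousOn x (Icc a b)) :
    IntervalIntegrable (fun t => A t (x t)) volume a b :=
  intervalIntegrable_clm_apply hab (L := fun t => ContinuousLinearMap.apply ℝ G (x t))
    ((ContinuousLinearMap.apply ℝ G (E := F)).continuous.comp_continuousOn hx) hA

variable {T : ℝ}

lemma continuous_IccExtend (hT : 0 ≤ T) (h : C(Icc 0 T, F)) : Continuous (IccExtend hT h) :=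
  h.continuous.Icc_extend'

lemma norm_IccExtend_le (hT : 0 ≤ T) (h : C(Icc 0 T, F)) (s : ℝ) : ‖IccExtend hT h s‖ ≤ ‖h‖ :=
  h.norm_coe_le_norm _

/-- The path `t ↦ ∫₀ᵗ g` of an integrable function `g`. -/
def primitivePath {g : ℝ → F} (hg : IntervalIntegrable g volume 0 T) : C(Icc 0 T, F) where
  toFun t := ∫ s in (0 : ℝ)..t, g s
  continuous_toFun :=
    continuousOn_iff_continuous_domRestrict.1
      (IsPrimitiveOn.continuousOn (f := fun t => ∫ s in (0 : ℝ)..t, g s) ⟨hg, fun t _ => by simp⟩)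

lemma primitivePath_apply {g : ℝ → F} (hg : IntervalIntegrable g volume 0 T) (t : Icc 0 T) :
    primitivePath hg t = ∫ s in (0 : ℝ)..t, g s := rfl

lemma norm_primitivePath_le (hT : 0 ≤ T) {g : ℝ → F} (hg : IntervalIntegrable g volume 0 T)
    {m : ℝ → ℝ} (hm : IntervalIntegrable m volume 0 T)
    (h : ∀ᵐ t, t ∈ Icc 0 T → ‖g t‖ ≤ m t) : ‖primitivePath hg‖ ≤ ∫ s in (0 : ℝ)..T, m s := by
  have h0 : ∀ᵐ t, t ∈ Ioc 0 T → 0 ≤ m t :=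
    h.mono fun t ht h't => (norm_nonneg _).trans (ht ⟨h't.1.le, h't.2⟩)
  have hint : 0 ≤ ∫ s in (0 : ℝ)..T, m s :=
    intervalIntegral.integral_nonneg_of_ae_restrict hT (by
      rw [EventuallyLE, ae_restrict_iff' measurableSet_Icc]
      exact h.mono fun t ht h't => (norm_nonneg _).trans (ht h't))
  refine (ContinuousMap.norm_le _ hint).2 fun t => ?_
  refine (intervalIntegral.norm_integral_le_of_norm_le t.2.1
    (h.mono fun s hs h's => hs ⟨h's.1.le, h's.2.trans t.2.2⟩)
    (intervalIntegrable_mono_Icc hm ⟨le_rfl, hT⟩ t.2)).trans ?_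
  refine intervalIntegral.integral_mono_interval le_rfl t.2.1 t.2.2 ?_ hm
  rw [EventuallyLE, ae_restrict_iff' measurableSet_Ioc]
  exact h0

/-- The Volterra operator `h ↦ (t ↦ ∫₀ᵗ A h)`. -/
def volterra (hT : 0 ≤ T) {A : ℝ → F →L[ℝ] G} (hA : IntervalIntegrable A volume 0 T) :
    C(Icc 0 T, F) →L[ℝ] C(Icc 0 T, G) :=
  have hi (h : C(Icc 0 T, F)) : IntervalIntegrable (fun s => A s (IccExtend hT h s)) volume 0 T :=
    IntervalIntegrable.clm_apply_continuousOn hT hA (continuous_IccExtend hT h).continuousOn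
  have hi' (h : C(Icc 0 T, F)) (t : Icc 0 T) :
      IntervalIntegrable (fun s => A s (IccExtend hT h s)) volume 0 t :=
    intervalIntegrable_mono_Icc (hi h) ⟨le_rfl, hT⟩ t.2
  LinearMap.mkContinuous
    { toFun := fun h => primitivePath (hi h)
      map_add' := fun h k => by
        ext t
        simp only [primitivePath_apply, ContinuousMap.add_apply]
        rw [← intervalIntegral.integral_add (hi' h t) (hi' k t)]
        simp [IccExtend]
      map_smul' := fun c h => by
        ext t
        simp only [primitivePath_apply, ContinuousMap.smul_apply, RingHom.id_apply]
        rw [← intervalIntegral.integral_smul]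
        simp [IccExtend] }
    (∫ s in (0 : ℝ)..T, ‖A s‖) fun h => by
      rw [← intervalIntegral.integral_mul_const]
      refine norm_primitivePath_le hT (hi h) (hA.norm.mul_const _) (Eventually.of_forall fun t _ => ?_)
      exact ((A t).le_opNorm _).trans
        (mul_le_mul_of_nonneg_left (norm_IccExtend_le hT h t) (norm_nonneg _))

lemma volterra_apply (hT : 0 ≤ T) {A : ℝ → F →L[ℝ] G} (hA : IntervalIntegrable A volume 0 T)
    (h : C(Icc 0 T, F)) (t : Icc 0 T) :
    volterra hT hA h t = ∫ s in (0 : ℝ)..t, A s (IccExtend hT h s) := rfl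

/-- The iterated Grönwall estimate, applied to the norms of the iterates. The factorial makes some
power a strict contraction without any smallness of `T` or `A`. -/
lemma norm_volterra_pow_le (hT : 0 ≤ T) {A : ℝ → F →L[ℝ] F} (hA : IntervalIntegrable A volume 0 T)
    (k : ℕ) : ‖volterra hT hA ^ k‖ ≤ (∫ s in (0 : ℝ)..T, ‖A s‖) ^ k / k.factorial := by
  have h0 : 0 ≤ ∫ s in (0 : ℝ)..T, ‖A s‖ :=
    intervalIntegral.integral_nonneg hT fun _ _ => norm_nonneg _
  refine ContinuousLinearMap.opNorm_le_bound _ (by positivity) fun h => ?_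
  refine (ContinuousMap.norm_le _ (by positivity)).2 fun t => ?_
  have key := le_pow_of_le_integral (m := fun s => ‖A s‖)
    (φ := fun k s => ‖IccExtend hT ((volterra hT hA ^ k) h) s‖) (C := ‖h‖) hT hA.norm
    (fun _ => norm_nonneg _) (fun k => (continuous_IccExtend hT _).norm.continuousOn)
    (fun t _ => norm_IccExtend_le hT h t) (fun k t ht => by
      rw [IccExtend_of_mem hT _ ht, pow_succ', mul_apply_eq_comp, volterra_apply]
      refine intervalIntegral.norm_integral_le_of_norm_le ht.1
        (Eventually.of_forall fun s _ => (A s).le_opNorm _) ?_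
      exact (intervalIntegrable_mono_Icc hA.norm ⟨le_rfl, hT⟩ ht).mul_continuousOn
        (continuous_IccExtend hT _).norm.continuousOn) k t t.2
  simp only [IccExtend_of_mem hT _ t.2] at key
  refine key.trans ?_
  rw [mul_comm, mul_div_right_comm]
  gcongr
  · exact intervalIntegral.integral_nonneg t.2.1 fun _ _ => norm_nonneg _
  · exact intervalIntegral.integral_mono_interval le_rfl t.2.1 t.2.2
      (Eventually.of_forall fun _ => norm_nonneg _) hA.norm

/-- Some power has norm below one, so `1 - V ^ k` is a unit. It is the product of `1 - V` with the
commuting geometric sum, so both factors are units. -/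
lemma isUnit_one_sub_volterra [CompleteSpace F] (hT : 0 ≤ T) {A : ℝ → F →L[ℝ] F}
    (hA : IntervalIntegrable A volume 0 T) : IsUnit (1 - volterra hT hA) := by
  obtain ⟨k, hk⟩ := ((FloorSemiring.tendsto_pow_div_factorial_atTop
    (∫ s in (0 : ℝ)..T, ‖A s‖)).eventually (gt_mem_nhds one_pos)).exists
  have h1 : IsUnit (1 - volterra hT hA ^ k) :=
    isUnit_one_sub_of_norm_lt_one (R := C(Icc 0 T, F) →L[ℝ] C(Icc 0 T, F)) ((norm_volterra_pow_le hT hA k).trans_lt hk)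
  have hc : Commute (1 - volterra hT hA) (∑ i ∈ Finset.range k, volterra hT hA ^ i) :=
    Commute.sum_right _ _ _ fun i _ => ((Commute.one_left _).sub_left (Commute.refl _)).pow_right i
  rw [← mul_neg_geom_sum, hc.isUnit_mul_iff] at h1
  exact h1.1

/-- Linear differential equations with integrable coefficients are solvable. -/
lemma exists_isPrimitiveOn_linear [CompleteSpace F] (hT : 0 ≤ T) {A : ℝ → F →L[ℝ] F}
    (hA : IntervalIntegrable A volume 0 T) (x₀ : F) :
    ∃ x : ℝ → F, IsPrimitiveOn 0 T x (fun t => A t (x t)) ∧ x 0 = x₀ := by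
  obtain ⟨S, hS⟩ := (isUnit_one_sub_volterra hT hA).exists_right_inv
  let h := S (ContinuousMap.const _ x₀)
  have hh : ∀ t ∈ Icc 0 T,
      IccExtend hT h t = x₀ + ∫ s in (0 : ℝ)..t, A s (IccExtend hT h s) := by
    intro t ht
    have := congrArg (fun L : C(Icc 0 T, F) →L[ℝ] C(Icc 0 T, F) =>
      L (ContinuousMap.const _ x₀) ⟨t, ht⟩) hS
    simp only [mul_apply_eq_comp, _root_.sub_apply,
      one_apply_eq_self, ContinuousMap.sub_apply, volterra_apply,
      ContinuousMap.const_apply] at this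
    rw [IccExtend_of_mem hT _ ht]
    exact sub_eq_iff_eq_add.1 this
  refine ⟨IccExtend hT h, IsPrimitiveOn.of_eq hT
    (IntervalIntegrable.clm_apply_continuousOn hT hA (continuous_IccExtend hT h).continuousOn) hh, ?_⟩
  rw [hh 0 ⟨le_rfl, hT⟩]
  simp

/-- The substitution `t ↦ T - t` turns the terminal value into an initial value and changes the sign
of the coefficient. -/
lemma exists_isPrimitiveOn_linear_terminal [CompleteSpace F] (hT : 0 ≤ T) {A : ℝ → F →L[ℝ] F}
    (hA : IntervalIntegrable A volume 0 T) (x₁ : F) :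
    ∃ x : ℝ → F, IsPrimitiveOn 0 T x (fun t => A t (x t)) ∧ x T = x₁ := by
  have hA' : IntervalIntegrable (fun t => -A (T - t)) volume 0 T := by
    have := (hA.comp_sub_left T).symm.neg
    rwa [sub_zero, sub_self] at this
  obtain ⟨x, hx, hx0⟩ := exists_isPrimitiveOn_linear hT hA' x₁
  refine ⟨fun t => x (T - t), ⟨?_, fun t ht => ?_⟩, by simpa using hx0⟩
  · have := (hx.1.comp_sub_left T).symm.neg
    rw [sub_zero, sub_self] at this
    refine this.congr_ae (Eventually.of_forall fun t => ?_)
    simp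
  · have h1 : T - t ∈ Icc 0 T := ⟨by linarith [ht.2], by linarith [ht.1]⟩
    have h2 : T - 0 ∈ Icc 0 T := ⟨by linarith [ht.2], by linarith [ht.1]⟩
    have := hx.integral_eq h2 h1
    beta_reduce
    rw [this]
    congr 1
    rw [← intervalIntegral.integral_comp_sub_left]
    rw [intervalIntegral.integral_symm]
    simp

end Volterra

/-! ### Time-dependent C¹ maps and superposition operators on paths -/

section TimeDependent

variable {E F G H : Type*} [NormedAddCommGroup E] [NormedSpace ℝ E] [NormedAddCommGroup F]
  [NormedSpace ℝ F] [NormedAddCommGroup G] [NormedSpace ℝ G] [NormedAddCommGroup H]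
  [NormedSpace ℝ H]

/-- A time-dependent map on `[0, T] × Ω` that is jointly continuous together with its first
derivative in space. -/
structure IsC1On (T : ℝ) (Ω : Set F) (b : ℝ → F → G) : Prop where
  continuousOn : ContinuousOn (fun p : ℝ × F => b p.1 p.2) (Icc 0 T ×ˢ Ω)
  differentiableOn : ∀ t ∈ Icc 0 T, DifferentiableOn ℝ (b t) Ω
  continuousOn_fderiv : ContinuousOn (fun p : ℝ × F => fderiv ℝ (b p.1) p.2) (Icc 0 T ×ˢ Ω)

namespace IsC1On

variable {T : ℝ} {Ω : Set F} {b : ℝ → F → G}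

lemma differentiableAt (hb : IsC1On T Ω b) (hΩ : IsOpen Ω) {t : ℝ} (ht : t ∈ Icc 0 T) {y : F}
    (hy : y ∈ Ω) : DifferentiableAt ℝ (b t) y :=
  (hb.differentiableOn t ht y hy).differentiableAt (hΩ.mem_nhds hy)

lemma of_contDiffOn (hΩ : IsOpen Ω) {g : F → G} (hg : ContDiffOn ℝ 1 g Ω) :
    IsC1On T Ω (fun _ => g) where
  continuousOn := hg.continuousOn.comp continuousOn_snd fun _ hp => hp.2
  differentiableOn _ _ := hg.differentiableOn one_ne_zero
  continuousOn_fderiv := (hg.continuousOn_fderiv_of_isOpen hΩ le_rfl).comp continuousOn_snd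
    fun _ hp => hp.2

lemma comp (hb : IsC1On T Ω b) (hΩ : IsOpen Ω) {U : Set E} (hU : IsOpen U) {φ : E → F}
    (hφ : ContDiffOn ℝ 1 φ U) (hm : MapsTo φ U Ω) : IsC1On T U (fun t y => b t (φ y)) where
  continuousOn := hb.continuousOn.comp
    (continuousOn_fst.prodMk (hφ.continuousOn.comp continuousOn_snd fun _ hp => hp.2))
    fun p hp => ⟨hp.1, hm hp.2⟩
  differentiableOn t ht := (hb.differentiableOn t ht).comp (hφ.differentiableOn one_ne_zero) hm
  continuousOn_fderiv := by
    have h1 : ContinuousOn (fun p : ℝ × E => fderiv ℝ (b p.1) (φ p.2)) (Icc 0 T ×ˢ U) :=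
      hb.continuousOn_fderiv.comp
        (continuousOn_fst.prodMk (hφ.continuousOn.comp continuousOn_snd fun _ hp => hp.2))
        fun p hp => ⟨hp.1, hm hp.2⟩
    have h2 : ContinuousOn (fun p : ℝ × E => fderiv ℝ φ p.2) (Icc 0 T ×ˢ U) :=
      (hφ.continuousOn_fderiv_of_isOpen hU le_rfl).comp continuousOn_snd fun _ hp => hp.2
    refine (h1.clm_comp h2).congr fun p hp => ?_
    exact fderiv_comp _ (hb.differentiableAt hΩ hp.1 (hm hp.2))
      ((hφ.differentiableOn one_ne_zero _ hp.2).differentiableAt (hU.mem_nhds hp.2))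

lemma clm_apply (hb : IsC1On T Ω b) (hΩ : IsOpen Ω) {L : F → G →L[ℝ] H}
    (hL : ContDiffOn ℝ 1 L Ω) : IsC1On T Ω (fun t y => L y (b t y)) where
  continuousOn := (hL.continuousOn.comp continuousOn_snd fun _ hp => hp.2).clm_apply
    hb.continuousOn
  differentiableOn t ht := (hL.differentiableOn one_ne_zero).clm_apply (hb.differentiableOn t ht)
  continuousOn_fderiv := by
    have h1 : ContinuousOn (fun p : ℝ × F => L p.2) (Icc 0 T ×ˢ Ω) :=
      hL.continuousOn.comp continuousOn_snd fun _ hp => hp.2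
    have h2 : ContinuousOn (fun p : ℝ × F => fderiv ℝ L p.2) (Icc 0 T ×ˢ Ω) :=
      (hL.continuousOn_fderiv_of_isOpen hΩ le_rfl).comp continuousOn_snd fun _ hp => hp.2
    have h3 : ContinuousOn (fun p : ℝ × F => (fderiv ℝ L p.2).flip (b p.1 p.2)) (Icc 0 T ×ˢ Ω) :=
      ((ContinuousLinearMap.flipₗᵢ ℝ F G H).continuous.comp_continuousOn h2).clm_apply
        hb.continuousOn
    refine ((h1.clm_comp hb.continuousOn_fderiv).add h3).congr fun p hp => ?_
    exact fderiv_clm_apply ((hL.differentiableOn one_ne_zero _ hp.2).differentiableAt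
      (hΩ.mem_nhds hp.2)) (hb.differentiableAt hΩ hp.1 hp.2)

lemma smul (hb : IsC1On T Ω b) (hΩ : IsOpen Ω) {w : F → ℝ} (hw : ContDiffOn ℝ 1 w Ω) :
    IsC1On T Ω (fun t y => w y • b t y) :=
  hb.clm_apply hΩ (L := fun y => w y • ContinuousLinearMap.id ℝ G) (hw.smul contDiffOn_const)

lemma sum {ι : Type*} {s : Finset ι} {b : ι → ℝ → F → G} (hΩ : IsOpen Ω)
    (hb : ∀ i ∈ s, IsC1On T Ω (b i)) : IsC1On T Ω (fun t y => ∑ i ∈ s, b i t y) where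
  continuousOn := continuousOn_finsetSum _ fun i hi => (hb i hi).continuousOn
  differentiableOn t ht := DifferentiableOn.fun_sum fun i hi => (hb i hi).differentiableOn t ht
  continuousOn_fderiv := by
    refine (continuousOn_finsetSum s fun i hi => (hb i hi).continuousOn_fderiv).congr fun p hp => ?_
    exact fderiv_fun_sum fun i hi => (hb i hi).differentiableAt hΩ hp.1 hp.2

lemma continuousOn_path (hb : IsC1On T Ω b) {a c : ℝ} (ha : 0 ≤ a) (hc : c ≤ T) {y : ℝ → F}
    (hy : ContinuousOn y (Icc a c)) (hyΩ : ∀ t ∈ Icc a c, y t ∈ Ω) :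
    ContinuousOn (fun t => b t (y t)) (Icc a c) :=
  hb.continuousOn.comp (continuousOn_id.prodMk hy) fun t ht =>
    ⟨⟨ha.trans ht.1, ht.2.trans hc⟩, hyΩ t ht⟩

lemma continuousOn_fderiv_path (hb : IsC1On T Ω b) {a c : ℝ} (ha : 0 ≤ a) (hc : c ≤ T) {y : ℝ → F}
    (hy : ContinuousOn y (Icc a c)) (hyΩ : ∀ t ∈ Icc a c, y t ∈ Ω) :
    ContinuousOn (fun t => fderiv ℝ (b t) (y t)) (Icc a c) :=
  hb.continuousOn_fderiv.comp (continuousOn_id.prodMk hy) fun t ht =>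
    ⟨⟨ha.trans ht.1, ht.2.trans hc⟩, hyΩ t ht⟩

/-- Compactness of `[0, T]` makes the radius independent of time. This is what turns
differentiability at each time into differentiability in the supremum norm. -/
lemma exists_tube (hb : IsC1On T Ω b) (hΩ : IsOpen Ω) (y : C(Icc 0 T, F)) (hy : ∀ t, y t ∈ Ω)
    {ε : ℝ} (hε : 0 < ε) : ∃ δ > 0, ∀ t : Icc 0 T, Metric.ball (y t) δ ⊆ Ω ∧
      ∀ z ∈ Metric.ball (y t) δ, ‖fderiv ℝ (b t) z - fderiv ℝ (b t) (y t)‖ < ε := by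
  have hev : ∀ᶠ h in 𝓝 (0 : F), ∀ t ∈ (univ : Set (Icc 0 T)), y t + h ∈ Ω ∧
      ‖fderiv ℝ (b t) (y t + h) - fderiv ℝ (b t) (y t)‖ < ε := by
    refine isCompact_univ.eventually_forall_of_forall_eventually fun t _ => ?_
    have hΦ : Continuous fun p : F × Icc 0 T => y p.2 + p.1 := by fun_prop
    have hmem : ∀ᶠ p in 𝓝 ((0 : F), t), y p.2 + p.1 ∈ Ω :=
      hΦ.continuousAt.eventually_mem (hΩ.mem_nhds (by simpa using hy t))
    have h1 : Tendsto (fun p : F × Icc 0 T => fderiv ℝ (b p.2) (y p.2 + p.1)) (𝓝 ((0 : F), t))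
        (𝓝 (fderiv ℝ (b t) (y t))) := by
      have h2 : ContinuousWithinAt (fun p : ℝ × F => fderiv ℝ (b p.1) p.2) (Icc 0 T ×ˢ Ω)
        ((t : ℝ), y t) := hb.continuousOn_fderiv _ ⟨t.2, hy t⟩
      refine h2.tendsto.comp (f := fun p : F × Icc 0 T => ((p.2 : ℝ), y p.2 + p.1))
        (tendsto_nhdsWithin_iff.2 ⟨?_, hmem.mono fun p hp => ⟨p.2.2, hp⟩⟩)
      have : Continuous fun p : F × Icc 0 T => ((p.2 : ℝ), y p.2 + p.1) := by fun_prop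
      simpa using this.tendsto ((0 : F), t)
    have h2 : Tendsto (fun p : F × Icc 0 T => fderiv ℝ (b p.2) (y p.2)) (𝓝 ((0 : F), t))
        (𝓝 (fderiv ℝ (b t) (y t))) := by
      have : Continuous fun t : Icc 0 T => fderiv ℝ (b t) (y t) :=
        hb.continuousOn_fderiv.comp_continuous (f := fun t : Icc 0 T => ((t : ℝ), y t))
          (by fun_prop) fun t => ⟨t.2, hy t⟩
      exact (this.comp continuous_snd).tendsto ((0 : F), t)
    have h3 := (h1.sub h2).norm
    rw [sub_self, norm_zero] at h3
    exact hmem.and (h3.eventually (gt_mem_nhds hε))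
  obtain ⟨δ, hδ, hball⟩ := Metric.eventually_nhds_iff_ball.1 hev
  refine ⟨δ, hδ, fun t => ?_⟩
  have key : ∀ z ∈ Metric.ball (y t) δ, z ∈ Ω ∧
      ‖fderiv ℝ (b t) z - fderiv ℝ (b t) (y t)‖ < ε := fun z hz => by
    have := hball (z - y t) (by simpa [dist_eq_norm] using hz) t (mem_univ _)
    simpa using this
  exact ⟨fun z hz => (key z hz).1, fun z hz => (key z hz).2⟩

/-- Local Lipschitz continuity in space, uniformly in time. -/
lemma exists_lipschitz (hb : IsC1On T Ω b) (hΩ : IsOpen Ω) {z : F} (hz : z ∈ Ω) :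
    ∃ C δ : ℝ, 0 ≤ C ∧ 0 < δ ∧ Metric.ball z δ ⊆ Ω ∧ ∀ t ∈ Icc 0 T, ∀ y ∈ Metric.ball z δ,
      ∀ y' ∈ Metric.ball z δ, ‖b t y - b t y'‖ ≤ C * ‖y - y'‖ := by
  rcases lt_or_ge T 0 with hT | hT
  · obtain ⟨δ, hδ, h⟩ := Metric.isOpen_iff.1 hΩ z hz
    exact ⟨0, δ, le_rfl, hδ, h, by simp [Icc_eq_empty_of_lt hT]⟩
  have hcont : ContinuousOn (fun t => fderiv ℝ (b t) z) (Icc 0 T) :=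
    hb.continuousOn_fderiv_path le_rfl le_rfl continuousOn_const fun _ _ => hz
  obtain ⟨C, hC⟩ := isCompact_Icc.exists_bound_of_continuousOn hcont
  obtain ⟨δ, hδ, h⟩ := hb.exists_tube hΩ (ContinuousMap.const _ z) (fun _ => hz) one_pos
  have hC0 : 0 ≤ C := (norm_nonneg _).trans (hC 0 ⟨le_rfl, hT⟩)
  refine ⟨C + 1, δ, by linarith, hδ, (h ⟨0, le_rfl, hT⟩).1, fun t ht y hy y' hy' => ?_⟩
  refine (convex_ball z δ).norm_image_sub_le_of_norm_fderiv_le (𝕜 := ℝ)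
    (fun x hx => hb.differentiableAt hΩ ht ((h ⟨t, ht⟩).1 hx)) (fun x hx => ?_) hy' hy
  have h1 := (h ⟨t, ht⟩).2 x hx
  have h2 := hC t ht
  have h3 := norm_sub_norm_le (fderiv ℝ (b t) x) (fderiv ℝ (b t) z)
  simp only [ContinuousMap.const_apply] at h1
  linarith

end IsC1On

open Classical in
/-- The superposition operator `y ↦ b(·, y(·))` on paths; zero where this is not continuous. -/
def superposition {T : ℝ} (b : ℝ → F → G) (y : C(Icc 0 T, F)) : C(Icc 0 T, G) :=
  if h : Continuous (fun t : Icc 0 T => b t (y t)) then ⟨fun t => b t (y t), h⟩ else 0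

/-- Pointwise application of a path of continuous linear maps. -/
def pathMul {T : ℝ} (D : C(Icc 0 T, F →L[ℝ] G)) : C(Icc 0 T, F) →L[ℝ] C(Icc 0 T, G) :=
  LinearMap.mkContinuous
    { toFun := fun h => ⟨fun t => D t (h t), D.continuous.clm_apply h.continuous⟩
      map_add' := fun h k => by ext t; simp
      map_smul' := fun c h => by ext t; simp } ‖D‖ fun h => by
    refine (ContinuousMap.norm_le _ (by positivity)).2 fun t => ?_
    exact ((D t).le_opNorm _).trans (by
      gcongr
      exacts [D.norm_coe_le_norm t, h.norm_coe_le_norm t])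

lemma pathMul_apply {T : ℝ} (D : C(Icc 0 T, F →L[ℝ] G)) (h : C(Icc 0 T, F)) (t : Icc 0 T) :
    pathMul D h t = D t (h t) := rfl

namespace IsC1On

variable {T : ℝ} {Ω : Set F} {b : ℝ → F → G}

lemma superposition_apply (hb : IsC1On T Ω b) {y : C(Icc 0 T, F)} (hy : ∀ t, y t ∈ Ω)
    (t : Icc 0 T) : superposition b y t = b t (y t) := by
  have : Continuous (fun t : Icc 0 T => b t (y t)) :=
    hb.continuousOn.comp_continuous (f := fun t : Icc 0 T => ((t : ℝ), y t))
          (by fun_prop) fun t => ⟨t.2, hy t⟩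
  simp [superposition, this]

/-- The derivative of `b` along a path. -/
def fderivPath (hb : IsC1On T Ω b) (y : C(Icc 0 T, F)) (hy : ∀ t, y t ∈ Ω) :
    C(Icc 0 T, F →L[ℝ] G) where
  toFun t := fderiv ℝ (b t) (y t)
  continuous_toFun := hb.continuousOn_fderiv.comp_continuous (f := fun t : Icc 0 T => ((t : ℝ), y t))
          (by fun_prop) fun t => ⟨t.2, hy t⟩

/-- On the tube the derivative of `b t` varies by at most `ε`, with one radius for all times. The
mean value inequality at each time then bounds the remainder in the supremum norm. -/
lemma hasStrictFDerivAt_superposition (hb : IsC1On T Ω b) (hΩ : IsOpen Ω) (y : C(Icc 0 T, F))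
    (hy : ∀ t, y t ∈ Ω) :
    HasStrictFDerivAt (superposition b) (pathMul (hb.fderivPath y hy)) y := by
  refine HasStrictFDerivAt.of_isLittleO (Asymptotics.isLittleO_iff.2 fun ε hε => ?_)
  obtain ⟨δ, hδ, h⟩ := hb.exists_tube hΩ y hy hε
  have hball : Metric.ball y δ ×ˢ Metric.ball y δ ∈ 𝓝 (y, y) :=
    prod_mem_nhds (Metric.ball_mem_nhds _ hδ) (Metric.ball_mem_nhds _ hδ)
  filter_upwards [hball] with p hp
  have hmem : ∀ q ∈ Metric.ball y δ, ∀ t, q t ∈ Metric.ball (y t) δ := fun q hq t =>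
    (ContinuousMap.dist_apply_le_dist t).trans_lt hq
  refine (ContinuousMap.norm_le _ (by positivity)).2 fun t => ?_
  simp only [ContinuousMap.sub_apply, pathMul_apply]
  rw [show hb.fderivPath y hy t = fderiv ℝ (b t) (y t) from rfl,
    hb.superposition_apply fun t => (h t).1 (hmem _ hp.1 t),
    hb.superposition_apply fun t => (h t).1 (hmem _ hp.2 t)]
  refine ((convex_ball (y t) δ).norm_image_sub_le_of_norm_hasFDerivWithin_le' (𝕜 := ℝ)
    (f' := fderiv ℝ (b t)) (C := ε)
    (fun x hx => (hb.differentiableAt hΩ t.2 ((h t).1 hx)).hasFDerivAt.hasFDerivWithinAt)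
    (fun x hx => ((h t).2 x hx).le) (hmem _ hp.2 t) (hmem _ hp.1 t)).trans ?_
  exact mul_le_mul_of_nonneg_left ((p.1 - p.2).norm_coe_le_norm t) hε.le

end IsC1On

end TimeDependent

/-! ### Controlled equations and their differentiable dependence on the control -/

section ControlledODE

variable {F : Type*} [NormedAddCommGroup F] [NormedSpace ℝ F] {J : ℕ} {T : ℝ}

lemma intervalIntegrable_of_memLp (hT : 0 ≤ T) {c : ℝ → EuclideanSpace ℝ (Fin J)}
    (hc : MemLp c 2 (volume.restrict (Icc (0 : ℝ) T))) : IntervalIntegrable c volume 0 T := by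
  rw [intervalIntegrable_iff_integrableOn_Icc_of_le hT]
  exact hc.integrable one_le_two

lemma intervalIntegrable_component {a b : ℝ} {c : ℝ → EuclideanSpace ℝ (Fin J)}
    (hc : IntervalIntegrable c volume a b) (j : Fin J) :
    IntervalIntegrable (fun t => c t j) volume a b := by
  let L : EuclideanSpace ℝ (Fin J) →L[ℝ] ℝ := EuclideanSpace.proj j
  exact ⟨L.integrable_comp hc.1, L.integrable_comp hc.2⟩

lemma Control.intervalIntegrable (hT : 0 ≤ T) (u : Control J T) : IntervalIntegrable u volume 0 T :=
  intervalIntegrable_of_memLp hT (Lp.memLp u)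

/-- Hölder's inequality on an interval of finite length; it gives the continuity in the control of
the bilinear map `controlIntegral`. -/
lemma Control.integral_norm_le (hT : 0 ≤ T) (u : Control J T) :
    ∫ s in (0 : ℝ)..T, ‖u s‖ ≤ ((volume.restrict (Icc (0 : ℝ) T)) univ ^ (1 / 2 : ℝ)).toReal * ‖u‖ := by
  have hu := Lp.memLp u
  have h1 := eLpNorm_le_eLpNorm_mul_rpow_measure_univ (p := 1) (q := 2) one_le_two hu.1
  have hfin : (volume.restrict (Icc (0 : ℝ) T)) univ ^ (1 / 2 : ℝ) ≠ ⊤ :=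
    ENNReal.rpow_ne_top_of_nonneg (by norm_num) (measure_ne_top _ _)
  rw [intervalIntegral.integral_of_le hT, ← integral_Icc_eq_integral_Ioc,
    integral_norm_eq_lintegral_enorm hu.1, ← eLpNorm_one_eq_lintegral_enorm, Lp.norm_def, mul_comm,
    ← ENNReal.toReal_mul]
  have h2 : (1 / (1 : ℝ≥0∞).toReal - 1 / (2 : ℝ≥0∞).toReal) = (1 / 2 : ℝ) := by norm_num
  rw [h2] at h1
  exact ENNReal.toReal_mono (ENNReal.mul_ne_top hu.2.ne hfin) h1

/-- Multiplication by an integrable scalar function. -/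
lemma intervalIntegrable_smul_id {a b : ℝ} {c : ℝ → ℝ} (hc : IntervalIntegrable c volume a b) :
    IntervalIntegrable (fun s => c s • ContinuousLinearMap.id ℝ F) volume a b :=
  ⟨hc.1.smul_const _, hc.2.smul_const _⟩

lemma Control.ae_add (u v : Control J T) :
    ∀ᵐ t, t ∈ Icc 0 T → (u + v : Control J T) t = u t + v t :=
  (ae_restrict_iff' measurableSet_Icc).1 (Lp.coeFn_add u v)

lemma Control.ae_smul (r : ℝ) (u : Control J T) :
    ∀ᵐ t, t ∈ Icc 0 T → (r • u : Control J T) t = r • u t :=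
  (ae_restrict_iff' measurableSet_Icc).1 (Lp.coeFn_smul r u)

lemma intervalIntegrable_clm_smul_path (hT : 0 ≤ T) {c : ℝ → ℝ}
    (hc : IntervalIntegrable c volume 0 T) (g : C(Icc 0 T, F)) :
    IntervalIntegrable (fun s => (c s • ContinuousLinearMap.id ℝ F) (IccExtend hT g s)) volume 0 T :=
  IntervalIntegrable.clm_apply_continuousOn hT (intervalIntegrable_smul_id hc)
    (continuous_IccExtend hT g).continuousOn

/-- The bilinear map `(u, g) ↦ (t ↦ ∫₀ᵗ u_j g)`. -/
def controlIntegral (hT : 0 ≤ T) (j : Fin J) :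
    Control J T →L[ℝ] C(Icc 0 T, F) →L[ℝ] C(Icc 0 T, F) :=
  have hi (u : Control J T) : IntervalIntegrable (fun s => u s j) volume 0 T :=
    intervalIntegrable_component (Control.intervalIntegrable hT u) j
  have hi' (u : Control J T) (g : C(Icc 0 T, F)) (t : Icc 0 T) :
      IntervalIntegrable (fun s => u s j • IccExtend hT g s) volume 0 t :=
    (intervalIntegrable_mono_Icc (hi u) ⟨le_rfl, hT⟩ t.2).smul_continuousOn
      (continuous_IccExtend hT g).continuousOn
  LinearMap.mkContinuous₂
    (LinearMap.mk₂ ℝ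
      (fun u g => volterra hT (intervalIntegrable_smul_id (F := F) (hi u)) g)
      (fun u v g => by
        ext t
        simp only [ContinuousMap.add_apply, volterra_apply, _root_.smul_apply,
          ContinuousLinearMap.id_apply]
        rw [← intervalIntegral.integral_add (hi' u g t) (hi' v g t)]
        refine intervalIntegral.integral_congr_ae ((Control.ae_add u v).mono fun s hs h's => ?_)
        rw [uIoc_of_le t.2.1] at h's
        rw [hs ⟨h's.1.le, h's.2.trans t.2.2⟩]
        simp [add_smul])
      (fun r u g => by
        ext t
        simp only [ContinuousMap.smul_apply, volterra_apply, _root_.smul_apply,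
          ContinuousLinearMap.id_apply]
        rw [← intervalIntegral.integral_smul]
        refine intervalIntegral.integral_congr_ae ((Control.ae_smul r u).mono fun s hs h's => ?_)
        rw [uIoc_of_le t.2.1] at h's
        rw [hs ⟨h's.1.le, h's.2.trans t.2.2⟩]
        simp [mul_smul])
      (fun u g g' => by simp)
      (fun r u g => by simp))
    (((volume.restrict (Icc (0 : ℝ) T)) univ ^ (1 / 2 : ℝ)).toReal) fun u g => by
      simp only [LinearMap.mk₂_apply]
      refine le_trans ?_ (mul_le_mul_of_nonneg_right (Control.integral_norm_le hT u) (norm_nonneg g))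
      rw [← intervalIntegral.integral_mul_const]
      refine norm_primitivePath_le hT (intervalIntegrable_clm_smul_path hT (hi u) g) ((Control.intervalIntegrable hT u).norm.mul_const _)
        (Eventually.of_forall fun t _ => ?_)
      simp only [_root_.smul_apply, ContinuousLinearMap.id_apply, norm_smul]
      exact mul_le_mul (PiLp.norm_apply_le _ _) (norm_IccExtend_le hT g t) (norm_nonneg _)
        (norm_nonneg _)

lemma controlIntegral_apply (hT : 0 ≤ T) (j : Fin J) (u : Control J T) (g : C(Icc 0 T, F))
    (t : Icc 0 T) :
    controlIntegral hT j u g t = ∫ s in (0 : ℝ)..t, u s j • IccExtend hT g s := rfl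

lemma intervalIntegrable_finset_sum {E ι : Type*} [NormedAddCommGroup E] [Fintype ι] {a b : ℝ}
    {f : ι → ℝ → E} (hf : ∀ i, IntervalIntegrable (f i) volume a b) :
    IntervalIntegrable (fun t => ∑ i, f i t) volume a b := by
  have := IntervalIntegrable.sum (μ := volume) (a := a) (b := b) Finset.univ (f := f)
    fun i _ => hf i
  refine this.congr_ae (Eventually.of_forall fun t => ?_)
  simp

/-- The velocity field `∑ j, c_{j,t} b_j + b₀` of a controlled differential equation. -/
def ctrlField (b : Fin J → ℝ → F → F) (b₀ : ℝ → F → F) (c : ℝ → EuclideanSpace ℝ (Fin J)) (t : ℝ)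
    (y : F) : F :=
  ∑ j, c t j • b j t y + b₀ t y

/-- The space derivative of the velocity field of a controlled differential equation. -/
def ctrlFieldDeriv (b : Fin J → ℝ → F → F) (b₀ : ℝ → F → F) (c : ℝ → EuclideanSpace ℝ (Fin J))
    (t : ℝ) (y : F) : F →L[ℝ] F :=
  ∑ j, c t j • fderiv ℝ (b j t) y + fderiv ℝ (b₀ t) y

lemma hasFDerivAt_ctrlField {Ω : Set F} (hΩ : IsOpen Ω) {b : Fin J → ℝ → F → F} {b₀ : ℝ → F → F}
    (hb : ∀ j, IsC1On T Ω (b j)) (hb₀ : IsC1On T Ω b₀) (c : ℝ → EuclideanSpace ℝ (Fin J)) {t : ℝ}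
    (ht : t ∈ Icc 0 T) {y : F} (hy : y ∈ Ω) :
    HasFDerivAt (ctrlField b b₀ c t) (ctrlFieldDeriv b b₀ c t y) y :=
  (HasFDerivAt.fun_sum fun j _ =>
    ((hb j).differentiableAt hΩ ht hy).hasFDerivAt.const_smul (c t j)).add
    (hb₀.differentiableAt hΩ ht hy).hasFDerivAt

lemma intervalIntegrable_ctrlFieldDeriv {Ω : Set F} {a d : ℝ} (ha : 0 ≤ a) (had : a ≤ d) (hd : d ≤ T)
    {b : Fin J → ℝ → F → F} {b₀ : ℝ → F → F} (hb : ∀ j, IsC1On T Ω (b j)) (hb₀ : IsC1On T Ω b₀)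
    {c : ℝ → EuclideanSpace ℝ (Fin J)} (hc : IntervalIntegrable c volume a d) {y : ℝ → F}
    (hy : ContinuousOn y (Icc a d)) (hyΩ : ∀ t ∈ Icc a d, y t ∈ Ω) :
    IntervalIntegrable (fun t => ctrlFieldDeriv b b₀ c t (y t)) volume a d := by
  have h1 : IntervalIntegrable (fun t => ∑ j, c t j • fderiv ℝ (b j t) (y t)) volume a d := by
    refine intervalIntegrable_finset_sum fun j => ?_
    refine (intervalIntegrable_component hc j).smul_continuousOn ?_
    rw [uIcc_of_le had]
    exact (hb j).continuousOn_fderiv_path ha hd hy hyΩ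
  refine h1.add (ContinuousOn.intervalIntegrable ?_)
  rw [uIcc_of_le had]
  exact hb₀.continuousOn_fderiv_path ha hd hy hyΩ

lemma intervalIntegrable_ctrlField {Ω : Set F} {a d : ℝ} (ha : 0 ≤ a) (had : a ≤ d) (hd : d ≤ T)
    {b : Fin J → ℝ → F → F} {b₀ : ℝ → F → F} (hb : ∀ j, IsC1On T Ω (b j)) (hb₀ : IsC1On T Ω b₀)
    {c : ℝ → EuclideanSpace ℝ (Fin J)} (hc : IntervalIntegrable c volume a d) {y : ℝ → F}
    (hy : ContinuousOn y (Icc a d)) (hyΩ : ∀ t ∈ Icc a d, y t ∈ Ω) :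
    IntervalIntegrable (fun t => ctrlField b b₀ c t (y t)) volume a d := by
  have h1 : IntervalIntegrable (fun t => ∑ j, c t j • b j t (y t)) volume a d := by
    refine intervalIntegrable_finset_sum fun j => ?_
    refine (intervalIntegrable_component hc j).smul_continuousOn ?_
    rw [uIcc_of_le had]
    exact (hb j).continuousOn_path ha hd hy hyΩ
  refine h1.add (ContinuousOn.intervalIntegrable ?_)
  rw [uIcc_of_le had]
  exact hb₀.continuousOn_path ha hd hy hyΩ

section Abstract

variable {U Y : Type*} [NormedAddCommGroup U] [NormedSpace ℝ U] [NormedAddCommGroup Y]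
  [NormedSpace ℝ Y]

/-- The derivative of `(v, y) ↦ y - y₀ - (∑ j, B j v (N j y) + B₀ (N₀ y))`. -/
def bilinearEqDeriv (B : Fin J → U →L[ℝ] Y →L[ℝ] Y) (B₀ : Y →L[ℝ] Y) (S : Fin J → Y)
    (D : Fin J → Y →L[ℝ] Y) (D₀ : Y →L[ℝ] Y) (u : U) : U × Y →L[ℝ] Y :=
  ContinuousLinearMap.snd ℝ U Y - (∑ j, ((B j).precompR _ u (D j ∘L ContinuousLinearMap.snd ℝ U Y) +
    (B j).precompL _ (ContinuousLinearMap.fst ℝ U Y) (S j)) +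
      B₀ ∘L (D₀ ∘L ContinuousLinearMap.snd ℝ U Y))

lemma bilinearEqDeriv_apply (B : Fin J → U →L[ℝ] Y →L[ℝ] Y) (B₀ : Y →L[ℝ] Y) (S : Fin J → Y)
    (D : Fin J → Y →L[ℝ] Y) (D₀ : Y →L[ℝ] Y) (u k : U) (h : Y) :
    bilinearEqDeriv B B₀ S D D₀ u (k, h) =
      h - (∑ j, (B j u (D j h) + B j k (S j)) + B₀ (D₀ h)) := by
  simp [bilinearEqDeriv]

lemma hasStrictFDerivAt_bilinearEq (B : Fin J → U →L[ℝ] Y →L[ℝ] Y) (B₀ : Y →L[ℝ] Y)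
    {N : Fin J → Y → Y} {N₀ : Y → Y} {D : Fin J → Y →L[ℝ] Y} {D₀ : Y →L[ℝ] Y} {u : U} {y : Y}
    (hN : ∀ j, HasStrictFDerivAt (N j) (D j) y) (hN₀ : HasStrictFDerivAt N₀ D₀ y) (y₀ : Y) :
    HasStrictFDerivAt (fun p : U × Y => p.2 - y₀ - (∑ j, B j p.1 (N j p.2) + B₀ (N₀ p.2)))
      (bilinearEqDeriv B B₀ (fun j => N j y) D D₀ u) (u, y) := by
  have hsnd : HasStrictFDerivAt (fun p : U × Y => p.2) (ContinuousLinearMap.snd ℝ U Y) (u, y) :=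
    hasStrictFDerivAt_snd
  have hfst : HasStrictFDerivAt (fun p : U × Y => p.1) (ContinuousLinearMap.fst ℝ U Y) (u, y) :=
    hasStrictFDerivAt_fst
  refine (hsnd.sub_const _).fun_sub ((HasStrictFDerivAt.fun_sum fun j _ => ?_).add ?_)
  · exact (B j).hasStrictFDerivAt_of_bilinear hfst ((hN j).comp (u, y) hsnd)
  · exact B₀.hasStrictFDerivAt.comp (u, y) (hN₀.comp (u, y) hsnd)

/-- Implicit function theorem for the equation `y = y₀ + ∑ j, B j v (N j y) + B₀ (N₀ y)`. -/
theorem exists_implicit_bilinearEq [CompleteSpace U] [CompleteSpace Y]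
    (B : Fin J → U →L[ℝ] Y →L[ℝ] Y) (B₀ : Y →L[ℝ] Y)
    {N : Fin J → Y → Y} {N₀ : Y → Y} {D : Fin J → Y →L[ℝ] Y} {D₀ : Y →L[ℝ] Y} {u : U} {y : Y}
    (hN : ∀ j, HasStrictFDerivAt (N j) (D j) y) (hN₀ : HasStrictFDerivAt N₀ D₀ y) (y₀ : Y)
    (hy : y = y₀ + (∑ j, B j u (N j y) + B₀ (N₀ y))) {K : Y →L[ℝ] Y}
    (hK : ∀ h, K h = ∑ j, B j u (D j h) + B₀ (D₀ h)) (hKu : IsUnit (1 - K)) :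
    ∃ (Ψ : U → Y) (Ψ' : U →L[ℝ] Y), HasStrictFDerivAt Ψ Ψ' u ∧ Ψ u = y ∧
      (∀ᶠ v in 𝓝 u, Ψ v = y₀ + (∑ j, B j v (N j (Ψ v)) + B₀ (N₀ (Ψ v)))) ∧
      ∀ k, Ψ' k = K (Ψ' k) + ∑ j, B j k (N j y) := by
  have hΦ := hasStrictFDerivAt_bilinearEq B B₀ (u := u) hN hN₀ y₀
  set Φ' := bilinearEqDeriv B B₀ (fun j => N j y) D D₀ u with hΦ'
  have hpart : Φ' ∘L ContinuousLinearMap.inr ℝ U Y = 1 - K := by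
    ext h
    simp [hΦ', bilinearEqDeriv_apply, hK]
  have hinv : (Φ' ∘L ContinuousLinearMap.inr ℝ U Y).IsInvertible := by
    rw [hpart]
    obtain ⟨V, hV⟩ := hKu
    exact ⟨ContinuousLinearEquiv.unitsEquiv ℝ _ V, by rw [← hV]; rfl⟩
  have h0 : y - y₀ - (∑ j, B j u (N j y) + B₀ (N₀ y)) = 0 := by
    rw [sub_sub, ← hy, sub_self]
  refine ⟨_, _, hΦ.hasStrictFDerivAt_implicitFunctionOfProdDomain hinv,
    (hΦ.eventually_apply_eq_iff_implicitFunctionOfProdDomain hinv).self_of_nhds.1 rfl, ?_,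
    fun k => ?_⟩
  · filter_upwards [hΦ.eventually_apply_implicitFunctionOfProdDomain hinv] with v hv
    rw [h0, sub_sub, sub_eq_zero] at hv
    exact hv
  -- The derivative of the implicit function is `-S ∘ Φ'(·, 0)` with `S` inverse to `1 - K`.
  -- Applying `1 - K` to it gives the linearized equation.
  · set S := (Φ' ∘L ContinuousLinearMap.inr ℝ U Y).inverse with hS
    have h1 : ∀ w, (1 - K) (S w) = w := fun w => by
      rw [← hpart, hS]
      exact DFunLike.congr_fun hinv.self_comp_inverse w
    have h2 : Φ' (k, 0) = -∑ j, B j k (N j y) := by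
      simp [hΦ', bilinearEqDeriv_apply]
    have h3 := h1 (-Φ' (k, 0))
    rw [h2, neg_neg] at h3
    have h4 : (-S ∘L (Φ' ∘L ContinuousLinearMap.inl ℝ U Y)) k = S (∑ j, B j k (N j y)) := by
      simp only [ContinuousLinearMap.comp_apply, _root_.neg_apply, ContinuousLinearMap.inl_apply, h2,
        map_neg, neg_neg]
    rw [h4]
    rw [_root_.sub_apply, one_apply_eq_self, sub_eq_iff_eq_add'] at h3
    exact h3

end Abstract

lemma sum_controlIntegral_apply (hT : 0 ≤ T) (v : Control J T) (g : Fin J → C(Icc 0 T, F))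
    (g₀ : C(Icc 0 T, F)) (hid : IntervalIntegrable (fun _ : ℝ => ContinuousLinearMap.id ℝ F) volume 0 T)
    (t : Icc 0 T) :
    (∑ j, controlIntegral hT j v (g j) + volterra hT hid g₀) t =
      ∫ s in (0 : ℝ)..t, (∑ j, v s j • IccExtend hT (g j) s + IccExtend hT g₀ s) := by
  have hv := Control.intervalIntegrable hT v
  have e1 : ∀ j, IntervalIntegrable (fun s => v s j • IccExtend hT (g j) s) volume 0 t :=
    fun j => (intervalIntegrable_mono_Icc (intervalIntegrable_component hv j) ⟨le_rfl, hT⟩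
      t.2).smul_continuousOn (continuous_IccExtend hT _).continuousOn
  have e2 : IntervalIntegrable (IccExtend hT g₀) volume 0 t :=
    (continuous_IccExtend hT _).intervalIntegrable _ _
  simp only [ContinuousMap.add_apply, ContinuousMap.sum_apply, controlIntegral_apply,
    volterra_apply, ContinuousLinearMap.id_apply]
  rw [← intervalIntegral.integral_finsetSum fun j _ => e1 j,
    ← intervalIntegral.integral_add (intervalIntegrable_finset_sum e1) e2]

/-- Solutions of a controlled differential equation depend strictly differentiably on the control,
and the derivative solves the linearized equation. -/
theorem exists_flow [CompleteSpace F] (hT : 0 ≤ T) {Ω : Set F} (hΩ : IsOpen Ω)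
    {b : Fin J → ℝ → F → F} {b₀ : ℝ → F → F} (hb : ∀ j, IsC1On T Ω (b j)) (hb₀ : IsC1On T Ω b₀)
    (u : Control J T) {y : ℝ → F} (hy : IsPrimitiveOn 0 T y (fun t => ctrlField b b₀ u t (y t)))
    (hyΩ : ∀ t ∈ Icc 0 T, y t ∈ Ω) :
    ∃ (Ψ : Control J T → C(Icc 0 T, F)) (Ψ' : Control J T →L[ℝ] C(Icc 0 T, F)),
      HasStrictFDerivAt Ψ Ψ' u ∧ (∀ t : Icc 0 T, Ψ u t = y t) ∧
      (∀ᶠ v in 𝓝 u, (∀ t, Ψ v t ∈ Ω) ∧ IsPrimitiveOn 0 T (IccExtend hT (Ψ v))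
        (fun t => ctrlField b b₀ v t (IccExtend hT (Ψ v) t)) ∧ IccExtend hT (Ψ v) 0 = y 0) ∧
      ∀ k, IsPrimitiveOn 0 T (IccExtend hT (Ψ' k))
        (fun t => ctrlFieldDeriv b b₀ u t (y t) (IccExtend hT (Ψ' k) t) +
          ∑ j, k t j • b j t (y t)) ∧ IccExtend hT (Ψ' k) 0 = 0 := by
  have h0 : (0 : ℝ) ∈ Icc 0 T := ⟨le_rfl, hT⟩
  have hid : IntervalIntegrable (fun _ : ℝ => ContinuousLinearMap.id ℝ F) volume 0 T :=
    intervalIntegrable_const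
  let Y : C(Icc 0 T, F) := ⟨fun t => y t, continuousOn_iff_continuous_domRestrict.1 hy.continuousOn⟩
  have hYΩ : ∀ t, Y t ∈ Ω := fun t => hyΩ t t.2
  have hu := Control.intervalIntegrable hT u
  have hA := intervalIntegrable_ctrlFieldDeriv le_rfl hT le_rfl hb hb₀ hu hy.continuousOn hyΩ
  have hIsub : ∀ t : Icc 0 T, uIcc 0 (t : ℝ) ⊆ Icc 0 T := fun t => uIcc_subset_Icc h0 t.2
  have hfield : ∀ (v : Control J T) (g : C(Icc 0 T, F)) (hg : ∀ t, g t ∈ Ω) (t : Icc 0 T),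
      (∑ j, controlIntegral hT j v (superposition (b j) g) +
        volterra hT hid (superposition b₀ g)) t =
        ∫ s in (0 : ℝ)..t, ctrlField b b₀ v s (IccExtend hT g s) := by
    intro v g hg t
    rw [sum_controlIntegral_apply]
    refine intervalIntegral.integral_congr fun s hs => ?_
    have hs' := hIsub t hs
    simp only [ctrlField, IccExtend_of_mem hT _ hs', (hb _).superposition_apply hg,
      hb₀.superposition_apply hg]
  -- The control enters the integral equation only through the bilinear maps `controlIntegral`, the
  -- nonlinearity only through superposition operators. A control that is merely square integrable
  -- therefore costs no differentiability.
  obtain ⟨Ψ, Ψ', hΨ, hΨu, hΨv, hΨ'⟩ := exists_implicit_bilinearEq (u := u) (y := Y)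
    (fun j => controlIntegral hT j)
    (volterra hT hid) (fun j => (hb j).hasStrictFDerivAt_superposition hΩ Y hYΩ)
    (hb₀.hasStrictFDerivAt_superposition hΩ Y hYΩ) (ContinuousMap.const _ (y 0))
    (by
      ext t
      rw [ContinuousMap.add_apply, hfield u Y hYΩ t, ContinuousMap.const_apply]
      refine (hy.2 t t.2).trans ?_
      congr 1
      refine intervalIntegral.integral_congr fun s hs => ?_
      simp only [IccExtend_of_mem hT _ (hIsub t hs)]
      rfl)
    (K := volterra hT hA)
    (fun h => by
      ext t
      rw [sum_controlIntegral_apply, volterra_apply]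
      refine intervalIntegral.integral_congr fun s hs => ?_
      have hs' := hIsub t hs
      simp only [ctrlFieldDeriv, IccExtend_of_mem hT _ hs', pathMul_apply]
      simp [IsC1On.fderivPath, Y]
      rfl)
    (isUnit_one_sub_volterra hT hA)
  refine ⟨Ψ, Ψ', hΨ, fun t => by rw [hΨu]; rfl, ?_, fun k => ?_⟩
  -- Only the inclusion of the tube in `Ω` matters, so `1` is an arbitrary choice. Inside `Ω` the
  -- superposition operators do not take their default value zero.
  · obtain ⟨δ, hδ, htube⟩ := hb₀.exists_tube hΩ Y hYΩ one_pos
    have hnear : ∀ᶠ v in 𝓝 u, Ψ v ∈ Metric.ball Y δ := by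
      have := hΨ.continuousAt.tendsto
      rw [hΨu] at this
      exact this.eventually (Metric.ball_mem_nhds _ hδ)
    filter_upwards [hnear, hΨv] with v hv hv0
    have hvΩ : ∀ t, Ψ v t ∈ Ω := fun t =>
      (htube t).1 ((ContinuousMap.dist_apply_le_dist t).trans_lt hv)
    have heq : ∀ t ∈ Icc 0 T, IccExtend hT (Ψ v) t =
        y 0 + ∫ s in (0 : ℝ)..t, ctrlField b b₀ v s (IccExtend hT (Ψ v) s) := by
      intro t ht
      have := DFunLike.congr_fun hv0 (⟨t, ht⟩ : Icc 0 T)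
      rw [ContinuousMap.add_apply, hfield v _ hvΩ, ContinuousMap.const_apply] at this
      rwa [IccExtend_of_mem hT _ ht]
    refine ⟨hvΩ, IsPrimitiveOn.of_eq hT ?_ heq, ?_⟩
    · exact intervalIntegrable_ctrlField le_rfl hT le_rfl hb hb₀ (Control.intervalIntegrable hT v)
        (continuous_IccExtend hT _).continuousOn fun t ht => by
          rw [IccExtend_of_mem hT _ ht]; exact hvΩ _
    · rw [heq 0 h0]
      simp
  · have hk := Control.intervalIntegrable hT k
    have hi1 := IntervalIntegrable.clm_apply_continuousOn hT hA
      (continuous_IccExtend hT (Ψ' k)).continuousOn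
    have hi2 : IntervalIntegrable (fun s => ∑ j, k s j • b j s (y s)) volume 0 T := by
      refine intervalIntegrable_finset_sum fun j => ?_
      refine (intervalIntegrable_component hk j).smul_continuousOn ?_
      rw [uIcc_of_le hT]
      exact (hb j).continuousOn_path le_rfl le_rfl hy.continuousOn hyΩ
    have heq : ∀ t ∈ Icc 0 T, IccExtend hT (Ψ' k) t =
        0 + ∫ s in (0 : ℝ)..t, (ctrlFieldDeriv b b₀ u s (y s) (IccExtend hT (Ψ' k) s) +
          ∑ j, k s j • b j s (y s)) := by
      intro t ht
      have h1 := DFunLike.congr_fun (hΨ' k) (⟨t, ht⟩ : Icc 0 T)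
      have h2 := sum_controlIntegral_apply hT k (fun j => superposition (b j) Y) 0 hid ⟨t, ht⟩
      rw [map_zero, add_zero] at h2
      rw [ContinuousMap.add_apply, h2, volterra_apply] at h1
      rw [IccExtend_of_mem hT _ ht, h1, zero_add,
        intervalIntegral.integral_add (intervalIntegrable_mono_Icc hi1 h0 ht)
          (intervalIntegrable_mono_Icc hi2 h0 ht)]
      congr 1
      refine intervalIntegral.integral_congr fun s hs => ?_
      have hs' := hIsub ⟨t, ht⟩ hs
      simp only [IccExtend_of_mem hT _ hs', (hb _).superposition_apply hYΩ]
      simp [Y]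
      rfl
    refine ⟨IsPrimitiveOn.of_eq hT (hi1.add hi2) heq, ?_⟩
    rw [heq 0 h0]
    simp

end ControlledODE

/-! ### Vector fields in charts and finite covers of compact sets -/

section Manifold

variable {d : ℕ} {M : Type*} [TopologicalSpace M] [ChartedSpace (EuclideanSpace ℝ (Fin d)) M]
  [IsManifold (𝓡 d) ∞ M] {G H : Type*} [NormedAddCommGroup G] [NormedSpace ℝ G]
  [NormedAddCommGroup H] [NormedSpace ℝ H]

/-- The differential of a vector-valued function on `M`. -/
def mdiff (g : M → G) (x : M) : TangentSpace (𝓡 d) x →L[ℝ] G :=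
  mfderiv (𝓡 d) 𝓘(ℝ, G) g x

omit [IsManifold (𝓡 d) ∞ M] in
lemma mdiff_congr {g g' : M → G} {x : M} (h : g =ᶠ[𝓝 x] g') :
    (mdiff g x : TangentSpace (𝓡 d) x →L[ℝ] G) = mdiff g' x :=
  h.mfderiv_eq

omit [IsManifold (𝓡 d) ∞ M] in
lemma mdiff_comp {g : M → G} {h : G → H} {x : M} (hh : DifferentiableAt ℝ h (g x))
    (hg : MDifferentiableAt (𝓡 d) 𝓘(ℝ, G) g x) (v : TangentSpace (𝓡 d) x) :
    mdiff (fun x => h (g x)) x v = fderiv ℝ h (g x) (mdiff g x v) := by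
  have := mfderiv_comp_apply x hh.mdifferentiableAt hg v
  rw [mfderiv_eq_fderiv] at this
  exact this

lemma mdifferentiableAt_extChartAt' {c x : M} (hx : x ∈ (extChartAt (𝓡 d) c).source) :
    MDifferentiableAt (𝓡 d) 𝓘(ℝ, EuclideanSpace ℝ (Fin d)) (extChartAt (𝓡 d) c) x := by
  rw [extChartAt_source] at hx
  exact (contMDiffAt_extChartAt' (n := 1) hx).mdifferentiableAt one_ne_zero

lemma contMDiffAt_extChartAt_symm {n : ℕ∞} {c : M} {z : EuclideanSpace ℝ (Fin d)}
    (hz : z ∈ (extChartAt (𝓡 d) c).target) :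
    ContMDiffAt 𝓘(ℝ, EuclideanSpace ℝ (Fin d)) (𝓡 d) n (extChartAt (𝓡 d) c).symm z :=
  ((contMDiffOn_extChartAt_symm (n := (⊤ : ℕ∞)) c).contMDiffAt
    ((isOpen_extChartAt_target c).mem_nhds hz)).of_le (mod_cast le_top)

/-- A smooth function on `M` in the chart around `c`. -/
lemma contDiffAt_comp_extChartAt_symm {n : ℕ∞} {g : M → G} {c : M} {z : EuclideanSpace ℝ (Fin d)}
    (hz : z ∈ (extChartAt (𝓡 d) c).target)
    (hg : ContMDiffAt (𝓡 d) 𝓘(ℝ, G) n g ((extChartAt (𝓡 d) c).symm z)) :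
    ContDiffAt ℝ n (fun z => g ((extChartAt (𝓡 d) c).symm z)) z :=
  (hg.comp z (contMDiffAt_extChartAt_symm hz)).contDiffAt

lemma mdiff_eq_fderiv_chart {g : M → G} {c x : M} (hx : x ∈ (extChartAt (𝓡 d) c).source)
    (hg : ContMDiffAt (𝓡 d) 𝓘(ℝ, G) 1 g x) (v : TangentSpace (𝓡 d) x) :
    mdiff g x v = fderiv ℝ (fun z => g ((extChartAt (𝓡 d) c).symm z)) (extChartAt (𝓡 d) c x)
      (mdiff (extChartAt (𝓡 d) c) x v) := by
  have h1 : g =ᶠ[𝓝 x] fun x => g ((extChartAt (𝓡 d) c).symm (extChartAt (𝓡 d) c x)) := by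
    filter_upwards [(isOpen_extChartAt_source c).mem_nhds hx] with y hy
    rw [(extChartAt (𝓡 d) c).left_inv hy]
  have h2 : DifferentiableAt ℝ (fun z => g ((extChartAt (𝓡 d) c).symm z)) (extChartAt (𝓡 d) c x) := by
    refine (contDiffAt_comp_extChartAt_symm (n := 1) ((extChartAt (𝓡 d) c).map_source hx) ?_).differentiableAt one_ne_zero
    rwa [(extChartAt (𝓡 d) c).left_inv hx]
  rw [mdiff_congr h1]
  exact mdiff_comp h2 (mdifferentiableAt_extChartAt' hx) v

omit [IsManifold (𝓡 d) ∞ M] in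
lemma mdiff_extChartAt_eq_localRep {c : M} (V : ∀ x : M, TangentSpace (𝓡 d) x) {x : M}
    (hx : x ∈ (extChartAt (𝓡 d) c).source) :
    mdiff (extChartAt (𝓡 d) c) x (V x) = localRep c V (extChartAt (𝓡 d) c x) := by
  simp only [localRep, mdiff]
  rw [(extChartAt (𝓡 d) c).left_inv hx]
  rfl

lemma injective_mdiff_extChartAt {c x : M} (hx : x ∈ (extChartAt (𝓡 d) c).source) :
    Function.Injective (mdiff (extChartAt (𝓡 d) c) x :
      TangentSpace (𝓡 d) x →L[ℝ] EuclideanSpace ℝ (Fin d)) :=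
  (isInvertible_mfderiv_extChartAt hx).injective

/-- Smoothness of a vector field is smoothness of its components in a chart. -/
lemma contMDiffOn_section_iff_mdiff_extChartAt {n : ℕ∞} (c : M)
    (V : ∀ x : M, TangentSpace (𝓡 d) x) :
    ContMDiffOn (𝓡 d) (𝓡 d).tangent n (fun x => (⟨x, V x⟩ : TangentBundle (𝓡 d) M))
      (chartAt (EuclideanSpace ℝ (Fin d)) c).source ↔
    ContMDiffOn (𝓡 d) 𝓘(ℝ, EuclideanSpace ℝ (Fin d)) n
      (fun x => mdiff (extChartAt (𝓡 d) c) x (V x))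
      (chartAt (EuclideanSpace ℝ (Fin d)) c).source := by
  have hI : IsManifold (𝓡 d) (n + 1) M := IsManifold.of_le (n := (⊤ : ℕ∞)) (by exact_mod_cast le_top)
  let e := trivializationAt (EuclideanSpace ℝ (Fin d)) (TangentSpace (𝓡 d) : M → Type _) c
  have hbase : e.baseSet = (chartAt (EuclideanSpace ℝ (Fin d)) c).source := rfl
  have hcv := TangentBundle.contMDiffVectorBundle (I := 𝓡 d) (M := M) (n := n)
  have := e.contMDiffOn_section_baseSet_iff (IB := 𝓡 d) (n := n) (s := V)
  rw [hbase] at this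
  refine this.trans (contMDiffOn_congr fun x hx => ?_)
  have h1 := TangentBundle.continuousLinearMapAt_trivializationAt (I := 𝓡 d) hx
  have h2 := e.continuousLinearMapAt_apply_of_mem (R := ℝ) (b := x) (by rwa [hbase]) (V x)
  rw [← h2]
  exact DFunLike.congr_fun h1.symm (V x) |>.symm

lemma contDiffOn_localRep {n : ℕ∞} {V : ∀ x : M, TangentSpace (𝓡 d) x}
    (hV : ContMDiff (𝓡 d) (𝓡 d).tangent n (fun x => (⟨x, V x⟩ : TangentBundle (𝓡 d) M))) (c : M) :
    ContDiffOn ℝ n (localRep c V) (extChartAt (𝓡 d) c).target := by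
  intro z hz
  have hz' : (extChartAt (𝓡 d) c).symm z ∈ (chartAt (EuclideanSpace ℝ (Fin d)) c).source := by
    rw [← extChartAt_source (I := 𝓡 d)]; exact (extChartAt (𝓡 d) c).map_target hz
  have h := (((contMDiffOn_section_iff_mdiff_extChartAt c V).1 hV.contMDiffOn).contMDiffAt
    ((chartAt (EuclideanSpace ℝ (Fin d)) c).open_source.mem_nhds hz'))
  exact (contDiffAt_comp_extChartAt_symm hz h).contDiffWithinAt

/-- A `C¹` field is a constant `C¹` time-dependent field. -/
lemma IsC1Field.isC1TimeField {V : ∀ x : M, TangentSpace (𝓡 d) x} (hV : IsC1Field V) (T : ℝ) :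
    IsC1TimeField T (fun _ => V) := fun c =>
  have := IsC1On.of_contDiffOn (T := T) (isOpen_extChartAt_target c)
    (contDiffOn_localRep (n := 1) hV c)
  ⟨this.1, this.2, this.3⟩

/-- The coordinate field `∂_e` of the chart around `c`. -/
def chartField (c : M) (e : EuclideanSpace ℝ (Fin d)) (x : M) : TangentSpace (𝓡 d) x :=
  (mdiff (extChartAt (𝓡 d) c) x : TangentSpace (𝓡 d) x →L[ℝ] EuclideanSpace ℝ (Fin d)).inverse e

lemma mdiff_extChartAt_chartField {c x : M} (hx : x ∈ (extChartAt (𝓡 d) c).source)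
    (e : EuclideanSpace ℝ (Fin d)) : mdiff (extChartAt (𝓡 d) c) x (chartField c e x) = e := by
  have h : (mdiff (extChartAt (𝓡 d) c) x :
    TangentSpace (𝓡 d) x →L[ℝ] EuclideanSpace ℝ (Fin d)).IsInvertible :=
    isInvertible_mfderiv_extChartAt hx
  exact DFunLike.congr_fun h.self_comp_inverse e

/-- The costate equation is tested on globally smooth fields only; cutting off makes the coordinate
fields of a chart available as test fields. -/
lemma isSmoothField_smul_chartField {c : M} {ψ : M → ℝ} (hψ : ContMDiff (𝓡 d) 𝓘(ℝ, ℝ) ∞ ψ)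
    (hsupp : tsupport ψ ⊆ (chartAt (EuclideanSpace ℝ (Fin d)) c).source)
    (e : EuclideanSpace ℝ (Fin d)) : IsSmoothField (fun x => ψ x • chartField c e x) := by
  refine ContMDiffOn.smul_section_of_tsupport (s := chartField c e) hψ.contMDiffOn
    (chartAt (EuclideanSpace ℝ (Fin d)) c).open_source hsupp ?_
  refine (contMDiffOn_section_iff_mdiff_extChartAt (n := (⊤ : ℕ∞)) c _).2 ?_
  refine (contMDiffOn_const (c := e)).congr fun x hx => ?_
  exact mdiff_extChartAt_chartField (by rwa [extChartAt_source]) e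

variable (d) in
/-- Finitely many charts, cutoff functions and a partition of unity around a set `K`. -/
structure Cover (K : Set M) where
  s : Finset M
  ρ : ∀ c : s, SmoothBumpFunction (𝓡 d) (c : M)
  ψ : s → M → ℝ
  contMDiff_ψ : ∀ c, ContMDiff (𝓡 d) 𝓘(ℝ, ℝ) ∞ (ψ c)
  -- The support lies where the bump function equals one, so there the cut-off chart is the chart
  -- itself.
  tsupport_ψ : ∀ c, tsupport (ψ c) ⊆ {x | x ∈ (chartAt (EuclideanSpace ℝ (Fin d)) (c : M)).source ∧
    dist (extChartAt (𝓡 d) (c : M) x) (extChartAt (𝓡 d) (c : M) c) < (ρ c).rIn}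
  sum_eq_one : ∀ x ∈ K, ∑ c, ψ c x = 1

lemma exists_cover [T2Space M] [SecondCountableTopology M] {K : Set M} (hK : IsCompact K) :
    Nonempty (Cover d K) := by
  have hloc : LocallyCompactSpace M := Manifold.locallyCompact_of_finiteDimensional (𝓡 d)
  let ρ : ∀ c : M, SmoothBumpFunction (𝓡 d) c := fun c => Classical.arbitrary _
  let U : M → Set M := fun c => {x | x ∈ (chartAt (EuclideanSpace ℝ (Fin d)) c).source ∧
    dist (extChartAt (𝓡 d) c x) (extChartAt (𝓡 d) c c) < (ρ c).rIn}
  have hU : ∀ c, IsOpen (U c) := fun c => by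
    have := isOpen_extChartAt_preimage (I := 𝓡 d) c (Metric.isOpen_ball (x := extChartAt (𝓡 d) c c)
      (ε := (ρ c).rIn))
    exact this
  obtain ⟨s, hs⟩ := hK.elim_finite_subcover U hU fun x _ => mem_iUnion.2 ⟨x, mem_chart_source _ x,
    by rw [dist_self]; exact (ρ x).rIn_pos⟩
  have hs' : K ⊆ ⋃ c : s, U c := by
    intro x hx
    obtain ⟨c, hc, hxc⟩ := mem_iUnion₂.1 (hs hx)
    exact mem_iUnion.2 ⟨⟨c, hc⟩, hxc⟩
  obtain ⟨f, hf⟩ := SmoothPartitionOfUnity.exists_isSubordinate (𝓡 d) hK.isClosed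
    (fun c : s => U c) (fun c => hU c) hs'
  exact ⟨{  s := s
            ρ := fun c => ρ c
            ψ := fun c => f c
            contMDiff_ψ := fun c => (f c).contMDiff
            tsupport_ψ := fun c => hf c
            sum_eq_one := fun x hx => by
              rw [← finsum_eq_sum_of_fintype]; exact f.sum_eq_one hx }⟩

end Manifold

/-! ### Embedding near a compact set, and extension of functions and fields -/

section Embedding

variable {d : ℕ} {M : Type*} [TopologicalSpace M] [ChartedSpace (EuclideanSpace ℝ (Fin d)) M]
  {K : Set M}

namespace Cover

/-- The vector space into which the cover embeds a neighbourhood of `K`. -/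
abbrev Space (D : Cover d K) : Type _ := D.s → EuclideanSpace ℝ (Fin d) × ℝ

variable (D : Cover d K)

/-- The embedding defined by the cut off charts and the partition of unity. -/
def emb (x : M) : D.Space := fun c =>
  -- The cutoff contracts towards the centre of the chart, which keeps this component in the ball of
  -- radius `rOut`, hence in the chart target, at every point of `M`.
  (D.ρ c x • (extChartAt (𝓡 d) (c : M) x - extChartAt (𝓡 d) (c : M) c) +
    extChartAt (𝓡 d) (c : M) c, D.ψ c x)

/-- The open set on which functions and fields on `M` are extended. -/
def dom : Set D.Space :=
  {y | (∀ c : D.s, (y c).1 ∈ Metric.ball (extChartAt (𝓡 d) (c : M) c) (D.ρ c).rOut) ∧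
    -- The sum is one on the image of `K`; a positive lower bound allows the weights to be
    -- normalized.
    1 / 2 < ∑ c : D.s, (y c).2}

/-- The weights of the charts. -/
def weight (c : D.s) (y : D.Space) : ℝ := (y c).2 / ∑ c', (y c').2

/-- The point of `M` which has the coordinates given by `y` in the chart with index `c`. -/
def retr (c : D.s) (y : D.Space) : M := (extChartAt (𝓡 d) (c : M)).symm (y c).1

lemma isOpen_dom : IsOpen D.dom := by
  have h : Continuous fun y : D.Space => ∑ c : D.s, (y c).2 := by fun_prop
  have h' : D.dom = (⋂ c : D.s, (fun y : D.Space => (y c).1) ⁻¹'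
      Metric.ball (extChartAt (𝓡 d) (c : M) c) (D.ρ c).rOut) ∩
      {y : D.Space | 1 / 2 < ∑ c : D.s, (y c).2} := by
    ext y; simp [dom]
  rw [h']
  exact (isOpen_iInter_of_finite fun c => Metric.isOpen_ball.preimage (by fun_prop)).inter
    (isOpen_lt continuous_const h)

lemma fst_mem_target {y : D.Space} (hy : y ∈ D.dom) (c : D.s) :
    (y c).1 ∈ (extChartAt (𝓡 d) (c : M)).target :=
  (D.ρ c).ball_subset ⟨hy.1 c, by simp⟩

lemma sum_weight {y : D.Space} (hy : y ∈ D.dom) : ∑ c, D.weight c y = 1 := by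
  simp only [weight, ← Finset.sum_div]
  exact div_self (by linarith [hy.2] : (0 : ℝ) < _).ne'

lemma exists_weight_ne_zero {y : D.Space} (hy : y ∈ D.dom) : ∃ c, D.weight c y ≠ 0 := by
  by_contra! h
  have := D.sum_weight hy
  simp [h] at this

lemma contDiffOn_weight {n : ℕ∞} (c : D.s) : ContDiffOn ℝ n (D.weight c) D.dom := by
  refine ContDiffOn.div (by fun_prop) (by fun_prop) fun y hy => ?_
  exact (by linarith [hy.2] : (0 : ℝ) < _).ne'

lemma emb_fst_mem_ball (c : D.s) (x : M) :
    (D.emb x c).1 ∈ Metric.ball (extChartAt (𝓡 d) (c : M) c) (D.ρ c).rOut := by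
  rw [Metric.mem_ball, dist_eq_norm]
  simp only [emb, add_sub_cancel_right]
  by_cases hx : x ∈ Function.support (D.ρ c)
  · have h1 := hx
    rw [(D.ρ c).support_eq_inter_preimage] at h1
    have h2 := h1.2
    rw [mem_preimage, Metric.mem_ball, dist_eq_norm] at h2
    have h3 := (D.ρ c).mem_Icc (x := x)
    rw [norm_smul, Real.norm_of_nonneg h3.1]
    exact (mul_le_of_le_one_left (norm_nonneg _) h3.2).trans_lt h2
  · rw [Function.notMem_support.1 hx, zero_smul, norm_zero]
    exact (D.ρ c).rOut_pos

lemma emb_mem_dom_iff {x : M} : D.emb x ∈ D.dom ↔ 1 / 2 < ∑ c, D.ψ c x :=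
  ⟨fun h => h.2, fun h => ⟨fun c => D.emb_fst_mem_ball c x, h⟩⟩

lemma emb_mem_dom {x : M} (hx : x ∈ K) : D.emb x ∈ D.dom := by
  rw [emb_mem_dom_iff, D.sum_eq_one x hx]; norm_num

lemma mem_tsupport_of_weight {c : D.s} {x : M} (h : D.weight c (D.emb x) ≠ 0) :
    x ∈ tsupport (D.ψ c) :=
  subset_tsupport _ fun h0 => h (by simp [weight, emb, h0])

lemma mem_chart_source_of_tsupport {c : D.s} {x : M} (h : x ∈ tsupport (D.ψ c)) :
    x ∈ (extChartAt (𝓡 d) (c : M)).source := by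
  rw [extChartAt_source]; exact (D.tsupport_ψ c h).1

lemma emb_fst_eventuallyEq {c : D.s} {x : M} (h : x ∈ tsupport (D.ψ c)) :
    (fun x => (D.emb x c).1) =ᶠ[𝓝 x] extChartAt (𝓡 d) (c : M) := by
  have h' := D.tsupport_ψ c h
  filter_upwards [(D.ρ c).eventuallyEq_one_of_dist_lt h'.1 h'.2] with y hy
  simp [emb, hy]

lemma emb_fst_eq {c : D.s} {x : M} (h : x ∈ tsupport (D.ψ c)) :
    (D.emb x c).1 = extChartAt (𝓡 d) (c : M) x := (D.emb_fst_eventuallyEq h).eq_of_nhds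

lemma retr_emb {c : D.s} {x : M} (h : x ∈ tsupport (D.ψ c)) : D.retr c (D.emb x) = x := by
  rw [retr, D.emb_fst_eq h]
  exact (extChartAt (𝓡 d) (c : M)).left_inv (D.mem_chart_source_of_tsupport h)

/-- The extension of a function on `M` to the ambient space. -/
def extFun {G : Type*} [NormedAddCommGroup G] [NormedSpace ℝ G] (g : M → G) (y : D.Space) : G :=
  ∑ c, D.weight c y • g (D.retr c y)

/-- The extension of a vector field on `M` to the ambient space. -/
def extField (V : ∀ x : M, TangentSpace (𝓡 d) x) (y : D.Space) : D.Space :=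
  ∑ c : D.s, D.weight c y •
    fderiv ℝ (fun z => D.emb ((extChartAt (𝓡 d) (c : M)).symm z)) (y c).1 (localRep (c : M) V (y c).1)

/-- On the image of `M` every chart of nonzero weight contains the point and gives the same value,
and the weights add up to one. So averaging over charts extends functions and fields without
changing them on `M`. -/
lemma sum_weight_smul_emb {G : Type*} [NormedAddCommGroup G] [NormedSpace ℝ G] {x : M}
    (hx : D.emb x ∈ D.dom) {F : D.s → G} {v : G} (h : ∀ c, x ∈ tsupport (D.ψ c) → F c = v) :
    ∑ c, D.weight c (D.emb x) • F c = v := by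
  rw [← one_smul ℝ v, ← D.sum_weight hx, Finset.sum_smul]
  refine Finset.sum_congr rfl fun c _ => ?_
  by_cases hc : D.weight c (D.emb x) = 0
  · simp [hc]
  · rw [h c (D.mem_tsupport_of_weight hc)]

lemma extFun_emb {G : Type*} [NormedAddCommGroup G] [NormedSpace ℝ G] (g : M → G) {x : M}
    (hx : D.emb x ∈ D.dom) : D.extFun g (D.emb x) = g x :=
  D.sum_weight_smul_emb hx fun c hc => by rw [D.retr_emb hc]

/-- The part of `M` lying over `D.dom` is caught in a compact set, whose image is closed. This is
needed to pass to limits in the invariance argument. -/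
lemma isCompact_preimage_dom [T2Space M] : ∃ K' : Set M, IsCompact K' ∧ D.emb ⁻¹' D.dom ⊆ K' := by
  refine ⟨⋃ c, tsupport (D.ψ c), isCompact_iUnion fun c => ?_, fun x hx => ?_⟩
  · refine (D.ρ c).hasCompactSupport.isCompact.of_isClosed_subset (isClosed_tsupport _)
      fun x hx => subset_tsupport _ ?_
    have h := D.tsupport_ψ c hx
    rw [Function.mem_support, (D.ρ c).one_of_dist_le h.1 h.2.le]
    exact one_ne_zero
  · obtain ⟨c, hc⟩ := D.exists_weight_ne_zero hx
    exact mem_iUnion.2 ⟨c, D.mem_tsupport_of_weight hc⟩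

/-- The ambient point selects a chart of nonzero weight and contains the coordinates in it. -/
lemma injOn_emb : InjOn D.emb (D.emb ⁻¹' D.dom) := by
  intro x hx x' _ h
  obtain ⟨c, hc⟩ := D.exists_weight_ne_zero hx
  rw [← D.retr_emb (D.mem_tsupport_of_weight hc), h,
    D.retr_emb (D.mem_tsupport_of_weight (c := c) (h ▸ hc))]

section Smooth

variable [IsManifold (𝓡 d) ∞ M]

lemma contMDiffAt_retr {n : ℕ∞} (c : D.s) {y : D.Space} (hy : y ∈ D.dom) :
    ContMDiffAt 𝓘(ℝ, D.Space) (𝓡 d) n (D.retr c) y :=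
  (contMDiffAt_extChartAt_symm (D.fst_mem_target hy c)).comp y
    (ContDiffAt.contMDiffAt (f := fun y : D.Space => (y c).1) (by fun_prop))

lemma contDiffOn_extFun {n : ℕ∞} {G : Type*} [NormedAddCommGroup G] [NormedSpace ℝ G] {g : M → G}
    (hg : ContMDiff (𝓡 d) 𝓘(ℝ, G) n g) : ContDiffOn ℝ n (D.extFun g) D.dom := by
  refine ContDiffOn.sum fun c _ => (D.contDiffOn_weight c).smul fun y hy => ?_
  exact ((hg.contMDiffAt.comp y (D.contMDiffAt_retr c hy)).contDiffAt).contDiffWithinAt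

variable [T2Space M]

lemma contMDiff_emb : ContMDiff (𝓡 d) 𝓘(ℝ, D.Space) ∞ D.emb := by
  rw [contMDiff_pi_space]
  intro c
  rw [contMDiff_prod_module_iff]
  refine ⟨?_, D.contMDiff_ψ c⟩
  refine ContMDiff.add ?_ contMDiff_const
  refine (D.ρ c).contMDiff_smul ?_
  exact contMDiffOn_extChartAt.sub contMDiffOn_const

lemma continuous_emb : Continuous D.emb := D.contMDiff_emb.continuous

lemma mdifferentiableAt_emb (x : M) : MDifferentiableAt (𝓡 d) 𝓘(ℝ, D.Space) D.emb x :=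
  D.contMDiff_emb.contMDiffAt.mdifferentiableAt (by simp)

lemma mdiff_eq_fderiv_extFun {G : Type*} [NormedAddCommGroup G] [NormedSpace ℝ G] {g : M → G}
    (hg : ContMDiff (𝓡 d) 𝓘(ℝ, G) 1 g) {x : M} (hx : D.emb x ∈ D.dom)
    (v : TangentSpace (𝓡 d) x) :
    mdiff g x v = fderiv ℝ (D.extFun g) (D.emb x) (mdiff D.emb x v) := by
  have h1 : g =ᶠ[𝓝 x] fun x => D.extFun g (D.emb x) := by
    filter_upwards [(D.isOpen_dom.preimage D.continuous_emb).mem_nhds hx] with x hx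
    rw [D.extFun_emb g hx]
  rw [mdiff_congr h1]
  exact mdiff_comp (((D.contDiffOn_extFun (n := 1) hg).contDiffAt
    (D.isOpen_dom.mem_nhds hx)).differentiableAt one_ne_zero) (D.mdifferentiableAt_emb x) v

lemma mdiff_emb_fst {c : D.s} {x : M}
    (h : (fun x => (D.emb x c).1) =ᶠ[𝓝 x] extChartAt (𝓡 d) (c : M)) (v : TangentSpace (𝓡 d) x) :
    (mdiff D.emb x v c).1 = mdiff (extChartAt (𝓡 d) (c : M)) x v := by
  rw [← mdiff_congr h]
  let L : D.Space →L[ℝ] EuclideanSpace ℝ (Fin d) :=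
    (ContinuousLinearMap.fst ℝ _ _).comp (ContinuousLinearMap.proj c)
  have := mdiff_comp (h := L) L.differentiableAt (D.mdifferentiableAt_emb x) v
  rw [L.fderiv] at this
  exact this.symm

lemma injective_mdiff_emb {x : M} (hx : D.emb x ∈ D.dom) :
    Function.Injective (mdiff D.emb x : TangentSpace (𝓡 d) x →L[ℝ] D.Space) := by
  obtain ⟨c, hc⟩ := D.exists_weight_ne_zero hx
  have hc := D.mem_tsupport_of_weight hc
  intro v w h
  refine injective_mdiff_extChartAt (D.mem_chart_source_of_tsupport hc) ?_
  have hc := D.emb_fst_eventuallyEq hc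
  rw [← D.mdiff_emb_fst hc, ← D.mdiff_emb_fst hc, h]

lemma contDiffAt_emb_chart {n : ℕ∞} {c : M} {z : EuclideanSpace ℝ (Fin d)}
    (hz : z ∈ (extChartAt (𝓡 d) c).target) :
    ContDiffAt ℝ n (fun z => D.emb ((extChartAt (𝓡 d) c).symm z)) z :=
  contDiffAt_comp_extChartAt_symm hz (D.contMDiff_emb.contMDiffAt.of_le (mod_cast le_top))

lemma fderiv_emb_chart {c x : M} (hx : x ∈ (extChartAt (𝓡 d) c).source)
    (v : TangentSpace (𝓡 d) x) :
    fderiv ℝ (fun z => D.emb ((extChartAt (𝓡 d) c).symm z)) (extChartAt (𝓡 d) c x)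
      (mdiff (extChartAt (𝓡 d) c) x v) = mdiff D.emb x v :=
  (mdiff_eq_fderiv_chart hx (D.contMDiff_emb.contMDiffAt.of_le (by simp)) v).symm

lemma extField_emb (V : ∀ x : M, TangentSpace (𝓡 d) x) {x : M} (hx : D.emb x ∈ D.dom) :
    D.extField V (D.emb x) = mdiff D.emb x (V x) := by
  refine D.sum_weight_smul_emb hx fun c hc => ?_
  have hs := D.mem_chart_source_of_tsupport hc
  rw [D.emb_fst_eq hc, ← mdiff_extChartAt_eq_localRep V hs]
  exact D.fderiv_emb_chart hs (V x)

/-- The extension multiplies the chart components by the derivative of a smooth map and by smooth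
weights, so no derivative of the field is lost. -/
lemma isC1On_extField {T : ℝ} {a : ℝ → ∀ x : M, TangentSpace (𝓡 d) x} (ha : IsC1TimeField T a) :
    IsC1On T D.dom (fun t => D.extField (a t)) := by
  refine IsC1On.sum D.isOpen_dom fun c _ => ?_
  have h1 : IsC1On T (extChartAt (𝓡 d) (c : M)).target (fun t => localRep (c : M) (a t)) :=
    ⟨(ha c).1, (ha c).2.1, (ha c).2.2⟩
  have h2 : ContDiffOn ℝ 1 (fun z => fderiv ℝ
      (fun z => D.emb ((extChartAt (𝓡 d) (c : M)).symm z)) z) (extChartAt (𝓡 d) (c : M)).target :=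
    fun z hz => ((D.contDiffAt_emb_chart (n := 2) hz).fderiv_right
      (by norm_num)).contDiffWithinAt
  have h3 := h1.clm_apply (isOpen_extChartAt_target (c : M)) h2
  have h4 := h3.comp (isOpen_extChartAt_target (c : M)) D.isOpen_dom
    (φ := fun y : D.Space => (y c).1) (by fun_prop) fun y hy => D.fst_mem_target hy c
  exact h4.smul D.isOpen_dom (D.contDiffOn_weight (n := 1) c)

end Smooth

end Cover

end Embedding

/-! ### Continuation in time and uniqueness of solutions -/

section Continuation

variable {F : Type*} [NormedAddCommGroup F] [NormedSpace ℝ F] {J : ℕ} {T : ℝ}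

lemma exists_forall_mem_of_continuousOn {X : Type*} [TopologicalSpace X] {y : ℝ → X}
    (hy : ContinuousOn y (Icc 0 T)) {t₀ : ℝ} (ht₀ : t₀ ∈ Ico 0 T) {U : Set X} (hU : U ∈ 𝓝 (y t₀)) :
    ∃ d ∈ Ioc t₀ T, ∀ t ∈ Icc t₀ d, y t ∈ U := by
  have h1 : ∀ᶠ t in 𝓝[Icc 0 T] t₀, y t ∈ U := hy t₀ ⟨ht₀.1, ht₀.2.le⟩ hU
  obtain ⟨ε, hε, h⟩ := Metric.eventually_nhds_iff.1 (eventually_nhdsWithin_iff.1 h1)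
  refine ⟨min T (t₀ + ε / 2), ⟨lt_min ht₀.2 (by linarith), min_le_left _ _⟩, fun t ht => h ?_
    ⟨ht₀.1.trans ht.1, ht.2.trans (min_le_left _ _)⟩⟩
  have := ht.2.trans (min_le_right _ _)
  rw [Real.dist_eq, abs_lt]
  constructor <;> linarith [ht.1]

/-- A closed property that can always be continued to the right holds on the whole interval. -/
lemma forall_mem_Icc_of_continuation {S : Set ℝ} (hS : IsClosed (S ∩ Icc 0 T)) (h0 : (0 : ℝ) ∈ S)
    (h : ∀ t ∈ S ∩ Ico 0 T, ∃ d ∈ Ioc t T, Icc t d ⊆ S) : Icc 0 T ⊆ S := by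
  refine hS.Icc_subset_of_forall_exists_gt h0 fun t ht y hy => ?_
  obtain ⟨d, hd, hdS⟩ := h t ht
  exact ⟨min d y, hdS ⟨(lt_min hd.1 hy).le, min_le_left _ _⟩, lt_min hd.1 hy, min_le_right _ _⟩

/-- `C` and `U` do not depend on the time or the control. The Lipschitz constant is thus an
integrable function of time for integrable controls, as Grönwall requires. -/
lemma exists_ctrlField_lipschitz {Ω : Set F} (hΩ : IsOpen Ω)
    {b : Fin J → ℝ → F → F} {b₀ : ℝ → F → F} (hb : ∀ j, IsC1On T Ω (b j)) (hb₀ : IsC1On T Ω b₀)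
    {z : F} (hz : z ∈ Ω) : ∃ C : ℝ, 0 ≤ C ∧ ∃ U ∈ 𝓝 z, U ⊆ Ω ∧
      ∀ c : ℝ → EuclideanSpace ℝ (Fin J), ∀ t ∈ Icc 0 T, ∀ y ∈ U, ∀ y' ∈ U,
        ‖ctrlField b b₀ c t y - ctrlField b b₀ c t y'‖ ≤ C * (∑ j, ‖c t j‖ + 1) * ‖y - y'‖ := by
  choose C δ hC hδ hδΩ h using fun j => (hb j).exists_lipschitz hΩ hz
  obtain ⟨C₀, δ₀, hC₀, hδ₀, hδΩ₀, h₀⟩ := hb₀.exists_lipschitz hΩ hz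
  refine ⟨∑ j, C j + C₀, add_nonneg (Finset.sum_nonneg fun j _ => hC j) hC₀,
    (⋂ j, Metric.ball z (δ j)) ∩ Metric.ball z δ₀, inter_mem
    (iInter_mem.2 fun j => Metric.ball_mem_nhds _ (hδ j)) (Metric.ball_mem_nhds _ hδ₀),
    inter_subset_right.trans hδΩ₀, fun c t ht y hy y' hy' => ?_⟩
  have hj (j : Fin J) : ‖c t j • b j t y - c t j • b j t y'‖ ≤
      ‖c t j‖ * ((∑ j, C j + C₀) * ‖y - y'‖) := by
    rw [← smul_sub, norm_smul]
    gcongr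
    refine (h j t ht y (mem_iInter.1 hy.1 j) y' (mem_iInter.1 hy'.1 j)).trans ?_
    gcongr
    have := Finset.single_le_sum (fun j _ => hC j) (Finset.mem_univ j)
    linarith
  have h0 : ‖b₀ t y - b₀ t y'‖ ≤ (∑ j, C j + C₀) * ‖y - y'‖ := by
    refine (h₀ t ht y hy.2 y' hy'.2).trans ?_
    gcongr
    have := Finset.sum_nonneg fun j (_ : j ∈ Finset.univ) => hC j
    linarith
  have heq : ctrlField b b₀ c t y - ctrlField b b₀ c t y' =
      ∑ j, (c t j • b j t y - c t j • b j t y') + (b₀ t y - b₀ t y') := by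
    rw [Finset.sum_sub_distrib, ctrlField, ctrlField]; abel
  rw [heq]
  refine (norm_add_le _ _).trans ((add_le_add ((norm_sum_le _ _).trans
    (Finset.sum_le_sum fun j _ => hj j)) h0).trans_eq ?_)
  rw [← Finset.sum_mul]; ring

lemma intervalIntegrable_lipschitz_const {a b : ℝ} {c : ℝ → EuclideanSpace ℝ (Fin J)}
    (hc : IntervalIntegrable c volume a b) (C : ℝ) :
    IntervalIntegrable (fun t => C * (∑ j, ‖c t j‖ + 1)) volume a b :=
  ((intervalIntegrable_finset_sum fun j => (intervalIntegrable_component hc j).norm).add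
    intervalIntegrable_const).const_mul C

lemma lipschitz_const_nonneg {C : ℝ} (hC : 0 ≤ C) (c : EuclideanSpace ℝ (Fin J)) :
    0 ≤ C * (∑ j, ‖c j‖ + 1) := by positivity

/-- Solutions of a controlled differential equation are determined by their initial value. -/
theorem eqOn_of_isPrimitiveOn_ctrlField [CompleteSpace F] {Ω : Set F} (hΩ : IsOpen Ω)
    {b : Fin J → ℝ → F → F} {b₀ : ℝ → F → F} (hb : ∀ j, IsC1On T Ω (b j)) (hb₀ : IsC1On T Ω b₀)
    {c : ℝ → EuclideanSpace ℝ (Fin J)} (hc : IntervalIntegrable c volume 0 T) {y y' : ℝ → F}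
    (hy : IsPrimitiveOn 0 T y (fun t => ctrlField b b₀ c t (y t)))
    (hy' : IsPrimitiveOn 0 T y' (fun t => ctrlField b b₀ c t (y' t)))
    (hyΩ : ∀ t ∈ Icc 0 T, y t ∈ Ω) (h0 : y 0 = y' 0) : EqOn y y' (Icc 0 T) := by
  refine forall_mem_Icc_of_continuation (S := {t | y t = y' t}) ?_ h0 fun t₀ ht₀ => ?_
  · have h := (hy.continuousOn.sub hy'.continuousOn).preimage_isClosed_of_isClosed isClosed_Icc
      (isClosed_singleton (x := (0 : F)))
    convert h using 1
    ext t
    simp [sub_eq_zero, and_comm]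
  have ht : t₀ ∈ Icc 0 T := ⟨ht₀.2.1, ht₀.2.2.le⟩
  obtain ⟨C, hC, U, hU, -, hlip⟩ := exists_ctrlField_lipschitz hΩ hb hb₀ (hyΩ t₀ ht)
  obtain ⟨d, hd, hdU⟩ := exists_forall_mem_of_continuousOn
    (hy.continuousOn.prodMk hy'.continuousOn) ht₀.2 (U := U ×ˢ U)
    (prod_mem_nhds hU (by rwa [← show y t₀ = y' t₀ from ht₀.1]))
  have hdT : d ∈ Icc 0 T := ⟨ht.1.trans hd.1.le, hd.2⟩
  refine ⟨d, hd, fun t htd => sub_eq_zero.1 (gronwall_norm_eq_zero hd.1.le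
    ((hy.sub hy').mono ht hdT) (sub_eq_zero.2 ht₀.1)
    (intervalIntegrable_lipschitz_const (intervalIntegrable_mono_Icc hc ht hdT) C)
    (fun t => lipschitz_const_nonneg hC _) (Eventually.of_forall fun s hs => ?_) t htd)⟩
  exact hlip c s ⟨ht.1.trans hs.1, hs.2.trans hd.2⟩ _ (hdU s hs).1 _ (hdU s hs).2

/-- Trajectories are tested on scalar functions; the coordinates in a basis assemble these tests
into a vector-valued equation. -/
lemma isPrimitiveOn_of_forall_clm [FiniteDimensional ℝ F] {a b : ℝ} {f g : ℝ → F}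
    (h : ∀ L : F →L[ℝ] ℝ, IsPrimitiveOn a b (fun t => L (f t)) (fun t => L (g t))) :
    IsPrimitiveOn a b f g := by
  have : CompleteSpace F := FiniteDimensional.complete ℝ F
  let B := Module.finBasis ℝ F
  have hg : IntervalIntegrable g volume a b := by
    have h1 : IntervalIntegrable (fun t => ∑ i, B.repr (g t) i • B i) volume a b := by
      refine intervalIntegrable_finset_sum fun i => ?_
      have := (h (LinearMap.toContinuousLinearMap (B.coord i))).1
      exact ⟨this.1.smul_const _, this.2.smul_const _⟩
    simpa only [B.sum_repr] using h1
  refine ⟨hg, fun t ht => ?_⟩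
  have hgt := intervalIntegrable_mono_Icc hg ⟨le_rfl, ht.1.trans ht.2⟩ ht
  refine B.ext_elem fun i => ?_
  have h2 := (h (LinearMap.toContinuousLinearMap (B.coord i))).2 t ht
  rw [ContinuousLinearMap.intervalIntegral_comp_comm _ hgt, ← map_add] at h2
  exact h2

end Continuation

/-! ### Invariance of the embedded manifold -/

section Invariance

variable {d : ℕ} {M : Type*} [TopologicalSpace M] [ChartedSpace (EuclideanSpace ℝ (Fin d)) M]
  {K : Set M} {J : ℕ} {T : ℝ}

lemma localRep_velocity (σ : Fin J → ∀ x : M, TangentSpace (𝓡 d) x)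
    (a : ℝ → ∀ x : M, TangentSpace (𝓡 d) x) (c : ℝ → EuclideanSpace ℝ (Fin J)) (t : ℝ) (x₀ : M)
    (y : EuclideanSpace ℝ (Fin d)) : localRep x₀ (velocity σ a c t) y =
      ∑ j, c t j • localRep x₀ (σ j) y + localRep x₀ (a t) y := by
  simp only [localRep, velocity, map_add, map_sum, map_smul]
  rfl

lemma Cover.ctrlField_extField (D : Cover d K) (σ : Fin J → ∀ x : M, TangentSpace (𝓡 d) x)
    (a : ℝ → ∀ x : M, TangentSpace (𝓡 d) x) (c : ℝ → EuclideanSpace ℝ (Fin J)) (t : ℝ)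
    (y : D.Space) :
    ctrlField (fun j _ => D.extField (σ j)) (fun t => D.extField (a t)) c t y =
      D.extField (velocity σ a c t) y := by
  simp only [ctrlField, Cover.extField, localRep_velocity, map_add, map_sum, map_smul, smul_add,
    Finset.sum_add_distrib, Finset.smul_sum]
  rw [Finset.sum_comm]
  congr 1
  exact Finset.sum_congr rfl fun _ _ => Finset.sum_congr rfl fun _ _ => smul_comm _ _ _

variable [IsManifold (𝓡 d) ∞ M] [T2Space M]

/-- The distance of a solution to the embedded manifold satisfies a linear differential inequality;
here the distance is measured along the fibres of the projection given by one of the charts. -/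
lemma Cover.exists_norm_sub_retract_le (D : Cover d K) {σ : Fin J → ∀ x : M, TangentSpace (𝓡 d) x}
    (hσ : ∀ j, IsC1Field (σ j)) {a : ℝ → ∀ x : M, TangentSpace (𝓡 d) x} (ha : IsC1TimeField T a)
    {x₀ : M} (hx₀ : D.emb x₀ ∈ D.dom) : ∃ i : D.s, D.retr i (D.emb x₀) = x₀ ∧
      ∃ C : ℝ, 0 ≤ C ∧ ∃ U ∈ 𝓝 (D.emb x₀), U ⊆ D.dom ∧ ∀ c : ℝ → EuclideanSpace ℝ (Fin J),
        ∀ t ∈ Icc 0 T, ∀ y ∈ U,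
          ‖D.extField (velocity σ a c t) y - fderiv ℝ (fun y => D.emb (D.retr i y)) y
            (D.extField (velocity σ a c t) y)‖ ≤
          C * (∑ j, ‖c t j‖ + 1) * ‖y - D.emb (D.retr i y)‖ := by
  obtain ⟨i, hi⟩ := D.exists_weight_ne_zero hx₀
  have hi := D.mem_tsupport_of_weight hi
  refine ⟨i, D.retr_emb hi, ?_⟩
  obtain ⟨C, hC, U, hU, hUΩ, hlip⟩ := exists_ctrlField_lipschitz D.isOpen_dom
    (fun j => D.isC1On_extField ((hσ j).isC1TimeField T)) (D.isC1On_extField ha) hx₀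
  simp only [D.ctrlField_extField] at hlip
  let h : EuclideanSpace ℝ (Fin d) → D.Space := fun z => D.emb ((extChartAt (𝓡 d) (i : M)).symm z)
  let P : D.Space → D.Space := fun y => D.emb (D.retr i y)
  have hretr := (D.contMDiffAt_retr (n := 0) i hx₀).continuousAt
  have hPc : ContinuousAt P (D.emb x₀) := ContinuousAt.comp (D.continuous_emb.continuousAt) hretr
  have hP0 : P (D.emb x₀) = D.emb x₀ := by simp only [P, D.retr_emb hi]
  have hhc : ContinuousAt (fun y : D.Space => ‖fderiv ℝ h (y i).1‖) (D.emb x₀) := by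
    have h1 := ((D.contDiffAt_emb_chart (n := 2) (D.fst_mem_target hx₀ i)).fderiv_right (m := 1)
      (by norm_num)).continuousAt
    exact (ContinuousAt.comp (f := fun y : D.Space => (y i).1) h1
      (continuous_fst.comp (continuous_apply i)).continuousAt).norm
  -- Near `x₀` the cutoff of chart `i` is one, so the component of the embedding with index `i` is
  -- the chart.
  have hV : ∀ᶠ y in 𝓝 (D.emb x₀), ∀ᶠ x in 𝓝 (D.retr i y),
      (D.emb x i).1 = extChartAt (𝓡 d) (i : M) x := by
    refine hretr.eventually (p := fun z => ∀ᶠ x in 𝓝 z, (D.emb x i).1 = extChartAt (𝓡 d) (i : M) x) ?_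
    rw [D.retr_emb hi]
    exact (D.emb_fst_eventuallyEq hi).eventually_nhds
  have hbd := hhc.eventually_lt (continuousAt_const (y := ‖fderiv ℝ h (D.emb x₀ i).1‖ + 1))
    (lt_add_one _)
  set C' := ‖fderiv ℝ h (D.emb x₀ i).1‖ + 1 with hC'
  refine ⟨(1 + C') * C, by positivity,
    U ∩ P ⁻¹' U ∩ {y | ∀ᶠ x in 𝓝 (D.retr i y), (D.emb x i).1 = extChartAt (𝓡 d) (i : M) x} ∩
      {y | ‖fderiv ℝ h (y i).1‖ < C'},
    inter_mem (inter_mem (inter_mem hU (hPc (by rwa [hP0]))) hV) hbd,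
    fun y hy => hUΩ hy.1.1.1, fun c t ht y hy => ?_⟩
  obtain ⟨⟨⟨hyU, hPU⟩, hyV⟩, hyb⟩ := hy
  have hyt := D.fst_mem_target (hUΩ hyU) i
  set X := D.extField (velocity σ a c t) with hX
  have hfd (v : D.Space) : fderiv ℝ (fun y => D.emb (D.retr i y)) y v = fderiv ℝ h (y i).1 (v i).1 := by
    let L : D.Space →L[ℝ] EuclideanSpace ℝ (Fin d) :=
      (ContinuousLinearMap.fst ℝ _ _).comp (ContinuousLinearMap.proj i)
    have h1 : HasFDerivAt h (fderiv ℝ h (y i).1) (L y) :=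
      ((D.contDiffAt_emb_chart (n := 1) hyt).differentiableAt one_ne_zero).hasFDerivAt
    exact DFunLike.congr_fun (h1.comp y L.hasFDerivAt).fderiv v
  have hsrc : D.retr i y ∈ (extChartAt (𝓡 d) (i : M)).source := (extChartAt (𝓡 d) (i : M)).map_target hyt
  have hchart : extChartAt (𝓡 d) (i : M) (D.retr i y) = (y i).1 :=
    (extChartAt (𝓡 d) (i : M)).right_inv hyt
  -- At `P y` the extended field is tangent to the image of `M`, hence reproduced by the
  -- differential of the projection. That differential is the same at `y` and at `P y`, which have
  -- equal coordinates in chart `i`. Subtracting this identity leaves only the difference of `X` at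
  -- `y` and `P y`, which the Lipschitz bound controls.
  have hXP : X (P y) = fderiv ℝ h (y i).1 (X (P y) i).1 := by
    have h1 : X (P y) = mdiff D.emb (D.retr i y) (velocity σ a c t (D.retr i y)) :=
      D.extField_emb _ (hUΩ hPU)
    rw [h1, D.mdiff_emb_fst hyV, ← hchart]
    exact (D.fderiv_emb_chart hsrc _).symm
  have key : X y - fderiv ℝ h (y i).1 (X y i).1 =
      (X y - X (P y)) - fderiv ℝ h (y i).1 ((X y - X (P y)) i).1 := by
    have : ((X y - X (P y)) i).1 = (X y i).1 - (X (P y) i).1 := rfl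
    rw [this, map_sub, ← hXP]; abel
  rw [hfd, key]
  have h1 := hlip c t ht y hyU (P y) hPU
  have h2 : ‖((X y - X (P y)) i).1‖ ≤ ‖X y - X (P y)‖ := (norm_fst_le _).trans (norm_le_pi_norm _ i)
  calc _ ≤ ‖X y - X (P y)‖ + C' * ‖X y - X (P y)‖ := by
        refine (norm_sub_le _ _).trans ?_
        gcongr
        refine ((fderiv ℝ h (y i).1).le_opNorm _).trans ?_
        have hyb' : ‖fderiv ℝ h (y i).1‖ ≤ C' := le_of_lt hyb
        gcongr
    _ = (1 + C') * ‖X y - X (P y)‖ := by ring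
    _ ≤ (1 + C') * (C * (∑ j, ‖c t j‖ + 1) * ‖y - P y‖) := by gcongr
    _ = _ := by ring

/-- The embedded manifold is invariant under the extended controlled equation. -/
theorem Cover.exists_emb_eq (D : Cover d K) {σ : Fin J → ∀ x : M, TangentSpace (𝓡 d) x}
    (hσ : ∀ j, IsC1Field (σ j)) {a : ℝ → ∀ x : M, TangentSpace (𝓡 d) x} (ha : IsC1TimeField T a)
    {c : ℝ → EuclideanSpace ℝ (Fin J)} (hc : IntervalIntegrable c volume 0 T) {y : ℝ → D.Space}
    (hy : IsPrimitiveOn 0 T y (fun t => D.extField (velocity σ a c t) (y t)))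
    (hyΩ : ∀ t ∈ Icc 0 T, y t ∈ D.dom) {x : M} (h0 : y 0 = D.emb x) :
    ∀ t ∈ Icc 0 T, ∃ x, D.emb x = y t := by
  obtain ⟨K', hK', hsub⟩ := D.isCompact_preimage_dom
  rcases lt_or_ge T 0 with hT | hT
  · simp [Icc_eq_empty_of_lt hT]
  have hmem : ∀ t ∈ Icc 0 T, (∃ x, D.emb x = y t) → y t ∈ D.emb '' K' := by
    rintro t ht ⟨x, hx⟩
    exact ⟨x, hsub (by rw [mem_preimage, hx]; exact hyΩ t ht), hx⟩
  -- With the compact set `K'` in place of `M` the set of good times is closed.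
  suffices h : Icc 0 T ⊆ {t | y t ∈ D.emb '' K'} from fun t ht => by
    obtain ⟨x, -, hx⟩ := h ht
    exact ⟨x, hx⟩
  refine forall_mem_Icc_of_continuation ?_ (hmem 0 ⟨le_rfl, hT⟩ ⟨x, h0.symm⟩) fun t₀ ht₀ => ?_
  · rw [inter_comm]
    exact hy.continuousOn.preimage_isClosed_of_isClosed isClosed_Icc
      (hK'.image D.continuous_emb).isClosed
  have ht : t₀ ∈ Icc 0 T := ⟨ht₀.2.1, ht₀.2.2.le⟩
  obtain ⟨x₀, -, hx₀⟩ := ht₀.1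
  obtain ⟨i, hi, C, hC, U, hU, hUΩ, hle⟩ := D.exists_norm_sub_retract_le hσ ha (x₀ := x₀)
    (by rw [hx₀]; exact hyΩ t₀ ht)
  rw [hx₀] at hU hi
  obtain ⟨d', hd, hdU⟩ := exists_forall_mem_of_continuousOn hy.continuousOn ht₀.2 hU
  have hdT : d' ∈ Icc 0 T := ⟨ht.1.trans hd.1.le, hd.2⟩
  have hy' := hy.mono ht hdT
  -- The distance `y - D.emb (D.retr i y)` is zero at `t₀` and satisfies a linear differential
  -- inequality, so it stays zero.
  have hP := hy'.comp hd.1.le (H := fun y => D.emb (D.retr i y)) fun t ht =>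
    D.contDiffAt_emb_chart (n := 1) (D.fst_mem_target (hUΩ (hdU t ht)) i) |>.comp
      (f := fun y : D.Space => (y i).1) (y t) (by fun_prop)
  refine ⟨d', hd, fun t htd => hmem t ⟨ht.1.trans htd.1, htd.2.trans hd.2⟩ ⟨D.retr i (y t), ?_⟩⟩
  refine (sub_eq_zero.1 (gronwall_norm_eq_zero hd.1.le (hy'.sub hP) ?_
    (intervalIntegrable_lipschitz_const (intervalIntegrable_mono_Icc hc ht hdT) C)
    (fun t => lipschitz_const_nonneg hC _) (Eventually.of_forall fun s hs => ?_) t htd)).symm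
  · rw [hi, hx₀, sub_self]
  · exact hle c s ⟨ht.1.trans hs.1, hs.2.trans hd.2⟩ _ (hdU s hs)

end Invariance

/-! ### Trajectories on the manifold and in the embedding -/

section Trajectory

variable {d n J : ℕ} {M : Type*} [TopologicalSpace M] [ChartedSpace (EuclideanSpace ℝ (Fin d)) M]
  {K : Set M} {T : ℝ} {σ : Fin J → ∀ x : M, TangentSpace (𝓡 d) x}
  {a : ℝ → ∀ x : M, TangentSpace (𝓡 d) x} {o : Config M n} {c c' : ℝ → EuclideanSpace ℝ (Fin J)}
  {γ η : ℝ → Config M n}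

/-- A weight that is nonzero at `y` remains nonzero nearby, so one fixed chart recovers `g` from its
embedding. Continuity and differentiability are carried back to `M` in this way. -/
lemma Cover.eventually_retr_emb (D : Cover d K) {X : Type*} {l : Filter X} {g : X → M} {y : D.Space}
    (hg : Tendsto (fun v => D.emb (g v)) l (𝓝 y)) (hy : y ∈ D.dom) :
    ∃ i, ∀ᶠ v in l, D.retr i (D.emb (g v)) = g v := by
  obtain ⟨i, hi⟩ := D.exists_weight_ne_zero hy
  have h1 : ContinuousAt (D.weight i) y :=
    (D.contDiffOn_weight (n := 0) i).continuousOn.continuousAt (D.isOpen_dom.mem_nhds hy)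
  refine ⟨i, ?_⟩
  filter_upwards [(h1.tendsto.comp hg).eventually_ne hi] with v hv
  exact D.retr_emb (D.mem_tsupport_of_weight hv)

lemma continuousOn_config_iff {s : Set ℝ} :
    ContinuousOn γ s ↔ ∀ r, ContinuousOn (fun t => (γ t).1 r) s := by
  refine (Topology.IsInducing.subtypeVal.continuousOn_iff (g := Subtype.val)).trans ?_
  rw [continuousOn_pi]
  rfl

/-- Equality almost everywhere of controls implies equality of the trajectories. -/
lemma IsTrajectory.congr_control (hT : 0 ≤ T) (h : IsTrajectory σ a T o c γ)
    (hc : ∀ᵐ t, t ∈ Icc 0 T → c' t = c t) : IsTrajectory σ a T o c' γ := by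
  refine ⟨h.1, h.2.1, fun r f hf => IsPrimitiveOn.congr (h.2.2 r f hf) hT (fun _ _ => rfl) ?_⟩
  filter_upwards [hc] with t ht htT
  have : velocity σ a c' t = velocity σ a c t := by unfold velocity; rw [ht htT]
  simp only [this]
  rfl

variable [IsManifold (𝓡 d) ∞ M] [T2Space M]

omit [T2Space M] in
lemma Cover.continuousOn_of_emb (D : Cover d K) {X : Type*} [TopologicalSpace X] {g : X → M}
    {s : Set X} (hg : ContinuousOn (fun v => D.emb (g v)) s) (hdom : ∀ x ∈ s, D.emb (g x) ∈ D.dom) :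
    ContinuousOn g s := by
  intro x hx
  obtain ⟨i, hi⟩ := D.eventually_retr_emb (hg x hx) (hdom x hx)
  have h1 := ((D.contMDiffAt_retr (n := 0) i (hdom x hx)).continuousAt).comp_continuousWithinAt
    (f := fun v => D.emb (g v)) (hg x hx)
  exact h1.congr_of_eventuallyEq (hi.mono fun v hv => hv.symm)
    (hi.self_of_nhdsWithin hx).symm

/-- A function into `M` that is differentiable in the embedding is differentiable. -/
lemma Cover.mdiff_emb_mfderiv (D : Cover d K) {U : Type*} [NormedAddCommGroup U] [NormedSpace ℝ U]
    {g : U → M} {Φ : U → D.Space} {Φ' : U →L[ℝ] D.Space} {u : U} (hΦ : HasFDerivAt Φ Φ' u)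
    (hg : ∀ᶠ v in 𝓝 u, D.emb (g v) = Φ v) (hdom : D.emb (g u) ∈ D.dom) (k : U) :
    mdiff D.emb (g u) (mfderiv 𝓘(ℝ, U) (𝓡 d) g u k) = Φ' k := by
  have hgu := hg.self_of_nhds
  have htend : Tendsto (fun v => D.emb (g v)) (𝓝 u) (𝓝 (Φ u)) :=
    hΦ.continuousAt.tendsto.congr' (hg.mono fun v hv => hv.symm)
  rw [hgu] at hdom
  obtain ⟨i, hi⟩ := D.eventually_retr_emb htend hdom
  have hgd : MDifferentiableAt 𝓘(ℝ, U) (𝓡 d) g u := by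
    have h1 := ((D.contMDiffAt_retr (n := 1) i hdom).mdifferentiableAt one_ne_zero).comp u
      hΦ.differentiableAt.mdifferentiableAt
    refine h1.congr_of_eventuallyEq ?_
    filter_upwards [hi, hg] with v h1 h2
    rw [Function.comp_apply, ← h2, h1]
  have h2 := mfderiv_comp_apply u (D.mdifferentiableAt_emb (g u)) hgd k
  have h3 : (D.emb ∘ g) =ᶠ[𝓝 u] Φ := hg
  rw [h3.mfderiv_eq, mfderiv_eq_fderiv, hΦ.fderiv] at h2
  exact h2.symm

/-- The defining tests are used for the smooth functions `L ∘ D.emb` with `L` a linear functional.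
-/
lemma IsTrajectory.isPrimitiveOn_emb (hT : 0 ≤ T) (h : IsTrajectory σ a T o c γ) (D : Cover d K)
    (hD : ∀ t ∈ Icc 0 T, ∀ r, D.emb ((γ t).1 r) ∈ D.dom) (r : Fin n) :
    IsPrimitiveOn 0 T (fun t => D.emb ((γ t).1 r))
      (fun t => D.extField (velocity σ a c t) (D.emb ((γ t).1 r))) := by
  refine isPrimitiveOn_of_forall_clm fun L => ?_
  refine IsPrimitiveOn.congr (h.2.2 r (fun x => L (D.emb x))
    (L.contDiff.contMDiff.comp D.contMDiff_emb)) hT (fun _ _ => rfl) (Eventually.of_forall fun t ht => ?_)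
  rw [D.extField_emb _ (hD t ht r)]
  have := mdiff_comp L.differentiableAt (D.mdifferentiableAt_emb ((γ t).1 r))
    (velocity σ a c t ((γ t).1 r))
  rw [L.fderiv] at this
  exact this.symm

/-- Any smooth test function extends to `D.dom` by `D.extFun`, and the chain rule in the ambient
space gives its derivative along the curve. -/
lemma isTrajectory_of_isPrimitiveOn_emb (hT : 0 ≤ T) (D : Cover d K) (h0 : γ 0 = o)
    (hD : ∀ t ∈ Icc 0 T, ∀ r, D.emb ((γ t).1 r) ∈ D.dom)
    (h : ∀ r, IsPrimitiveOn 0 T (fun t => D.emb ((γ t).1 r))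
      (fun t => D.extField (velocity σ a c t) (D.emb ((γ t).1 r)))) :
    IsTrajectory σ a T o c γ := by
  refine ⟨h0, continuousOn_config_iff.2 fun r =>
    D.continuousOn_of_emb (h r).continuousOn fun t ht => hD t ht r, fun r g hg => ?_⟩
  have hg1 : ContMDiff (𝓡 d) 𝓘(ℝ, ℝ) 1 g := hg.of_le (by simp)
  have h1 := (h r).comp hT (H := D.extFun g) fun t ht =>
    (D.contDiffOn_extFun (n := 1) hg1).contDiffAt (D.isOpen_dom.mem_nhds (hD t ht r))
  refine h1.congr hT (fun t ht => (D.extFun_emb g (hD t ht r)).symm)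
    (Eventually.of_forall fun t ht => ?_)
  rw [D.extField_emb _ (hD t ht r)]
  exact D.mdiff_eq_fderiv_extFun hg1 (hD t ht r) _

omit [IsManifold (𝓡 d) ∞ M] [T2Space M] in
lemma IsTrajectory.isCompact_range (h : IsTrajectory σ a T o c γ) :
    IsCompact (⋃ r, (fun t => (γ t).1 r) '' Icc 0 T) :=
  isCompact_iUnion fun r => isCompact_Icc.image_of_continuousOn (continuousOn_config_iff.1 h.2.1 r)

/-- Trajectories are unique. -/
theorem IsTrajectory.eqOn [SecondCountableTopology M] (hT : 0 ≤ T) (hσ : ∀ j, IsC1Field (σ j))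
    (ha : IsC1TimeField T a) (hc : IntervalIntegrable c volume 0 T)
    (h : IsTrajectory σ a T o c γ) (h' : IsTrajectory σ a T o c η) : EqOn γ η (Icc 0 T) := by
  -- One cover serves both curves, so that both solve the same ambient equation.
  obtain ⟨D⟩ := exists_cover (d := d) (h.isCompact_range.union h'.isCompact_range)
  have hD : ∀ t ∈ Icc 0 T, ∀ r, D.emb ((γ t).1 r) ∈ D.dom := fun t ht r =>
    D.emb_mem_dom (Or.inl (mem_iUnion.2 ⟨r, t, ht, rfl⟩))
  have hD' : ∀ t ∈ Icc 0 T, ∀ r, D.emb ((η t).1 r) ∈ D.dom := fun t ht r =>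
    D.emb_mem_dom (Or.inr (mem_iUnion.2 ⟨r, t, ht, rfl⟩))
  intro t ht
  refine Subtype.ext (funext fun r => D.injOn_emb (hD t ht r) (hD' t ht r) ?_)
  have hy := h.isPrimitiveOn_emb hT D hD r
  have hy' := h'.isPrimitiveOn_emb hT D hD' r
  simp only [← D.ctrlField_extField] at hy hy'
  exact eqOn_of_isPrimitiveOn_ctrlField D.isOpen_dom
    (fun j => D.isC1On_extField ((hσ j).isC1TimeField T)) (D.isC1On_extField ha) hc hy hy'
    (fun t ht => hD t ht r) (by rw [h.1, h'.1]) ht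

/-- The trajectories of controls near `u` in the embedding, as differentiable functions of the
control. -/
theorem IsTrajectory.exists_flow (hT : 0 ≤ T) (hσ : ∀ j, IsC1Field (σ j)) (ha : IsC1TimeField T a)
    {u : Control J T} (h : IsTrajectory σ a T o u γ) (D : Cover d K)
    (hD : ∀ t ∈ Icc 0 T, ∀ r, D.emb ((γ t).1 r) ∈ D.dom) :
    ∃ (Ψ : Fin n → Control J T → C(Icc 0 T, D.Space))
      (Ψ' : Fin n → Control J T →L[ℝ] C(Icc 0 T, D.Space)),
      (∀ r, HasStrictFDerivAt (Ψ r) (Ψ' r) u) ∧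
      (∀ᶠ v : Control J T in 𝓝 u, ∃ η : ℝ → Config M n, IsTrajectory σ a T o v η ∧
        ∀ (t : Icc 0 T) r, D.emb ((η t).1 r) = Ψ r v t ∧ Ψ r v t ∈ D.dom) ∧
      ∀ r k, IsPrimitiveOn 0 T (IccExtend hT (Ψ' r k)) (fun t =>
        ctrlFieldDeriv (fun j _ => D.extField (σ j)) (fun t => D.extField (a t)) u t
          (D.emb ((γ t).1 r)) (IccExtend hT (Ψ' r k) t) +
        ∑ j, k t j • D.extField (σ j) (D.emb ((γ t).1 r))) ∧ IccExtend hT (Ψ' r k) 0 = 0 := by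
  have hb (j : Fin J) := D.isC1On_extField ((hσ j).isC1TimeField T)
  have hb₀ := D.isC1On_extField ha
  have hy (r : Fin n) := h.isPrimitiveOn_emb hT D hD r
  simp only [← D.ctrlField_extField] at hy
  choose Ψ Ψ' hΨ hΨu hev hΨ' using fun r =>
    Landmark.exists_flow hT D.isOpen_dom hb hb₀ u (hy r) (fun t ht => hD t ht r)
  refine ⟨Ψ, Ψ', hΨ, ?_, fun r k => hΨ' r k⟩
  -- Distinct landmarks stay distinct for nearby controls: a path avoiding zero on the compact time
  -- interval still does so after a small perturbation.
  have hinj : ∀ r s, r ≠ s → ∀ᶠ v in 𝓝 u, MapsTo (Ψ r v - Ψ s v) univ {0}ᶜ := fun r s hrs => by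
    have h1 : ContinuousAt (fun v => Ψ r v - Ψ s v) u :=
      (hΨ r).continuousAt.sub (hΨ s).continuousAt
    refine h1.eventually (ContinuousMap.eventually_mapsTo isCompact_univ isOpen_compl_singleton
      fun t _ => ?_)
    rw [mem_compl_singleton_iff, ContinuousMap.sub_apply, hΨu, hΨu, sub_ne_zero]
    exact fun he => hrs ((γ t).2 (D.injOn_emb (hD t t.2 r) (hD t t.2 s) he))
  have hinj' : ∀ᶠ v in 𝓝 u, ∀ r s, r ≠ s → MapsTo (Ψ r v - Ψ s v) univ {0}ᶜ :=
    eventually_all.2 fun r => eventually_all.2 fun s => eventually_imp_distrib_left.2 (hinj r s)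
  filter_upwards [eventually_all.2 hev, hinj'] with v hv hvi
  have h0T : (0 : ℝ) ∈ Icc 0 T := ⟨le_rfl, hT⟩
  have hv2 (r : Fin n) := (hv r).2.1
  simp only [D.ctrlField_extField] at hv2
  -- A configuration is needed at every real time; outside `[0, T]` the path is extended by its
  -- endpoint values.
  have hext (r : Fin n) (t : ℝ) : ∃ x, D.emb x = IccExtend hT (Ψ r v) t := by
    have h1 := D.exists_emb_eq hσ ha (Control.intervalIntegrable hT v) (hv2 r)
      (fun t ht => by rw [IccExtend_of_mem hT _ ht]; exact (hv r).1 _) (hv r).2.2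
    have h2 := h1 (projIcc 0 T hT t) (projIcc 0 T hT t).2
    rwa [IccExtend_val] at h2
  choose x hx using hext
  have hxdom (r : Fin n) (t : ℝ) : D.emb (x r t) ∈ D.dom := by rw [hx]; exact (hv r).1 _
  let η : ℝ → Config M n := fun t => ⟨fun r => x r t, fun r s hrs => by
    by_contra hne
    refine hvi r s hne (mem_univ (projIcc 0 T hT t)) ?_
    have h1 : IccExtend hT (Ψ r v) t = IccExtend hT (Ψ s v) t := by rw [← hx, ← hx]; exact congrArg _ hrs
    exact sub_eq_zero.2 h1⟩
  have hη (r : Fin n) (t : ℝ) : D.emb ((η t).1 r) = IccExtend hT (Ψ r v) t := hx r t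
  refine ⟨η, isTrajectory_of_isPrimitiveOn_emb hT D ?_ (fun t _ r => hxdom r t) fun r => ?_,
    fun t r => ⟨?_, (hv r).1 t⟩⟩
  · refine Subtype.ext (funext fun r => D.injOn_emb (hxdom r 0) ?_ ?_)
    · rw [← h.1]; exact hD 0 h0T r
    · rw [hη, (hv r).2.2, h.1]
  · simp only [hη]; exact hv2 r
  · rw [hη, IccExtend_val]

end Trajectory

/-! ### The Lie bracket in the ambient space -/

section Bracket

variable {d : ℕ} {M : Type*} [TopologicalSpace M] [ChartedSpace (EuclideanSpace ℝ (Fin d)) M]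
  [IsManifold (𝓡 d) ∞ M]

/-- The Lie bracket in the chart around the point. -/
lemma mdiff_extChartAt_mlieBracket (V W : ∀ x : M, TangentSpace (𝓡 d) x) (x : M) :
    mdiff (extChartAt (𝓡 d) x) x (VectorField.mlieBracket (𝓡 d) V W x) =
      VectorField.lieBracket ℝ (localRep x V) (localRep x W) (extChartAt (𝓡 d) x x) := by
  have hrep (V : ∀ x : M, TangentSpace (𝓡 d) x) :
      (VectorField.mpullbackWithin 𝓘(ℝ, EuclideanSpace ℝ (Fin d)) (𝓡 d) (extChartAt (𝓡 d) x).symm V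
        (range (𝓡 d)) : EuclideanSpace ℝ (Fin d) → EuclideanSpace ℝ (Fin d)) =ᶠ[𝓝 (extChartAt (𝓡 d) x x)]
        localRep x V := by
    filter_upwards [(isOpen_extChartAt_target (I := 𝓡 d) x).mem_nhds (mem_extChartAt_target x)]
      with z hz
    rw [VectorField.mpullbackWithin_apply, localRep]
    rw [ContinuousLinearMap.inverse_eq
      (mfderivWithin_extChartAt_symm_comp_mfderiv_extChartAt hz)
      (mfderiv_extChartAt_comp_mfderivWithin_extChartAt_symm hz)]
    rfl
  rw [← VectorField.mlieBracketWithin_univ, VectorField.mlieBracketWithin_apply]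
  have h1 : (mdiff (extChartAt (𝓡 d) x) x :
      TangentSpace (𝓡 d) x →L[ℝ] EuclideanSpace ℝ (Fin d)).IsInvertible :=
    isInvertible_mfderiv_extChartAt (mem_extChartAt_source x)
  have h2 := (hrep V).lieBracket_vectorField_eq (𝕜 := ℝ) (hrep W)
  have h3 (v : EuclideanSpace ℝ (Fin d)) : mdiff (extChartAt (𝓡 d) x) x
      ((mdiff (extChartAt (𝓡 d) x) x : TangentSpace (𝓡 d) x →L[ℝ] EuclideanSpace ℝ (Fin d)).inverse v) = v :=
    DFunLike.congr_fun h1.self_comp_inverse v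
  have hu : (extChartAt (𝓡 d) x).symm ⁻¹' univ ∩ range (𝓡 d) = univ := by simp
  rw [← h2, hu]
  exact (h3 _).trans (congrFun VectorField.lieBracketWithin_univ _)

variable [T2Space M] {K : Set M}

/-- The Lie bracket in terms of the extensions of the fields. -/
lemma Cover.mdiff_emb_mlieBracket (D : Cover d K) {V W : ∀ x : M, TangentSpace (𝓡 d) x} {x : M}
    (hx : D.emb x ∈ D.dom)
    (hV : DifferentiableAt ℝ (localRep x V) (extChartAt (𝓡 d) x x))
    (hW : DifferentiableAt ℝ (localRep x W) (extChartAt (𝓡 d) x x))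
    (hV' : DifferentiableAt ℝ (D.extField V) (D.emb x))
    (hW' : DifferentiableAt ℝ (D.extField W) (D.emb x)) :
    mdiff D.emb x (VectorField.mlieBracket (𝓡 d) V W x) =
      fderiv ℝ (D.extField W) (D.emb x) (D.extField V (D.emb x)) -
        fderiv ℝ (D.extField V) (D.emb x) (D.extField W (D.emb x)) := by
  let h : EuclideanSpace ℝ (Fin d) → D.Space := fun z => D.emb ((extChartAt (𝓡 d) x).symm z)
  set z := extChartAt (𝓡 d) x x with hz
  have hzt : z ∈ (extChartAt (𝓡 d) x).target := mem_extChartAt_target x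
  have hsymm : (extChartAt (𝓡 d) x).symm z = x := extChartAt_to_inv x
  have hhz : h z = D.emb x := by simp only [h, hsymm]
  have hh : ContDiffAt ℝ 2 h z := D.contDiffAt_emb_chart hzt
  have hhd : DifferentiableAt ℝ h z := hh.differentiableAt (by norm_num)
  -- The chart components of a field and its extension are related by `h`. Related fields have
  -- related brackets, since the second derivative of `h` is symmetric and drops out; no smoothness
  -- beyond differentiability of the fields is used.
  have hrel (U : ∀ x : M, TangentSpace (𝓡 d) x) :
      (fun z => fderiv ℝ h z (localRep x U z)) =ᶠ[𝓝 z] fun z => D.extField U (h z) := by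
    have hdom : h ⁻¹' D.dom ∈ 𝓝 z :=
      hhd.continuousAt (D.isOpen_dom.mem_nhds (by rw [hhz]; exact hx))
    filter_upwards [(isOpen_extChartAt_target (I := 𝓡 d) x).mem_nhds hzt, hdom] with w hw hwd
    rw [show D.extField U (h w) = mdiff D.emb _ _ from D.extField_emb U hwd,
      ← D.fderiv_emb_chart ((extChartAt (𝓡 d) x).map_target hw),
      mdiff_extChartAt_eq_localRep U ((extChartAt (𝓡 d) x).map_target hw),
      (extChartAt (𝓡 d) x).right_inv hw]
  have hderiv {U U' : ∀ x : M, TangentSpace (𝓡 d) x} (hU : DifferentiableAt ℝ (D.extField U) (D.emb x)) :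
      fderiv ℝ (fun z => fderiv ℝ h z (localRep x U z)) z (localRep x U' z) =
        fderiv ℝ (D.extField U) (D.emb x) (D.extField U' (D.emb x)) := by
    rw [(hrel U).fderiv_eq]
    have h1 := fderiv_comp z (g := D.extField U) (f := h) (by rwa [hhz]) hhd
    have h2 := (hrel U').eq_of_nhds
    simp only [hhz] at h1 h2
    rw [← h2]
    exact DFunLike.congr_fun h1 _
  rw [← D.fderiv_emb_chart (mem_extChartAt_source x), mdiff_extChartAt_mlieBracket]
  refine (VectorField.fderiv_apply_lieBracket hh (by simp) hW hV).trans ?_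
  rw [hderiv hW', hderiv hV']

end Bracket

lemma IsPrimitiveOn.sum {F ι : Type*} [NormedAddCommGroup F] [NormedSpace ℝ F] {a b : ℝ}
    {s : Finset ι} {f g : ι → ℝ → F} (h : ∀ i ∈ s, IsPrimitiveOn a b (f i) (g i)) :
    IsPrimitiveOn a b (fun t => ∑ i ∈ s, f i t) (fun t => ∑ i ∈ s, g i t) := by
  classical
  induction s using Finset.induction_on with
  | empty => exact ⟨by simp, fun t _ => by simp⟩
  | insert i s hi ih =>
    simp only [Finset.sum_insert hi]
    exact (h i (by simp)).add (ih fun j hj => h j (by simp [hj]))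

/-! ### The dual linear equation -/

section Dual

variable {F : Type*} [NormedAddCommGroup F] [NormedSpace ℝ F] {T : ℝ} {A : ℝ → F →L[ℝ] F}

lemma IsPrimitiveOn.exists_linear_of_clm {E G : Type*} [NormedAddCommGroup E] [NormedSpace ℝ E]
    [NormedAddCommGroup G] [NormedSpace ℝ G] [CompleteSpace G] (hT : 0 ≤ T) {A : ℝ → E}
    (hA : IntervalIntegrable A volume 0 T) (L : E →L[ℝ] G →L[ℝ] G) (x : G) :
    (∃ Λ : ℝ → G, IsPrimitiveOn 0 T Λ (fun t => -(L (A t) (Λ t))) ∧ Λ 0 = x) ∧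
    ∃ Λ : ℝ → G, IsPrimitiveOn 0 T Λ (fun t => -(L (A t) (Λ t))) ∧ Λ T = x := by
  have h : IntervalIntegrable (fun t => L (A t)) volume 0 T :=
    ⟨L.integrable_comp hA.1, L.integrable_comp hA.2⟩
  exact ⟨exists_isPrimitiveOn_linear hT h.neg x, exists_isPrimitiveOn_linear_terminal hT h.neg x⟩

lemma exists_isPrimitiveOn_dual (hT : 0 ≤ T) (hA : IntervalIntegrable A volume 0 T)
    (Λ₀ : F →L[ℝ] ℝ) :
    ∃ Λ : ℝ → F →L[ℝ] ℝ, IsPrimitiveOn 0 T Λ (fun t => -(Λ t ∘L A t)) ∧ Λ 0 = Λ₀ :=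
  (IsPrimitiveOn.exists_linear_of_clm hT hA (ContinuousLinearMap.compL ℝ F F ℝ).flip Λ₀).1

lemma exists_isPrimitiveOn_dual_terminal (hT : 0 ≤ T) (hA : IntervalIntegrable A volume 0 T)
    (Λ₁ : F →L[ℝ] ℝ) :
    ∃ Λ : ℝ → F →L[ℝ] ℝ, IsPrimitiveOn 0 T Λ (fun t => -(Λ t ∘L A t)) ∧ Λ T = Λ₁ :=
  (IsPrimitiveOn.exists_linear_of_clm hT hA (ContinuousLinearMap.compL ℝ F F ℝ).flip Λ₁).2

end Dual

/-! ### Global smooth fields spanning the tangent spaces over a compact set -/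

section Frame

variable {d : ℕ} {M : Type*} [TopologicalSpace M] [ChartedSpace (EuclideanSpace ℝ (Fin d)) M]
  {K : Set M}

/-- The coordinate functionals of the charts in the ambient space. -/
def Cover.coord (D : Cover d K) (p : D.s × Fin d) : D.Space →L[ℝ] ℝ :=
  (EuclideanSpace.proj p.2 : EuclideanSpace ℝ (Fin d) →L[ℝ] ℝ) ∘L
    ContinuousLinearMap.fst ℝ _ _ ∘L ContinuousLinearMap.proj p.1

/-- Globally defined fields that span the tangent spaces at the points of `K`. -/
def Cover.frame (D : Cover d K) (p : D.s × Fin d) (x : M) : TangentSpace (𝓡 d) x :=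
  D.ψ p.1 x • chartField (p.1 : M) (EuclideanSpace.single p.2 1) x

variable [IsManifold (𝓡 d) ∞ M]

lemma Cover.isSmoothField_frame (D : Cover d K) (p : D.s × Fin d) : IsSmoothField (D.frame p) :=
  isSmoothField_smul_chartField (D.contMDiff_ψ p.1) (fun _ hx => (D.tsupport_ψ p.1 hx).1) _

lemma chartField_mdiff_extChartAt {c x : M} (hx : x ∈ (extChartAt (𝓡 d) c).source)
    (v : TangentSpace (𝓡 d) x) : chartField c (mdiff (extChartAt (𝓡 d) c) x v) x = v :=
  injective_mdiff_extChartAt hx (mdiff_extChartAt_chartField hx _)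

omit [IsManifold (𝓡 d) ∞ M] in
lemma sum_smul_chartField_single (c x : M) (e : EuclideanSpace ℝ (Fin d)) :
    ∑ m, e m • chartField c (EuclideanSpace.single m 1) x = chartField c e x := by
  simp only [chartField]
  simp only [← map_smul, ← map_sum]
  congr 1
  ext i
  simp [Finset.sum_apply, Pi.single_apply]

/-- For each chart, expanding `v` in its coordinate fields gives `D.ψ c x • v`, and these add up to
`v`. A form is therefore determined by its values on finitely many admissible test fields. -/
lemma Cover.sum_coord_smul_frame [T2Space M] (D : Cover d K) {x : M} (hx : x ∈ K)
    (v : TangentSpace (𝓡 d) x) : ∑ p, D.coord p (mdiff D.emb x v) • D.frame p x = v := by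
  rw [Fintype.sum_prod_type]
  have h1 (c : D.s) : ∑ m, D.coord (c, m) (mdiff D.emb x v) • D.frame (c, m) x = D.ψ c x • v := by
    by_cases hc : D.ψ c x = 0
    · simp [frame, hc]
    have hs := subset_tsupport (D.ψ c) hc
    have h2 (m : Fin d) : D.coord (c, m) (mdiff D.emb x v) • D.frame (c, m) x = D.ψ c x •
        (mdiff (extChartAt (𝓡 d) (c : M)) x v m • chartField (c : M) (EuclideanSpace.single m 1) x) := by
      rw [← D.mdiff_emb_fst (D.emb_fst_eventuallyEq hs), smul_comm]
      rfl
    rw [Finset.sum_congr rfl fun m _ => h2 m, ← Finset.smul_sum, sum_smul_chartField_single,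
      chartField_mdiff_extChartAt (D.mem_chart_source_of_tsupport hs)]
  rw [Finset.sum_congr rfl fun c _ => h1 c, ← Finset.sum_smul, D.sum_eq_one x hx, one_smul]

end Frame

/-! ### Costates as restrictions of dual solutions -/

section Costate

variable {d n J : ℕ} {M : Type*} [TopologicalSpace M] [ChartedSpace (EuclideanSpace ℝ (Fin d)) M]
  [IsManifold (𝓡 d) ∞ M] [T2Space M]
  {K : Set M} {T : ℝ} {σ : Fin J → ∀ x : M, TangentSpace (𝓡 d) x}
  {a : ℝ → ∀ x : M, TangentSpace (𝓡 d) x} {o : Config M n} {c : ℝ → EuclideanSpace ℝ (Fin J)}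
  {γ : ℝ → Config M n}

lemma Cover.contDiffOn_extField (D : Cover d K) {V : ∀ x : M, TangentSpace (𝓡 d) x}
    (hV : IsC1Field V) : ContDiffOn ℝ 1 (D.extField V) D.dom := by
  refine ContDiffOn.sum fun c _ => (D.contDiffOn_weight (n := 1) c).smul fun y hy => ?_
  have hy' := D.fst_mem_target hy c
  have h1 : ContDiffAt ℝ 1 (fun y : D.Space => (y c).1) y := by fun_prop
  have h2 := ((D.contDiffAt_emb_chart (n := 2) hy').fderiv_right (m := 1) (by norm_num)).comp
    (f := fun y : D.Space => (y c).1) y h1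
  have h3 := ((contDiffOn_localRep (n := 1) hV (c : M)).contDiffAt
    ((isOpen_extChartAt_target (c : M)).mem_nhds hy')).comp (f := fun y : D.Space => (y c).1) y h1
  exact (h2.clm_apply h3).contDiffWithinAt

/-- The linearization of the controlled equation along the trajectory. -/
def Cover.linearization (D : Cover d K) (σ : Fin J → ∀ x : M, TangentSpace (𝓡 d) x)
    (a : ℝ → ∀ x : M, TangentSpace (𝓡 d) x) (c : ℝ → EuclideanSpace ℝ (Fin J))
    (γ : ℝ → Config M n) (r : Fin n) (t : ℝ) : D.Space →L[ℝ] D.Space :=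
  ctrlFieldDeriv (fun j _ => D.extField (σ j)) (fun t => D.extField (a t)) c t
    (D.emb ((γ t).1 r))

lemma Cover.hasFDerivAt_extField_velocity (D : Cover d K) (hσ : ∀ j, IsC1Field (σ j))
    (ha : IsC1TimeField T a) {t : ℝ} (ht : t ∈ Icc 0 T) {r : Fin n}
    (hD : D.emb ((γ t).1 r) ∈ D.dom) :
    HasFDerivAt (D.extField (velocity σ a c t)) (D.linearization σ a c γ r t)
      (D.emb ((γ t).1 r)) := by
  have := hasFDerivAt_ctrlField D.isOpen_dom
    (fun j => D.isC1On_extField ((hσ j).isC1TimeField T)) (D.isC1On_extField ha) c ht hD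
  refine this.congr_of_eventuallyEq (Eventually.of_forall fun y => ?_)
  exact (D.ctrlField_extField σ a c t y).symm

omit [T2Space M] in
lemma differentiableAt_localRep_velocity (hσ : ∀ j, IsC1Field (σ j)) (ha : IsC1TimeField T a) {t : ℝ}
    (ht : t ∈ Icc 0 T) (x : M) :
    DifferentiableAt ℝ (localRep x (velocity σ a c t)) (extChartAt (𝓡 d) x x) := by
  have hd {b : ℝ → ∀ x : M, TangentSpace (𝓡 d) x} (hb : IsC1TimeField T b) :
      DifferentiableAt ℝ (localRep x (b t)) (extChartAt (𝓡 d) x x) :=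
    ((hb x).2.1 t ht).differentiableAt
      ((isOpen_extChartAt_target (I := 𝓡 d) x).mem_nhds (mem_extChartAt_target x))
  have h : localRep x (velocity σ a c t) =
      fun y => ∑ j, c t j • localRep x (σ j) y + localRep x (a t) y :=
    funext fun y => localRep_velocity σ a c t x y
  rw [h]
  exact (DifferentiableAt.fun_sum fun j _ => (hd ((hσ j).isC1TimeField T)).const_smul (c t j)).add
    (hd ha)

omit [T2Space M] in
lemma IsSmoothField.isC1Field {W : ∀ x : M, TangentSpace (𝓡 d) x} (hW : IsSmoothField W) :
    IsC1Field W := ContMDiff.of_le hW (by simp)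

lemma Cover.mdiff_emb_mlieBracket_velocity (D : Cover d K) (hσ : ∀ j, IsC1Field (σ j))
    (ha : IsC1TimeField T a) {W : ∀ x : M, TangentSpace (𝓡 d) x} (hW : IsSmoothField W) {t : ℝ}
    (ht : t ∈ Icc 0 T) {r : Fin n} (hD : D.emb ((γ t).1 r) ∈ D.dom) :
    mdiff D.emb ((γ t).1 r) (VectorField.mlieBracket (𝓡 d) (velocity σ a c t) W ((γ t).1 r)) =
      fderiv ℝ (D.extField W) (D.emb ((γ t).1 r))
        (D.extField (velocity σ a c t) (D.emb ((γ t).1 r))) -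
      D.linearization σ a c γ r t (D.extField W (D.emb ((γ t).1 r))) := by
  have h := D.hasFDerivAt_extField_velocity (c := c) hσ ha ht hD
  have hW1 := hW.isC1Field
  rw [D.mdiff_emb_mlieBracket hD (differentiableAt_localRep_velocity hσ ha ht _) ?_
    h.differentiableAt ?_, h.fderiv]
  · exact ((hW1.isC1TimeField T _).2.1 t ht).differentiableAt
      ((isOpen_extChartAt_target (I := 𝓡 d) _).mem_nhds (mem_extChartAt_target _))
  · exact ((D.contDiffOn_extField hW1).contDiffAt (D.isOpen_dom.mem_nhds hD)).differentiableAt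
      one_ne_zero

lemma IsTrajectory.intervalIntegrable_linearization (hT : 0 ≤ T) (hσ : ∀ j, IsC1Field (σ j))
    (ha : IsC1TimeField T a) (hc : IntervalIntegrable c volume 0 T)
    (hγ : IsTrajectory σ a T o c γ) (D : Cover d K)
    (hD : ∀ t ∈ Icc 0 T, ∀ r, D.emb ((γ t).1 r) ∈ D.dom) (r : Fin n) :
    IntervalIntegrable (D.linearization σ a c γ r) volume 0 T :=
  intervalIntegrable_ctrlFieldDeriv le_rfl hT le_rfl
    (fun j => D.isC1On_extField ((hσ j).isC1TimeField T)) (D.isC1On_extField ha) hc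
    (hγ.isPrimitiveOn_emb hT D hD r).continuousOn fun t ht => hD t ht r

/-- The solutions of the dual linearized equation along the trajectory. -/
def Cover.IsDualSolution (D : Cover d K) (σ : Fin J → ∀ x : M, TangentSpace (𝓡 d) x)
    (a : ℝ → ∀ x : M, TangentSpace (𝓡 d) x) (T : ℝ) (c : ℝ → EuclideanSpace ℝ (Fin J))
    (γ : ℝ → Config M n) (Λ : Fin n → ℝ → D.Space →L[ℝ] ℝ) : Prop :=
  ∀ r, IsPrimitiveOn 0 T (Λ r) (fun t => -(Λ r t ∘L D.linearization σ a c γ r t))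

/-- The forms along the trajectory given by functionals on the ambient space. -/
def Cover.pullback (D : Cover d K) (γ : ℝ → Config M n) (Λ : Fin n → ℝ → D.Space →L[ℝ] ℝ) (r : Fin n)
    (t : ℝ) : TangentSpace (𝓡 d) ((γ t).1 r) →L[ℝ] ℝ :=
  (Λ r t).comp (mdiff D.emb ((γ t).1 r) : TangentSpace (𝓡 d) ((γ t).1 r) →L[ℝ] D.Space)

lemma IsTrajectory.exists_isDualSolution_initial (hT : 0 ≤ T) (hσ : ∀ j, IsC1Field (σ j))
    (ha : IsC1TimeField T a) (hc : IntervalIntegrable c volume 0 T)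
    (hγ : IsTrajectory σ a T o c γ) (D : Cover d K)
    (hD : ∀ t ∈ Icc 0 T, ∀ r, D.emb ((γ t).1 r) ∈ D.dom) (Λ₀ : Fin n → D.Space →L[ℝ] ℝ) :
    ∃ Λ, D.IsDualSolution σ a T c γ Λ ∧ ∀ r, Λ r 0 = Λ₀ r := by
  choose Λ h1 h2 using fun r => exists_isPrimitiveOn_dual hT
    (hγ.intervalIntegrable_linearization hT hσ ha hc D hD r) (Λ₀ r)
  exact ⟨Λ, h1, h2⟩

lemma IsTrajectory.exists_isDualSolution_terminal (hT : 0 ≤ T) (hσ : ∀ j, IsC1Field (σ j))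
    (ha : IsC1TimeField T a) (hc : IntervalIntegrable c volume 0 T)
    (hγ : IsTrajectory σ a T o c γ) (D : Cover d K)
    (hD : ∀ t ∈ Icc 0 T, ∀ r, D.emb ((γ t).1 r) ∈ D.dom) (Λ₁ : Fin n → D.Space →L[ℝ] ℝ) :
    ∃ Λ, D.IsDualSolution σ a T c γ Λ ∧ ∀ r, Λ r T = Λ₁ r := by
  choose Λ h1 h2 using fun r => exists_isPrimitiveOn_dual_terminal hT
    (hγ.intervalIntegrable_linearization hT hσ ha hc D hD r) (Λ₁ r)
  exact ⟨Λ, h1, h2⟩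

/-- Differentiate the pairing of `Λ` with the extension of `W`: the dual equation contributes `-Λ A
W` and the chain rule contributes `Λ` of the derivative of `W` along the velocity. Together they are
`Λ` of the embedded bracket. -/
lemma IsTrajectory.isCostate_pullback (hT : 0 ≤ T) (hσ : ∀ j, IsC1Field (σ j))
    (ha : IsC1TimeField T a) (hγ : IsTrajectory σ a T o c γ) (D : Cover d K)
    (hD : ∀ t ∈ Icc 0 T, ∀ r, D.emb ((γ t).1 r) ∈ D.dom) {Λ : Fin n → ℝ → D.Space →L[ℝ] ℝ}
    (hΛ : D.IsDualSolution σ a T c γ Λ) : IsCostate σ a T c γ (D.pullback γ Λ) := by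
  intro r W hW
  have hy := (hγ.isPrimitiveOn_emb hT D hD r).comp hT (H := D.extField W) fun t ht =>
    (D.contDiffOn_extField hW.isC1Field).contDiffAt (D.isOpen_dom.mem_nhds (hD t ht r))
  refine IsPrimitiveOn.congr ((hΛ r).clm_apply_apply hT hy) hT (fun t ht => ?_)
    (Eventually.of_forall fun t ht => ?_)
  · beta_reduce
    rw [D.extField_emb W (hD t ht r)]
    rfl
  · have h1 := D.mdiff_emb_mlieBracket_velocity (c := c) hσ ha hW ht (hD t ht r)
    have h2 : D.pullback γ Λ r t (VectorField.mlieBracket (𝓡 d) (velocity σ a c t) W ((γ t).1 r)) =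
      Λ r t (mdiff D.emb ((γ t).1 r)
        (VectorField.mlieBracket (𝓡 d) (velocity σ a c t) W ((γ t).1 r))) := rfl
    rw [h2, h1, map_sub]
    have h3 (v : D.Space) : (-(Λ r t ∘L D.linearization σ a c γ r t)) v =
      -(Λ r t (D.linearization σ a c γ r t v)) := rfl
    rw [h3]; ring

/-- A solution of the costate equation that vanishes at some time vanishes at all later times. -/
lemma IsCostate.eq_zero (hT : 0 ≤ T) (hσ : ∀ j, IsC1Field (σ j))
    (ha : IsC1TimeField T a) (hc : IntervalIntegrable c volume 0 T)
    (hγ : IsTrajectory σ a T o c γ) (D : Cover d K) (hK : ∀ t ∈ Icc 0 T, ∀ r, (γ t).1 r ∈ K)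
    {l : ∀ (r : Fin n) (t : ℝ), TangentSpace (𝓡 d) ((γ t).1 r) →L[ℝ] ℝ}
    (hl : IsCostate σ a T c γ l) {r : Fin n} {t₀ : ℝ} (ht₀ : t₀ ∈ Icc 0 T) (h0 : l r t₀ = 0) :
    ∀ t ∈ Icc t₀ T, l r t = 0 := by
  have hD : ∀ t ∈ Icc 0 T, ∀ r, D.emb ((γ t).1 r) ∈ D.dom := fun t ht r => D.emb_mem_dom (hK t ht r)
  -- Nothing is known about the regularity of `l` beyond its values on smooth fields. `Q` rebuilds
  -- `l` from its values on the frame as a path in a fixed space.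
  let Q : ℝ → D.Space →L[ℝ] ℝ := fun t => ∑ p, l r t (D.frame p ((γ t).1 r)) • D.coord p
  let br : D.s × Fin d → ℝ → D.Space := fun p t => fderiv ℝ (D.extField (D.frame p))
    (D.emb ((γ t).1 r)) (D.extField (velocity σ a c t) (D.emb ((γ t).1 r))) -
      D.linearization σ a c γ r t (D.extField (D.frame p) (D.emb ((γ t).1 r)))
  have hQ : ∀ t ∈ Icc 0 T, ∀ v, l r t v = Q t (mdiff D.emb ((γ t).1 r) v) := fun t ht v => by
    conv_lhs => rw [← D.sum_coord_smul_frame (hK t ht r) v]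
    simp only [map_sum, map_smul, Q, _root_.sum_apply, _root_.smul_apply,
      smul_eq_mul]
    exact Finset.sum_congr rfl fun p _ => mul_comm _ _
  -- The bracket terms are again values of `l`, hence of `Q`, so the equations for the frame close
  -- up to a linear equation for `Q`.
  have hQ' : IsPrimitiveOn 0 T Q (fun t => ∑ p, Q t (br p t) • D.coord p) := by
    have h1 : IsPrimitiveOn 0 T Q (fun t => ∑ p, l r t (VectorField.mlieBracket (𝓡 d)
        (velocity σ a c t) (D.frame p) ((γ t).1 r)) • D.coord p) :=
      IsPrimitiveOn.sum fun p _ => IsPrimitiveOn.clm_apply (hl r (D.frame p) (D.isSmoothField_frame p))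
        (ContinuousLinearMap.toSpanSingleton ℝ (D.coord p))
    refine h1.congr hT (fun _ _ => rfl) (Eventually.of_forall fun t ht => ?_)
    refine Finset.sum_congr rfl fun p _ => ?_
    rw [hQ t ht, D.mdiff_emb_mlieBracket_velocity hσ ha (D.isSmoothField_frame p) ht (hD t ht r)]
  have hy := hγ.isPrimitiveOn_emb hT D hD r
  have hbr (p : D.s × Fin d) : IntervalIntegrable (br p) volume 0 T := by
    have h1 := hy.comp hT (H := D.extField (D.frame p)) fun t ht =>
      (D.contDiffOn_extField (D.isSmoothField_frame p).isC1Field).contDiffAt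
        (D.isOpen_dom.mem_nhds (hD t ht r))
    exact h1.1.sub (IntervalIntegrable.clm_apply_continuousOn hT
      (hγ.intervalIntegrable_linearization hT hσ ha hc D hD r) h1.continuousOn)
  have hm : IntervalIntegrable (fun t => ∑ p, ‖D.coord p‖ * ‖br p t‖) volume t₀ T :=
    intervalIntegrable_mono_Icc (intervalIntegrable_finset_sum fun p => ((hbr p).norm.const_mul _))
      ht₀ ⟨hT, le_rfl⟩
  have hzero := gronwall_norm_eq_zero ht₀.2 (hQ'.mono ht₀ ⟨hT, le_rfl⟩) (by simp [Q, h0]) hm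
    (fun t => by positivity) (Eventually.of_forall fun t _ => by
      rw [Finset.sum_mul]
      refine (norm_sum_le _ _).trans (Finset.sum_le_sum fun p _ => ?_)
      rw [norm_smul]
      calc _ ≤ ‖Q t‖ * ‖br p t‖ * ‖D.coord p‖ := by gcongr; exact (Q t).le_opNorm _
        _ = _ := by ring)
  intro t ht
  ext v
  rw [hQ t ⟨ht₀.1.trans ht.1, ht.2⟩, hzero t ht]
  rfl

omit [T2Space M] in
lemma IsCostate.sub {l l' : ∀ (r : Fin n) (t : ℝ), TangentSpace (𝓡 d) ((γ t).1 r) →L[ℝ] ℝ}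
    (hl : IsCostate σ a T c γ l) (hl' : IsCostate σ a T c γ l') :
    IsCostate σ a T c γ (fun r t => l r t - l' r t) := fun r W hW =>
  IsPrimitiveOn.sub (hl r W hW) (hl' r W hW)

/-- The differential of the embedding is injective and so has a linear left inverse, through which
the form factors. -/
lemma Cover.exists_dual_extension (D : Cover d K) {x : M} (hx : D.emb x ∈ D.dom)
    (l : TangentSpace (𝓡 d) x →ₗ[ℝ] ℝ) : ∃ Λ : D.Space →L[ℝ] ℝ, ∀ v, Λ (mdiff D.emb x v) = l v := by
  obtain ⟨g, hg⟩ := LinearMap.exists_leftInverse_of_injective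
    (mdiff D.emb x : TangentSpace (𝓡 d) x →L[ℝ] D.Space).toLinearMap
    (LinearMap.ker_eq_bot.2 (D.injective_mdiff_emb hx))
  refine ⟨LinearMap.toContinuousLinearMap (l ∘ₗ g), fun v => ?_⟩
  exact congrArg l (LinearMap.congr_fun hg v)

/-- Every solution of the costate equation comes from the dual linearized equation. -/
lemma IsCostate.exists_isDualSolution (hT : 0 ≤ T) (hσ : ∀ j, IsC1Field (σ j))
    (ha : IsC1TimeField T a) (hc : IntervalIntegrable c volume 0 T)
    (hγ : IsTrajectory σ a T o c γ) (D : Cover d K) (hK : ∀ t ∈ Icc 0 T, ∀ r, (γ t).1 r ∈ K)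
    {l : ∀ (r : Fin n) (t : ℝ), TangentSpace (𝓡 d) ((γ t).1 r) →L[ℝ] ℝ}
    (hl : IsCostate σ a T c γ l) : ∃ Λ, D.IsDualSolution σ a T c γ Λ ∧
      ∀ r, ∀ t ∈ Icc 0 T, l r t = D.pullback γ Λ r t := by
  have hD : ∀ t ∈ Icc 0 T, ∀ r, D.emb ((γ t).1 r) ∈ D.dom := fun t ht r => D.emb_mem_dom (hK t ht r)
  have h0T : (0 : ℝ) ∈ Icc 0 T := ⟨le_rfl, hT⟩
  -- Extend the initial forms arbitrarily and solve the dual equation; the result and `l` are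
  -- costates that agree at time zero.
  choose Λ₀ hΛ₀ using fun r => D.exists_dual_extension (hD 0 h0T r) (l r 0).toLinearMap
  obtain ⟨Λ, hΛ, hΛ0⟩ := hγ.exists_isDualSolution_initial hT hσ ha hc D hD Λ₀
  refine ⟨Λ, hΛ, fun r t ht => sub_eq_zero.1 ?_⟩
  refine (hl.sub (hγ.isCostate_pullback hT hσ ha D hD hΛ)).eq_zero hT hσ ha hc hγ D hK h0T ?_ t ht
  ext v
  have : D.pullback γ Λ r 0 v = l r 0 v := by
    rw [show l r 0 v = (l r 0).toLinearMap v from rfl, ← hΛ₀ r v, ← hΛ0 r]; rfl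
  exact sub_eq_zero.2 this.symm

/-- The pairing of a dual solution with a variation of the trajectory. -/
lemma Cover.IsDualSolution.apply_variation (hT : 0 ≤ T) (D : Cover d K)
    (hD : ∀ t ∈ Icc 0 T, ∀ r, D.emb ((γ t).1 r) ∈ D.dom) {Λ : Fin n → ℝ → D.Space →L[ℝ] ℝ}
    (hΛ : D.IsDualSolution σ a T c γ Λ) (r : Fin n) {ξ : ℝ → D.Space}
    {k : ℝ → EuclideanSpace ℝ (Fin J)}
    (hξ : IsPrimitiveOn 0 T ξ (fun t => D.linearization σ a c γ r t (ξ t) +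
      ∑ j, k t j • D.extField (σ j) (D.emb ((γ t).1 r)))) :
    IsPrimitiveOn 0 T (fun t => Λ r t (ξ t))
      (fun t => ∑ j, k t j * D.pullback γ Λ r t (σ j ((γ t).1 r))) := by
  refine ((hΛ r).clm_apply_apply hT hξ).congr hT (fun _ _ => rfl)
    (Eventually.of_forall fun t ht => ?_)
  have h1 : (-(Λ r t ∘L D.linearization σ a c γ r t)) (ξ t) =
    -(Λ r t (D.linearization σ a c γ r t (ξ t))) := rfl
  -- The linearization acts with opposite signs on `Λ` and on the variation; only the control terms
  -- survive.
  rw [h1, map_add, neg_add_cancel_left, map_sum]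
  refine Finset.sum_congr rfl fun j _ => ?_
  rw [D.extField_emb _ (hD t ht r), map_smul]
  rfl

end Costate

/-! ### The Hilbert space of controls -/

section ControlSpace

variable {J : ℕ} {T : ℝ}

lemma Control.inner_eq (hT : 0 ≤ T) (k v : Control J T) :
    inner ℝ k v = ∫ t in (0 : ℝ)..T, ∑ j, k t j * v t j := by
  rw [L2.inner_def, intervalIntegral.integral_of_le hT, ← integral_Icc_eq_integral_Ioc]
  congr 1
  ext t
  simp [PiLp.inner_apply, mul_comm]

lemma onsagerMachlup_eq (u : Control J T) : onsagerMachlup u = (1 / 2) * ‖u‖ ^ 2 := by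
  rw [onsagerMachlup, ← real_inner_self_eq_norm_sq u, L2.inner_def]
  simp only [real_inner_self_eq_norm_sq]

lemma hasStrictFDerivAt_onsagerMachlup (u : Control J T) :
    HasStrictFDerivAt (onsagerMachlup : Control J T → ℝ) (innerSL ℝ u) u := by
  have h := (hasStrictFDerivAt_norm_sq u).const_mul (1 / 2 : ℝ)
  have h1 : (onsagerMachlup : Control J T → ℝ) = fun u => (1 / 2) * ‖u‖ ^ 2 :=
    funext onsagerMachlup_eq
  have h2 : innerSL ℝ u = (1 / 2 : ℝ) • (2 • innerSL ℝ u) := by ext k; simp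
  rw [h1, h2]
  exact h

/-- A square integrable function that is orthogonal to all controls vanishes. -/
lemma ae_eq_zero_of_forall_integral_eq_zero (hT : 0 ≤ T) {h : ℝ → EuclideanSpace ℝ (Fin J)}
    (hh : MemLp h 2 (volume.restrict (Icc (0 : ℝ) T)))
    (h0 : ∀ k : Control J T, ∫ t in (0 : ℝ)..T, ∑ j, k t j * h t j = 0) :
    h =ᵐ[volume.restrict (Icc (0 : ℝ) T)] 0 := by
  have h1 := hh.coeFn_toLp
  have h2 : inner ℝ (hh.toLp h) (hh.toLp h) = (0 : ℝ) := by
    rw [Control.inner_eq hT]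
    refine (intervalIntegral.integral_congr_ae ?_).trans (h0 (hh.toLp h))
    rw [uIoc_of_le hT]
    filter_upwards [(ae_restrict_iff' measurableSet_Icc).1 h1] with t ht htT
    rw [ht (Ioc_subset_Icc_self htT)]
  rw [inner_self_eq_zero] at h2
  rw [h2] at h1
  exact h1.symm.trans (Lp.coeFn_zero _ _ _)

end ControlSpace

/-! ### Uniqueness of the control and the differential of the endpoint map -/

section Final

variable {d n J : ℕ} {M : Type*} [TopologicalSpace M] [ChartedSpace (EuclideanSpace ℝ (Fin d)) M]
  [IsManifold (𝓡 d) ∞ M] [T2Space M]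
  {K : Set M} {T : ℝ} {σ : Fin J → ∀ x : M, TangentSpace (𝓡 d) x}
  {a : ℝ → ∀ x : M, TangentSpace (𝓡 d) x} {o : Config M n} {c c' : ℝ → EuclideanSpace ℝ (Fin J)}
  {γ : ℝ → Config M n}

omit [T2Space M] in
lemma IsCostate.congr_control (hT : 0 ≤ T)
    {l : ∀ (r : Fin n) (t : ℝ), TangentSpace (𝓡 d) ((γ t).1 r) →L[ℝ] ℝ}
    (h : IsCostate σ a T c γ l) (hc : ∀ᵐ t, t ∈ Icc 0 T → c' t = c t) :
    IsCostate σ a T c' γ l := by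
  refine fun r W hW => IsPrimitiveOn.congr (h r W hW) hT (fun _ _ => rfl) ?_
  filter_upwards [hc] with t ht htT
  have : velocity σ a c' t = velocity σ a c t := by unfold velocity; rw [ht htT]
  simp only [this]

omit [IsManifold (𝓡 d) ∞ M] [T2Space M] in
-- The difference of the two control fields vanishes at the `n` distinct points of the
-- configuration, so it is the zero field, and linear independence makes its coefficients vanish.
lemma eq_of_velocity_eq (hσ_indep : LinearIndependent ℝ σ) (hA1 : FewZeros n σ) {t : ℝ}
    {x : Fin n → M} (hx : Function.Injective x)
    (h : ∀ r, velocity σ a c t (x r) = velocity σ a c' t (x r)) : c t = c' t := by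
  let V : ∀ x : M, TangentSpace (𝓡 d) x := ∑ j, (c t j - c' t j) • σ j
  have hVx (r : Fin n) : V (x r) = 0 := by
    have h1 := h r
    simp only [velocity, add_left_inj] at h1
    simp only [V, Finset.sum_apply, Pi.smul_apply]
    simp only [sub_smul, Finset.sum_sub_distrib]
    exact sub_eq_zero.2 h1
  have hV : V = 0 := by
    by_contra hne
    have h1 := hA1 V (Submodule.sum_mem _ fun j _ => Submodule.smul_mem _ _
      (Submodule.subset_span ⟨j, rfl⟩)) hne
    have h2 : (range x).encard ≤ {x : M | V x = 0}.encard :=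
      encard_le_encard (range_subset_iff.2 hVx)
    have h3 : (range x).encard = n := by
      rw [← image_univ, hx.injOn.encard_image, encard_univ]
      simp
    rw [h3] at h2
    exact absurd h1 (not_lt.2 h2)
  ext j
  exact sub_eq_zero.1 (Fintype.linearIndependent_iff.1 hσ_indep _ hV j)

/-- A trajectory determines its control. -/
lemma IsTrajectory.control_unique [SecondCountableTopology M] (hT : 0 < T)
    (hσ_indep : LinearIndependent ℝ σ) (hA1 : FewZeros n σ)
    (h : IsTrajectory σ a T o c γ) (h' : IsTrajectory σ a T o c' γ) :
    ∀ᵐ t, t ∈ Icc 0 T → c t = c' t := by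
  obtain ⟨D⟩ := exists_cover (d := d) h.isCompact_range
  have hD : ∀ t ∈ Icc 0 T, ∀ r, D.emb ((γ t).1 r) ∈ D.dom := fun t ht r =>
    D.emb_mem_dom (mem_iUnion.2 ⟨r, t, ht, rfl⟩)
  have h1 := ae_all_iff.2 fun r => (h.isPrimitiveOn_emb hT.le D hD r).ae_hasDerivAt
  have h2 := ae_all_iff.2 fun r => (h'.isPrimitiveOn_emb hT.le D hD r).ae_hasDerivAt
  filter_upwards [h1, h2] with t ht1 ht2 ht
  refine eq_of_velocity_eq (a := a) hσ_indep hA1 (γ t).2 fun r => D.injective_mdiff_emb (hD t ht r) ?_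
  rw [← D.extField_emb _ (hD t ht r), ← D.extField_emb _ (hD t ht r)]
  exact ((uniqueDiffOn_Icc hT) t ht).eq_deriv _ (ht1 r ht) (ht2 r ht)

/-- The trajectory chosen in the definition of `endpoint` is immaterial by uniqueness. -/
lemma endpoint_eq [SecondCountableTopology M] (hT : 0 ≤ T) (hσ : ∀ j, IsC1Field (σ j))
    (ha : IsC1TimeField T a) {u : Control J T} (h : IsTrajectory σ a T o u γ) :
    endpoint σ a T o u = γ T := by
  have hex : ∃ γ : ℝ → Config M n, IsTrajectory σ a T o u γ := ⟨γ, h⟩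
  rw [endpoint, dif_pos hex]
  exact hex.choose_spec.eqOn hT hσ ha (Control.intervalIntegrable hT u) h ⟨hT, le_rfl⟩

/-- The endpoints of the trajectories near `u` in the embedding, and the variational equation for
their differential. -/
lemma IsTrajectory.exists_endpoint_emb (hT : 0 ≤ T) (hσ : ∀ j, IsC1Field (σ j))
    (ha : IsC1TimeField T a) {u : Control J T} (h : IsTrajectory σ a T o u γ) (D : Cover d K)
    (hD : ∀ t ∈ Icc 0 T, ∀ r, D.emb ((γ t).1 r) ∈ D.dom) :
    ∃ (Φ : Fin n → Control J T → D.Space) (Φ' : Fin n → Control J T →L[ℝ] D.Space)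
      (ξ : Fin n → Control J T → ℝ → D.Space),
      (∀ r, HasStrictFDerivAt (Φ r) (Φ' r) u) ∧
      (∀ᶠ v : Control J T in 𝓝 u, ∃ η : ℝ → Config M n, IsTrajectory σ a T o v η ∧
        ∀ r, D.emb ((η T).1 r) = Φ r v ∧ Φ r v ∈ D.dom) ∧
      ∀ r k, IsPrimitiveOn 0 T (ξ r k) (fun t => D.linearization σ a u γ r t (ξ r k t) +
        ∑ j, k t j • D.extField (σ j) (D.emb ((γ t).1 r))) ∧ ξ r k 0 = 0 ∧ ξ r k T = Φ' r k := by
  obtain ⟨Ψ, Ψ', h1, h2, h3⟩ := h.exists_flow hT hσ ha D hD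
  let e : C(Icc 0 T, D.Space) →L[ℝ] D.Space := ContinuousMap.evalCLM ℝ ⟨T, hT, le_rfl⟩
  refine ⟨fun r v => e (Ψ r v), fun r => e ∘L Ψ' r, fun r k => IccExtend hT (Ψ' r k),
    fun r => e.hasStrictFDerivAt.comp u (h1 r), ?_, fun r k => ⟨(h3 r k).1, (h3 r k).2, ?_⟩⟩
  · filter_upwards [h2] with v hv
    obtain ⟨η, hη, hη'⟩ := hv
    exact ⟨η, hη, fun r => hη' ⟨T, hT, le_rfl⟩ r⟩
  · exact IccExtend_right hT _

/-- A proper subspace is killed by a nonzero functional, which splits into one form per landmark;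
each form extends to the ambient space. Nontriviality must be tested on tangent vectors, because
ambient functionals can vanish on all of them. -/
lemma Cover.not_surjective_iff (D : Cover d K) {U : Type*} [AddCommGroup U] [Module ℝ U]
    {p : Fin n → M} (hp : ∀ r, D.emb (p r) ∈ D.dom) (L : U →ₗ[ℝ] ∀ r, TangentSpace (𝓡 d) (p r)) :
    ¬ Function.Surjective L ↔ ∃ Λ : Fin n → D.Space →L[ℝ] ℝ,
      (∃ r, ∃ v : TangentSpace (𝓡 d) (p r), Λ r (mdiff D.emb (p r) v) ≠ 0) ∧
      ∀ k, ∑ r, Λ r (mdiff D.emb (p r) (L k r)) = 0 := by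
  constructor
  · intro h
    rw [← LinearMap.range_eq_top] at h
    obtain ⟨f, hf, hfL⟩ := Submodule.exists_le_ker_of_lt_top _ (lt_top_iff_ne_top.2 h)
    choose Λ hΛ using fun r => D.exists_dual_extension (hp r)
      (f ∘ₗ LinearMap.single ℝ (fun r => TangentSpace (𝓡 d) (p r)) r)
    have hsum (x : ∀ r, TangentSpace (𝓡 d) (p r)) : ∑ r, Λ r (mdiff D.emb (p r) (x r)) = f x := by
      conv_rhs => rw [← Finset.univ_sum_single x, map_sum]
      exact Finset.sum_congr rfl fun r _ => hΛ r (x r)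
    refine ⟨Λ, ?_, fun k => (hsum _).trans (hfL ⟨k, rfl⟩)⟩
    by_contra! h0
    refine hf (LinearMap.ext fun x => ?_)
    rw [← hsum x]
    exact Finset.sum_eq_zero fun r _ => h0 r (x r)
  · rintro ⟨Λ, ⟨r, v, hv⟩, h0⟩ hsurj
    obtain ⟨k, hk⟩ := hsurj (Pi.single r v)
    refine hv ?_
    rw [← h0 k, hk, Finset.sum_eq_single r (fun s _ hs => ?_) (by simp), Pi.single_eq_same]
    rw [Pi.single_eq_of_ne hs]
    simp

variable [SecondCountableTopology M]

/-- Regularity in terms of the variational equation. -/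
lemma IsTrajectory.not_isRegularControl_iff (hT : 0 ≤ T) (hσ : ∀ j, IsC1Field (σ j))
    (ha : IsC1TimeField T a) {u : Control J T} (h : IsTrajectory σ a T o u γ) (D : Cover d K)
    (hD : ∀ t ∈ Icc 0 T, ∀ r, D.emb ((γ t).1 r) ∈ D.dom) {Φ : Fin n → Control J T → D.Space}
    {Φ' : Fin n → Control J T →L[ℝ] D.Space} (hΦ : ∀ r, HasStrictFDerivAt (Φ r) (Φ' r) u)
    (hev : ∀ᶠ v : Control J T in 𝓝 u, ∃ η : ℝ → Config M n, IsTrajectory σ a T o v η ∧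
        ∀ r, D.emb ((η T).1 r) = Φ r v ∧ Φ r v ∈ D.dom) :
    ¬ IsRegularControl σ a T o u ↔ ∃ Λ : Fin n → D.Space →L[ℝ] ℝ,
      (∃ r, ∃ v : TangentSpace (𝓡 d) ((γ T).1 r), Λ r (mdiff D.emb ((γ T).1 r) v) ≠ 0) ∧
      ∀ k, ∑ r, Λ r (Φ' r k) = 0 := by
  have hend : endpoint σ a T o u = γ T := endpoint_eq hT hσ ha h
  have hdom (r : Fin n) : D.emb ((endpoint σ a T o u).1 r) ∈ D.dom := by
    rw [hend]; exact hD T ⟨hT, le_rfl⟩ r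
  have hev' (r : Fin n) : ∀ᶠ v : Control J T in 𝓝 u,
      D.emb ((endpoint σ a T o v).1 r) = Φ r v := by
    filter_upwards [hev] with v ⟨η, hη, hη'⟩
    rw [endpoint_eq hT hσ ha hη, (hη' r).1]
  have hd (r : Fin n) (k : Control J T) := D.mdiff_emb_mfderiv (hΦ r).hasFDerivAt (hev' r) (hdom r) k
  let L : Control J T →ₗ[ℝ] ∀ r, TangentSpace (𝓡 d) ((endpoint σ a T o u).1 r) :=
    LinearMap.pi fun r => (mfderiv 𝓘(ℝ, Control J T) (𝓡 d)
      (fun v => (endpoint σ a T o v).1 r) u).toLinearMap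
  have h1 := D.not_surjective_iff hdom L
  have h2 : IsRegularControl σ a T o u ↔ Function.Surjective L := Iff.rfl
  have h3 (r : Fin n) (k : Control J T) : mdiff D.emb _ (L k r) = Φ' r k := hd r k
  simp only [h3] at h1
  rw [h2, h1, hend]

end Final

/-! ### Singular controls and the Lagrange multiplier rule -/

section Characterization

variable {d n J : ℕ} {M : Type*} [TopologicalSpace M] [ChartedSpace (EuclideanSpace ℝ (Fin d)) M]
  [IsManifold (𝓡 d) ∞ M] [T2Space M]
  {K : Set M} {T : ℝ} {σ : Fin J → ∀ x : M, TangentSpace (𝓡 d) x}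
  {a : ℝ → ∀ x : M, TangentSpace (𝓡 d) x} {o : Config M n} {c : ℝ → EuclideanSpace ℝ (Fin J)}
  {γ : ℝ → Config M n}

/-- The momenta `∑ r, l r t (σ j)` of the forms given by a dual solution. -/
def Cover.momentum (D : Cover d K) (σ : Fin J → ∀ x : M, TangentSpace (𝓡 d) x)
    (γ : ℝ → Config M n) (Λ : Fin n → ℝ → D.Space →L[ℝ] ℝ) (t : ℝ) : EuclideanSpace ℝ (Fin J) :=
  WithLp.toLp 2 fun j => ∑ r, D.pullback γ Λ r t (σ j ((γ t).1 r))

/-- Continuity improves vanishing of the momentum almost everywhere to vanishing at every time. -/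
lemma IsTrajectory.continuousOn_momentum (hT : 0 ≤ T) (hσ : ∀ j, IsC1Field (σ j))
    (hγ : IsTrajectory σ a T o c γ) (D : Cover d K)
    (hD : ∀ t ∈ Icc 0 T, ∀ r, D.emb ((γ t).1 r) ∈ D.dom) {Λ : Fin n → ℝ → D.Space →L[ℝ] ℝ}
    (hΛ : D.IsDualSolution σ a T c γ Λ) : ContinuousOn (D.momentum σ γ Λ) (Icc 0 T) := by
  refine (PiLp.continuous_toLp 2 _).comp_continuousOn (continuousOn_pi.2 fun j =>
    continuousOn_finsetSum _ fun r _ => ?_)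
  have h1 : ContinuousOn (fun t => D.extField (σ j) (D.emb ((γ t).1 r))) (Icc 0 T) :=
    (D.contDiffOn_extField (hσ j)).continuousOn.comp (hγ.isPrimitiveOn_emb hT D hD r).continuousOn
      fun t ht => hD t ht r
  refine ((hΛ r).continuousOn.clm_apply h1).congr fun t ht => ?_
  beta_reduce
  rw [D.extField_emb _ (hD t ht r)]
  rfl

lemma IsTrajectory.memLp_momentum (hT : 0 ≤ T) (hσ : ∀ j, IsC1Field (σ j))
    (hγ : IsTrajectory σ a T o c γ) (D : Cover d K)
    (hD : ∀ t ∈ Icc 0 T, ∀ r, D.emb ((γ t).1 r) ∈ D.dom) {Λ : Fin n → ℝ → D.Space →L[ℝ] ℝ}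
    (hΛ : D.IsDualSolution σ a T c γ Λ) :
    MemLp (D.momentum σ γ Λ) 2 (volume.restrict (Icc (0 : ℝ) T)) := by
  have h := hγ.continuousOn_momentum hT hσ D hD hΛ
  obtain ⟨C, hC⟩ := isCompact_Icc.exists_bound_of_continuousOn h
  exact MemLp.of_bound (h.aestronglyMeasurable measurableSet_Icc) C
    ((ae_restrict_iff' measurableSet_Icc).2 (Eventually.of_forall hC))

/-- The pairing of the terminal value of a dual solution with the differential of the endpoint. -/
lemma Cover.IsDualSolution.sum_apply_endpoint (hT : 0 ≤ T) (D : Cover d K)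
    (hD : ∀ t ∈ Icc 0 T, ∀ r, D.emb ((γ t).1 r) ∈ D.dom) {Λ : Fin n → ℝ → D.Space →L[ℝ] ℝ}
    (hΛ : D.IsDualSolution σ a T c γ Λ) {ξ : Fin n → ℝ → D.Space}
    {k : ℝ → EuclideanSpace ℝ (Fin J)}
    (hξ : ∀ r, IsPrimitiveOn 0 T (ξ r) (fun t => D.linearization σ a c γ r t (ξ r t) +
      ∑ j, k t j • D.extField (σ j) (D.emb ((γ t).1 r)))) (h0 : ∀ r, ξ r 0 = 0) :
    ∑ r, Λ r T (ξ r T) = ∫ t in (0 : ℝ)..T, ∑ j, k t j * D.momentum σ γ Λ t j := by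
  have h := (IsPrimitiveOn.sum fun r (_ : r ∈ Finset.univ) =>
    hΛ.apply_variation hT D hD r (hξ r)).2 T ⟨hT, le_rfl⟩
  simp only [h0, map_zero, Finset.sum_const_zero, zero_add] at h
  rw [h]
  refine intervalIntegral.integral_congr fun t _ => ?_
  simp only [momentum, Finset.mul_sum]
  exact Finset.sum_comm

variable [SecondCountableTopology M]

/-- The controls that are not regular are those which admit nontrivial costates that annihilate the
control fields. -/
theorem IsTrajectory.not_isRegularControl_iff_exists_costate (hT : 0 < T)
    (hσ : ∀ j, IsC1Field (σ j)) (ha : IsC1TimeField T a) {u : Control J T}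
    (h : IsTrajectory σ a T o u γ) : ¬ IsRegularControl σ a T o u ↔
      ∃ l : ∀ (r : Fin n) (t : ℝ), TangentSpace (𝓡 d) ((γ t).1 r) →L[ℝ] ℝ,
        IsCostate σ a T u γ l ∧ (∀ t ∈ Icc 0 T, ∃ r, l r t ≠ 0) ∧
        ∀ j, ∀ t ∈ Icc 0 T, ∑ r, l r t (σ j ((γ t).1 r)) = 0 := by
  obtain ⟨D⟩ := exists_cover (d := d) h.isCompact_range
  have hK : ∀ t ∈ Icc 0 T, ∀ r, (γ t).1 r ∈ ⋃ r, (fun t => (γ t).1 r) '' Icc 0 T :=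
    fun t ht r => mem_iUnion.2 ⟨r, t, ht, rfl⟩
  have hD : ∀ t ∈ Icc 0 T, ∀ r, D.emb ((γ t).1 r) ∈ D.dom := fun t ht r => D.emb_mem_dom (hK t ht r)
  have hu := Control.intervalIntegrable hT.le u
  have hTT : T ∈ Icc 0 T := ⟨hT.le, le_rfl⟩
  obtain ⟨Φ, Φ', ξ, hΦ, hev, hξ⟩ := h.exists_endpoint_emb hT.le hσ ha D hD
  rw [h.not_isRegularControl_iff hT.le hσ ha D hD hΦ hev]
  have hpair {Λ : Fin n → ℝ → D.Space →L[ℝ] ℝ} (hΛ : D.IsDualSolution σ a T u γ Λ)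
      (k : Control J T) :
      ∑ r, Λ r T (Φ' r k) = ∫ t in (0 : ℝ)..T, ∑ j, k t j * D.momentum σ γ Λ t j := by
    rw [← hΛ.sum_apply_endpoint hT.le D hD (fun r => (hξ r k).1) fun r => (hξ r k).2.1]
    simp only [(hξ _ k).2.2]
  constructor
  · rintro ⟨Λ₁, ⟨s, v, hv⟩, h0⟩
    obtain ⟨Λ, hΛ, hΛT⟩ := h.exists_isDualSolution_terminal hT.le hσ ha hu D hD Λ₁
    have hcos := h.isCostate_pullback hT.le hσ ha D hD hΛ
    refine ⟨D.pullback γ Λ, hcos, fun t ht => ?_, fun j t ht => ?_⟩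
    -- A costate vanishing at `t` would vanish at the later time `T`, where its value is nonzero by
    -- construction.
    · by_contra! hzero
      refine hv ?_
      have h1 := hcos.eq_zero hT.le hσ ha hu h D hK ht (hzero s) T ⟨ht.2, le_rfl⟩
      rw [← hΛT]
      exact DFunLike.congr_fun h1 v
    -- The momentum is itself an admissible direction, so being orthogonal to all controls it is
    -- zero.
    · have h1 := ae_eq_zero_of_forall_integral_eq_zero hT.le (h.memLp_momentum hT.le hσ D hD hΛ)
        fun k => by rw [← hpair hΛ]; simpa only [hΛT] using h0 k
      have h2 := Measure.eqOn_Icc_of_ae_eq volume hT.ne h1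
        (h.continuousOn_momentum hT.le hσ D hD hΛ) continuousOn_const ht
      exact congrArg (fun w : EuclideanSpace ℝ (Fin J) => w j) h2
  · rintro ⟨l, hl, hne, hzero⟩
    obtain ⟨Λ, hΛ, hlΛ⟩ := hl.exists_isDualSolution hT.le hσ ha hu h D hK
    refine ⟨fun r => Λ r T, ?_, fun k => ?_⟩
    · obtain ⟨r, hr⟩ := hne T hTT
      by_contra! hall
      refine hr (ContinuousLinearMap.ext fun v => ?_)
      rw [hlΛ r T hTT]
      exact hall r v
    · rw [hpair hΛ, intervalIntegral.integral_of_le hT.le]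
      refine setIntegral_eq_zero_of_forall_eq_zero fun t ht => Finset.sum_eq_zero fun j _ => ?_
      have ht' := Ioc_subset_Icc_self ht
      have h1 : D.momentum σ γ Λ t j = 0 := by
        have h2 := hzero j t ht'
        simp only [hlΛ _ t ht'] at h2
        exact h2
      rw [h1, mul_zero]

/-- The Lagrange multiplier rule: a regular minimizing control is given by a costate. -/
theorem IsTrajectory.exists_costate_of_minimizer (hT : 0 < T)
    (hσ : ∀ j, IsC1Field (σ j)) (ha : IsC1TimeField T a) {u : Control J T}
    (h : IsTrajectory σ a T o u γ) (hreg : IsRegularControl σ a T o u)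
    (hmin : ∀ (v : Control J T) (η : ℝ → Config M n), IsTrajectory σ a T o v η → η T = γ T →
      onsagerMachlup u ≤ onsagerMachlup v) :
      ∃ l : ∀ (r : Fin n) (t : ℝ), TangentSpace (𝓡 d) ((γ t).1 r) →L[ℝ] ℝ,
        IsCostate σ a T u γ l ∧ ∀ j, ∀ᵐ t ∂(volume.restrict (Icc (0 : ℝ) T)),
          ∑ r, l r t (σ j ((γ t).1 r)) = u t j := by
  obtain ⟨D⟩ := exists_cover (d := d) h.isCompact_range
  have hK : ∀ t ∈ Icc 0 T, ∀ r, (γ t).1 r ∈ ⋃ r, (fun t => (γ t).1 r) '' Icc 0 T :=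
    fun t ht r => mem_iUnion.2 ⟨r, t, ht, rfl⟩
  have hD : ∀ t ∈ Icc 0 T, ∀ r, D.emb ((γ t).1 r) ∈ D.dom := fun t ht r => D.emb_mem_dom (hK t ht r)
  have hu := Control.intervalIntegrable hT.le u
  have hTT : T ∈ Icc 0 T := ⟨hT.le, le_rfl⟩
  obtain ⟨Φ, Φ', ξ, hΦ, hev, hξ⟩ := h.exists_endpoint_emb hT.le hσ ha D hD
  have hregiff := h.not_isRegularControl_iff hT.le hσ ha D hD hΦ hev
  have hend (v : Control J T) (η : ℝ → Config M n) (hη : IsTrajectory σ a T o v η) :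
      endpoint σ a T o v = η T := endpoint_eq hT.le hσ ha hη
  have hΦu (r : Fin n) : Φ r u = D.emb ((γ T).1 r) := by
    obtain ⟨η, hη, hη'⟩ := hev.self_of_nhds
    rw [← (hη' r).1, ← hend u η hη, hend u γ h]
  -- The constraint is expressed in one chart per landmark. The ambient endpoint map cannot be onto
  -- when the ambient dimension exceeds `d`, and would then allow abnormal multipliers even at
  -- regular controls.
  choose i hi using fun r => D.exists_weight_ne_zero (hD T hTT r)
  let q (r : Fin n) : D.Space →L[ℝ] EuclideanSpace ℝ (Fin d) :=
    ContinuousLinearMap.fst ℝ _ _ ∘L ContinuousLinearMap.proj (i r)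
  let Q : (Fin n → D.Space) →L[ℝ] Fin n → EuclideanSpace ℝ (Fin d) :=
    ContinuousLinearMap.pi fun r => q r ∘L ContinuousLinearMap.proj r
  have hf : HasStrictFDerivAt (fun v => Q fun r => Φ r v) (Q ∘L ContinuousLinearMap.pi Φ') u :=
    Q.hasStrictFDerivAt.comp u (hasStrictFDerivAt_pi.2 hΦ)
  have hw : ∀ᶠ v in 𝓝 u, ∀ r, D.weight (i r) (Φ r v) ≠ 0 := eventually_all.2 fun r => by
    have h1 : ContinuousAt (D.weight (i r)) (Φ r u) :=
      (D.contDiffOn_weight (n := 0) (i r)).continuousOn.continuousAt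
        (D.isOpen_dom.mem_nhds (by rw [hΦu]; exact hD T hTT r))
    exact (h1.comp (hΦ r).continuousAt).eventually_ne (by rw [Function.comp_apply, hΦu]; exact hi r)
  have hextr : IsLocalExtrOn (onsagerMachlup : Control J T → ℝ)
      {v | (Q fun r => Φ r v) = Q fun r => Φ r u} u := by
    refine Or.inl ?_
    have h1 : ∀ᶠ v in 𝓝 u, (Q fun r => Φ r v) = (Q fun r => Φ r u) →
        onsagerMachlup u ≤ onsagerMachlup v := by
      filter_upwards [hev, hw] with v ⟨η, hη, hη'⟩ hwv hQ
      refine hmin v η hη (Subtype.ext (funext fun r => ?_))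
      -- A chart of nonzero weight at both endpoints recovers them from their coordinates, so equal
      -- coordinates mean equal endpoints.
      have h2 := D.retr_emb (D.mem_tsupport_of_weight (x := (η T).1 r)
        (by rw [(hη' r).1]; exact hwv r))
      have h3 := D.retr_emb (D.mem_tsupport_of_weight (hi r))
      have h4 : (Φ r v (i r)).1 = (Φ r u (i r)).1 := congrFun hQ r
      rw [← h2, ← h3, Cover.retr, Cover.retr, (hη' r).1, h4, hΦu]
    exact eventually_nhdsWithin_iff.2 h1
  obtain ⟨Θ, Θ₀, hne, hΘ⟩ := hextr.exists_linear_map_of_hasStrictFDerivAt hf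
    (hasStrictFDerivAt_onsagerMachlup u)
  let Θ' (r : Fin n) : D.Space →L[ℝ] ℝ :=
    (LinearMap.toContinuousLinearMap (Θ ∘ₗ LinearMap.single ℝ (fun _ => EuclideanSpace ℝ (Fin d)) r)) ∘L q r
  have hsum (y : Fin n → D.Space) : ∑ r, Θ' r (y r) = Θ (Q y) := by
    conv_rhs => rw [← Finset.univ_sum_single (Q y), map_sum]
    rfl
  have hΘ' (k : Control J T) : ∑ r, Θ' r (Φ' r k) + Θ₀ * inner ℝ u k = 0 := by
    rw [hsum fun r => Φ' r k]
    exact hΘ k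
  -- An abnormal multiplier would kill the image of the differential, contradicting regularity. It
  -- is nonzero on tangent vectors because every coordinate vector comes from one, by `chartField`.
  have hΘ₀ : Θ₀ ≠ 0 := by
    intro h0
    have hΘne : Θ ≠ 0 := fun h1 => hne (by rw [h0, h1]; rfl)
    refine hregiff.2 ⟨Θ', ?_, fun k => by simpa [h0] using hΘ' k⟩ hreg
    by_contra! hall
    refine hΘne (LinearMap.ext fun e => ?_)
    have h1 (r : Fin n) : Θ (Pi.single r (e r)) = 0 := by
      have hsupp := D.mem_tsupport_of_weight (hi r)
      have hs := D.mem_chart_source_of_tsupport hsupp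
      have h2 : q r (mdiff D.emb ((γ T).1 r) (chartField (i r : M) (e r) ((γ T).1 r))) = e r :=
        (D.mdiff_emb_fst (D.emb_fst_eventuallyEq hsupp) _).trans (mdiff_extChartAt_chartField hs _)
      have h3 := hall r (chartField (i r : M) (e r) ((γ T).1 r))
      have h4 : Θ (Pi.single r (q r (mdiff D.emb ((γ T).1 r)
        (chartField (i r : M) (e r) ((γ T).1 r))))) = 0 := h3
      rwa [h2] at h4
    rw [← Finset.univ_sum_single e, map_sum]
    exact Finset.sum_eq_zero fun r _ => h1 r
  -- The multiplier relation reads `Θ' (dΠ k) + Θ₀ ⟨u, k⟩ = 0`; this normalization makes the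
  -- terminal pairing equal to `⟨u, k⟩`.
  obtain ⟨Λ, hΛ, hΛT⟩ := h.exists_isDualSolution_terminal hT.le hσ ha hu D hD
    fun r => (-Θ₀⁻¹) • Θ' r
  refine ⟨D.pullback γ Λ, h.isCostate_pullback hT.le hσ ha D hD hΛ, ?_⟩
  have hmom := h.memLp_momentum hT.le hσ D hD hΛ
  have hint (k : Control J T) : inner ℝ k (hmom.toLp _) = inner ℝ k u := by
    have h1 : inner ℝ k (hmom.toLp _) = ∑ r, Λ r T (Φ' r k) := by
      simp only [← (hξ _ k).2.2]
      rw [hΛ.sum_apply_endpoint hT.le D hD (fun r => (hξ r k).1) fun r => (hξ r k).2.1,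
        Control.inner_eq hT.le]
      refine intervalIntegral.integral_congr_ae ?_
      rw [uIoc_of_le hT.le]
      filter_upwards [(ae_restrict_iff' measurableSet_Icc).1 hmom.coeFn_toLp] with t ht htT
      rw [ht (Ioc_subset_Icc_self htT)]
    have h2 : ∑ r, Λ r T (Φ' r k) = -Θ₀⁻¹ * ∑ r, Θ' r (Φ' r k) := by
      rw [Finset.mul_sum]
      exact Finset.sum_congr rfl fun r _ => by rw [hΛT]; rfl
    rw [h1, h2, eq_neg_of_add_eq_zero_left (hΘ' k), real_inner_comm k u]
    field_simp
  have heq : hmom.toLp _ = u := ext_inner_left ℝ hint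
  intro j
  have h1 := hmom.coeFn_toLp
  rw [heq] at h1
  filter_upwards [h1] with t ht
  rw [ht]
  rfl

end Characterization

end Landmark

end

/-! ### The characterizations for the given control -/

theorem mainTheorem3 {d n J : ℕ} (hn : 1 ≤ n) {M : Type*} [TopologicalSpace M] [T2Space M]
    [SecondCountableTopology M] [ChartedSpace (EuclideanSpace ℝ (Fin d)) M]
    [IsManifold (𝓡 d) ∞ M]
    (T : ℝ) (hT : 0 < T)
    (σ : Fin J → ∀ x : M, TangentSpace (𝓡 d) x) (hσ : ∀ j, Landmark.IsC1Field (σ j))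
    (hσ_indep : LinearIndependent ℝ σ) (hA1 : Landmark.FewZeros n σ)
    (a : ℝ → ∀ x : M, TangentSpace (𝓡 d) x) (ha : Landmark.IsC1TimeField T a)
    (o : Landmark.Config M n)
    (c : ℝ → EuclideanSpace ℝ (Fin J)) (hc : MemLp c 2 (volume.restrict (Icc (0 : ℝ) T)))
    (γ : ℝ → Landmark.Config M n) (hγ : Landmark.IsTrajectory σ a T o c γ) :
    (Landmark.IsSingularCurve σ a T o γ ↔
      ∃ l : ∀ (r : Fin n) (t : ℝ), TangentSpace (𝓡 d) ((γ t).1 r) →L[ℝ] ℝ,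
        Landmark.IsCostate σ a T c γ l ∧
        (∀ t ∈ Icc 0 T, ∃ r, l r t ≠ 0) ∧
        ∀ j, ∀ t ∈ Icc 0 T, ∑ r, l r t (σ j ((γ t).1 r)) = 0) ∧
    (Landmark.IsMostProbablePath σ a T o γ → ¬ Landmark.IsSingularCurve σ a T o γ →
      ∃ l : ∀ (r : Fin n) (t : ℝ), TangentSpace (𝓡 d) ((γ t).1 r) →L[ℝ] ℝ,
        Landmark.IsCostate σ a T c γ l ∧
        ∀ j, ∀ᵐ t ∂(volume.restrict (Icc (0 : ℝ) T)),
          ∑ r, l r t (σ j ((γ t).1 r)) = c t j) := by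
  have hu : ∀ᵐ t, t ∈ Icc 0 T → hc.toLp c t = c t :=
    (ae_restrict_iff' measurableSet_Icc).1 hc.coeFn_toLp
  have hu' : ∀ᵐ t, t ∈ Icc 0 T → c t = hc.toLp c t := by
    filter_upwards [hu] with t ht htT using (ht htT).symm
  have hγu : Landmark.IsTrajectory σ a T o (hc.toLp c) γ := hγ.congr_control hT.le hu
  -- Singular curves and most probable paths are defined through some control; uniqueness identifies
  -- it with the class of `c`.
  have huniq (v : Landmark.Control J T) (hv : Landmark.IsTrajectory σ a T o v γ) :
      v = hc.toLp c := by
    refine Lp.ext ((ae_restrict_iff' measurableSet_Icc).2 ?_)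
    exact hv.control_unique hT hσ_indep hA1 hγu
  have hsing : Landmark.IsSingularCurve σ a T o γ ↔
      ¬ Landmark.IsRegularControl σ a T o (hc.toLp c) :=
    ⟨fun ⟨v, hv, hvr⟩ => huniq v hv ▸ hvr, fun h => ⟨_, hγu, h⟩⟩
  refine ⟨?_, fun hmpp hns => ?_⟩
  · rw [hsing, hγu.not_isRegularControl_iff_exists_costate hT hσ ha]
    exact ⟨fun ⟨l, h1, h2⟩ => ⟨l, h1.congr_control hT.le hu', h2⟩,
      fun ⟨l, h1, h2⟩ => ⟨l, h1.congr_control hT.le hu, h2⟩⟩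
  · obtain ⟨v, hv, hmin⟩ := hmpp
    rw [hsing, not_not] at hns
    obtain rfl := huniq v hv
    obtain ⟨l, h1, h2⟩ := hγu.exists_costate_of_minimizer hT hσ ha hns hmin
    refine ⟨l, h1.congr_control hT.le hu', fun j => ?_⟩
    filter_upwards [h2 j, hc.coeFn_toLp] with t ht htc
    rw [ht, htc]
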